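/- \textbf{Theorem (Critical Temperature).} Let $V:\mathbb{R}^3\to\mathbb{R}$ with $V\in L^1(\mathbb{R}^3)\cap L^{3/2}(\mathbb{R}^3)$ and let $\mu>0$. Write $\hat V(p)=(2\pi)^{-3/2}\int_{\mathbb{R}^3}V(x)e^{-ip\cdot x}\,dx$. Let $\Omega_\mu=\{p\in\mathbb{R}^3:|p|=\sqrt\mu\}$ be the Fermi sphere with its surface measure $d\omega$, and let $\mathcal V_\mu$ be the bounded self-adjoint operator on $L^2(\Omega_\mu)$ given by $$(\mathcal V_\mu u)(p)=\frac{1}{(2\pi)^{3/2}}\frac1{\sqrt\mu}\int_{\Omega_\mu}\hat V(p-q)\,u(q)\,d\omega(q).$$ For $u\in L^2(\Omega_\mu)$ put $\hat\varphi(p)=(2\pi)^{-3/2}\int_{\Omega_\mu}\hat V(p-q)u(q)\,d\omega(q)$, $p\in\mathbb{R}^3$, and let $\mathcal W_\mu$ be the operator on $L^2(\Omega_\mu)$ defined by its quadratic form $$\langle u|\mathcal W_\mu|u\rangle=\int_0^\infty\left(\frac{r^2}{|r^2-\mu|}\int_{\mathbb S^2}\left(|\hat\varphi(r\theta)|^2-|\hat\varphi(\sqrt\mu\,\theta)|^2\right)d\Omega(\theta)+\int_{\mathbb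 S^2}|\hat\varphi(\sqrt\mu\,\theta)|^2\,d\Omega(\theta)\right)dr .$$ For $\lambda>0$ let $$b_\mu(\lambda)=\inf\operatorname{spec}\left(\lambda\frac{\pi}{2\sqrt\mu}\mathcal V_\mu-\lambda^2\frac{\pi}{2\mu}\mathcal W_\mu\right)$$ (an effective scattering length), and let $$T_c=T_c(\lambda)=\inf\left\{T>0:\ \inf\operatorname{spec}(K_{T,\mu}+\lambda V)\ge 0\right\}$$ be the critical temperature of the BCS equation, where $K_{T,\mu}$ is multiplication by $(p^2-\mu)\,\frac{e^{(p^2-\mu)/T}+1}{e^{(p^2-\mu)/T}-1}$ in momentum space and $K_{T,\mu}+\lambda V$ is the self-adjoint operator on $L^2(\mathbb{R}^3)$ defined as a form sum with form domain $H^1(\mathbb{R}^3)$. Assume that $e_\mu=\inf\operatorname{spec}\mathcal V_\mu<0$. Then the integral defining $\langle u|\mathcal W_\mu|u\rangle$ converges absolutely for every $u$ and defines a bounded operator $\mathcal W_\mu$; the critical temperature satisfies $T_c(\lambda)>0$ for every $\lambda>0$; and $$\lim_{\lambda\downarrow0}\left(\ln\frac{\mu}{T_c(\lambda)}+\frac{\pi}{2\sqrt\mu\,b_\mu(\lambda)}\right)=2-\gamma-\ln(8/\pi),$$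 where $\gamma\approx0.577$ is Euler's constant. -/

import Mathlib

open Real MeasureTheory Filter Topology Set
open scoped ENNReal FourierTransform

noncomputable section

namespace BCS

/-! ### Basic spaces -/

/-- Position / momentum space `ℝ³`. -/
abbrev R3 : Type := EuclideanSpace ℝ (Fin 3)

/-- `L²(ℝ³)`, complex valued, with Lebesgue measure. -/
abbrev L2R3 : Type := Lp ℂ 2 (volume : Measure R3)

/-- The unit sphere `S²`. -/
abbrev S2 : Type := Metric.sphere (0 : R3) 1

/-- The surface measure `dΩ` on `S²` (total mass `4π`). -/
abbrev dOmega : Measure S2 := (volume : Measure R3).toSphere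

/-- The Fermi sphere `Ω_μ`: the sphere in momentum space of radius `√μ`. -/
abbrev FermiSphere (μ : ℝ) : Type := Metric.sphere (0 : R3) (√μ)

/-- The dilation `S² → Ω_μ`, `θ ↦ √μ θ`. -/
def toFermiSphere (μ : ℝ) (θ : S2) : FermiSphere μ :=
  ⟨√μ • (θ : R3), by simp [norm_smul, abs_of_nonneg (Real.sqrt_nonneg μ)]⟩

lemma measurable_toFermiSphere (μ : ℝ) : Measurable (toFermiSphere μ) :=
  (Continuous.subtype_mk (by fun_prop) _).measurable

/-- The uniform (Lebesgue) surface measure `dω` on the Fermi sphere, i.e. `μ dΩ` transported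
along `θ ↦ √μ θ`; its total mass is `4πμ`. -/
def fermiMeasure (μ : ℝ) : Measure (FermiSphere μ) :=
  ENNReal.ofReal μ • Measure.map (toFermiSphere μ) dOmega

/-- `L²(Ω_μ)`, complex valued. -/
abbrev L2Fermi (μ : ℝ) : Type := Lp ℂ 2 (fermiMeasure μ)

instance (μ : ℝ) : IsFiniteMeasure (fermiMeasure μ) := by
  unfold fermiMeasure
  exact Measure.smul_finite _ ENNReal.ofReal_ne_top

/-! ### The Fourier transform of the potential -/

/-- The constant `(2π)^{-3/2}`. -/
def fourierConst : ℂ := (((2 * π) ^ (-(3 / 2) : ℝ) : ℝ) : ℂ)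

/-- `V̂(p) = (2π)^{-3/2} ∫ V(x) e^{-ipx} dx`. -/
def Vhat (V : R3 → ℝ) (p : R3) : ℂ :=
  fourierConst * ∫ x : R3, (V x : ℂ) * Complex.exp (-Complex.I * (inner ℝ p x : ℝ))

/-- `φ̂(p) = (2π)^{-3/2} ∫_{Ω_μ} V̂(p - q) u(q) dω(q)` for `p ∈ ℝ³` and `u ∈ L²(Ω_μ)`. -/
def phiHat (V : R3 → ℝ) (μ : ℝ) (u : L2Fermi μ) (p : R3) : ℂ :=
  fourierConst * ∫ q : FermiSphere μ, Vhat V (p - q) * u q ∂(fermiMeasure μ)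

lemma norm_Vhat_integrand (V : R3 → ℝ) (p x : R3) :
    ‖(V x : ℂ) * Complex.exp (-Complex.I * (inner ℝ p x : ℝ))‖ = ‖V x‖ := by
  rw [norm_mul, Complex.norm_real]
  have : -Complex.I * ((inner ℝ p x : ℝ) : ℂ) = ((-(inner ℝ p x) : ℝ) : ℂ) * Complex.I := by
    push_cast; ring
  rw [this, Complex.norm_exp_ofReal_mul_I, mul_one]

lemma continuous_Vhat (V : R3 → ℝ) : Continuous (Vhat V) := by
  unfold Vhat
  refine continuous_const.mul ?_
  by_cases hV : Integrable V
  · refine continuous_of_dominated (bound := fun x => ‖V x‖) ?_ ?_ hV.norm ?_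
    · intro p
      refine AEStronglyMeasurable.mul ?_ ?_
      · exact Complex.continuous_ofReal.comp_aestronglyMeasurable hV.aestronglyMeasurable
      · exact Continuous.aestronglyMeasurable (by fun_prop)
    · intro p
      exact Eventually.of_forall fun x => (norm_Vhat_integrand V p x).le
    · exact Eventually.of_forall fun x => by fun_prop
  · have h0 : ∀ p : R3,
        ∫ x : R3, (V x : ℂ) * Complex.exp (-Complex.I * (inner ℝ p x : ℝ)) = 0 := by
      intro p
      refine integral_undef fun hI => hV ?_
      have h1 : Integrable (fun x => ((V x : ℂ) *
          Complex.exp (-Complex.I * (inner ℝ p x : ℝ))) *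
            Complex.exp (Complex.I * (inner ℝ p x : ℝ))) := by
        refine hI.mul_bdd (c := 1) (Continuous.aestronglyMeasurable (by fun_prop)) ?_
        refine Eventually.of_forall fun x => ?_
        rw [mul_comm, Complex.norm_exp_ofReal_mul_I]
      have h2 : (fun x => ((V x : ℂ) *
          Complex.exp (-Complex.I * (inner ℝ p x : ℝ))) *
            Complex.exp (Complex.I * (inner ℝ p x : ℝ))) = fun x => (V x : ℂ) := by
        funext x
        rw [mul_assoc, ← Complex.exp_add]
        simp
      rw [h2] at h1
      simpa using h1.re
    simp only [h0]
    exact continuous_const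

lemma norm_Vhat_le (V : R3 → ℝ) (p : R3) : ‖Vhat V p‖ ≤ ‖fourierConst‖ * ∫ x, ‖V x‖ := by
  unfold Vhat
  rw [norm_mul]
  refine mul_le_mul_of_nonneg_left ?_ (norm_nonneg _)
  refine (norm_integral_le_integral_norm _).trans (le_of_eq ?_)
  simp only [norm_Vhat_integrand]

lemma integrable_L2Fermi {μ : ℝ} (u : L2Fermi μ) : Integrable u (fermiMeasure μ) :=
  (Lp.memLp u).integrable (by norm_num)

lemma integrable_kernel (V : R3 → ℝ) {μ : ℝ} (u : L2Fermi μ) (p : R3) :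
    Integrable (fun q : FermiSphere μ => Vhat V (p - q) * u q) (fermiMeasure μ) := by
  refine (integrable_L2Fermi u).bdd_mul (c := ‖fourierConst‖ * ∫ x, ‖V x‖) ?_ ?_
  · exact ((continuous_Vhat V).comp (by fun_prop)).aestronglyMeasurable
  · exact Eventually.of_forall fun q => norm_Vhat_le V _

lemma continuous_phiHat (V : R3 → ℝ) (μ : ℝ) (u : L2Fermi μ) : Continuous (phiHat V μ u) := by
  unfold phiHat
  refine continuous_const.mul ?_
  refine continuous_of_dominated
    (bound := fun q => (‖fourierConst‖ * ∫ x, ‖V x‖) * ‖u q‖) ?_ ?_ ?_ ?_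
  · exact fun p => (integrable_kernel V u p).aestronglyMeasurable
  · intro p
    refine Eventually.of_forall fun q => ?_
    rw [norm_mul]
    exact mul_le_mul_of_nonneg_right (norm_Vhat_le V _) (norm_nonneg _)
  · exact (integrable_L2Fermi u).norm.const_mul _
  · refine Eventually.of_forall fun q => ?_
    exact ((continuous_Vhat V).comp (by fun_prop)).mul continuous_const

lemma phiHat_add (V : R3 → ℝ) (μ : ℝ) (u v : L2Fermi μ) (p : R3) :
    phiHat V μ (u + v) p = phiHat V μ u p + phiHat V μ v p := by
  unfold phiHat
  rw [← mul_add, ← integral_add (integrable_kernel V u p) (integrable_kernel V v p)]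
  refine congrArg (fun z : ℂ => fourierConst * z) (integral_congr_ae ?_)
  filter_upwards [Lp.coeFn_add u v] with q hq
  rw [hq, Pi.add_apply, mul_add]

lemma phiHat_smul (V : R3 → ℝ) (μ : ℝ) (c : ℂ) (u : L2Fermi μ) (p : R3) :
    phiHat V μ (c • u) p = c * phiHat V μ u p := by
  unfold phiHat
  rw [mul_left_comm, ← integral_const_mul c]
  refine congrArg (fun z : ℂ => fourierConst * z) (integral_congr_ae ?_)
  filter_upwards [Lp.coeFn_smul c u] with q hq
  rw [hq, Pi.smul_apply, smul_eq_mul, mul_left_comm]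

lemma exists_integral_norm_le (μ : ℝ) :
    ∃ C : ℝ, 0 ≤ C ∧ ∀ u : L2Fermi μ, ∫ q, ‖u q‖ ∂(fermiMeasure μ) ≤ C * ‖u‖ := by
  refine ⟨((fermiMeasure μ univ) ^ (1 / (1 : ℝ≥0∞).toReal - 1 / (2 : ℝ≥0∞).toReal)).toReal,
    ENNReal.toReal_nonneg, fun u => ?_⟩
  have h := eLpNorm_le_eLpNorm_mul_rpow_measure_univ (μ := fermiMeasure μ) (f := u)
    (p := 1) (q := 2) (by norm_num) (Lp.aestronglyMeasurable u)
  have h1 : ∫ q, ‖u q‖ ∂(fermiMeasure μ) = (eLpNorm u 1 (fermiMeasure μ)).toReal := by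
    rw [integral_norm_eq_lintegral_enorm (Lp.aestronglyMeasurable u), eLpNorm_one_eq_lintegral_enorm]
  rw [h1, Lp.norm_def, ← ENNReal.toReal_mul, mul_comm]
  refine ENNReal.toReal_mono (ENNReal.mul_ne_top (Lp.eLpNorm_ne_top u) ?_) h
  refine ENNReal.rpow_ne_top_of_nonneg ?_ (measure_ne_top _ _)
  norm_num

lemma exists_phiHat_bound (V : R3 → ℝ) (μ : ℝ) :
    ∃ C : ℝ, 0 ≤ C ∧ ∀ (u : L2Fermi μ) (p : R3), ‖phiHat V μ u p‖ ≤ C * ‖u‖ := by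
  obtain ⟨C, hC, h⟩ := exists_integral_norm_le μ
  have hA : 0 ≤ ‖fourierConst‖ * ∫ x, ‖V x‖ := by positivity
  refine ⟨‖fourierConst‖ * ((‖fourierConst‖ * ∫ x, ‖V x‖) * C), by positivity, fun u p => ?_⟩
  unfold phiHat
  rw [norm_mul, mul_assoc, mul_assoc _ C]
  refine mul_le_mul_of_nonneg_left ?_ (norm_nonneg _)
  calc ‖∫ q : FermiSphere μ, Vhat V (p - q) * u q ∂(fermiMeasure μ)‖
      ≤ ∫ q : FermiSphere μ, ‖Vhat V (p - q) * u q‖ ∂(fermiMeasure μ) :=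
        norm_integral_le_integral_norm _
    _ ≤ ∫ q : FermiSphere μ, (‖fourierConst‖ * ∫ x, ‖V x‖) * ‖u q‖ ∂(fermiMeasure μ) := by
        refine integral_mono (integrable_kernel V u p).norm
          ((integrable_L2Fermi u).norm.const_mul _) fun q => ?_
        simp only [norm_mul]
        exact mul_le_mul_of_nonneg_right (norm_Vhat_le V _) (norm_nonneg _)
    _ = (‖fourierConst‖ * ∫ x, ‖V x‖) * ∫ q : FermiSphere μ, ‖u q‖ ∂(fermiMeasure μ) :=
        integral_const_mul _ _
    _ ≤ _ := mul_le_mul_of_nonneg_left (h u) hA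

/-! ### Operators on the Fermi sphere -/

/-- `u ↦ φ̂` restricted to the Fermi sphere, as a bounded operator `L²(Ω_μ) → C(Ω_μ)`. -/
def phiHatOnSphere (V : R3 → ℝ) (μ : ℝ) : L2Fermi μ →L[ℂ] C(FermiSphere μ, ℂ) :=
  LinearMap.mkContinuousOfExistsBound
    { toFun := fun u => ⟨fun p => phiHat V μ u p,
        (continuous_phiHat V μ u).comp continuous_subtype_val⟩
      map_add' := fun u v => by ext p; exact phiHat_add V μ u v p
      map_smul' := fun c u => by ext p; exact phiHat_smul V μ c u p }
    (by
      obtain ⟨C, hC, h⟩ := exists_phiHat_bound V μ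
      refine ⟨C, fun u => ?_⟩
      rw [ContinuousMap.norm_le _ (by positivity)]
      exact fun p => h u p)

/-- The operator `𝒱_μ` on `L²(Ω_μ)`,
`(𝒱_μ u)(p) = (2π)^{-3/2} μ^{-1/2} ∫_{Ω_μ} V̂(p - q) u(q) dω(q)`. -/
def opV (V : R3 → ℝ) (μ : ℝ) : L2Fermi μ →L[ℂ] L2Fermi μ :=
  (1 / √μ : ℝ) • (ContinuousMap.toLp 2 (fermiMeasure μ) ℂ).comp (phiHatOnSphere V μ)

/-- `opV` is given by the integral formula. -/
lemma opV_apply_ae (V : R3 → ℝ) (μ : ℝ) (u : L2Fermi μ) :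
    opV V μ u =ᵐ[fermiMeasure μ] fun p =>
      fourierConst * ((1 / √μ : ℝ) : ℂ) *
        ∫ q : FermiSphere μ, Vhat V ((p : R3) - q) * u q ∂(fermiMeasure μ) := by
  have h1 : opV V μ u = (1 / √μ : ℝ) •
      (ContinuousMap.toLp 2 (fermiMeasure μ) ℂ (phiHatOnSphere V μ u)) := rfl
  rw [h1]
  filter_upwards [Lp.coeFn_smul (1 / √μ : ℝ)
      (ContinuousMap.toLp 2 (fermiMeasure μ) ℂ (phiHatOnSphere V μ u)),
    ContinuousMap.coeFn_toLp (p := 2) (𝕜 := ℂ) (fermiMeasure μ) (phiHatOnSphere V μ u)]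
    with p hp hq
  rw [hp, Pi.smul_apply, hq]
  change (1 / √μ : ℝ) • phiHat V μ u p = _
  rw [phiHat, Complex.real_smul]
  ring

/-- Infimum of the spectrum of a bounded self-adjoint operator. -/
def infSpec {μ : ℝ} (A : L2Fermi μ →L[ℂ] L2Fermi μ) : ℝ := sInf (spectrum ℝ A)

/-- The radial integrand of the quadratic form of `𝒲_μ`, at `|p| = r`:
`r²/|r²-μ| ∫_{S²} (|φ̂(rθ)|² - |φ̂(√μ θ)|²) dΩ(θ) + ∫_{S²} |φ̂(√μ θ)|² dΩ(θ)`. -/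
def formWIntegrand (V : R3 → ℝ) (μ : ℝ) (u : L2Fermi μ) (r : ℝ) : ℝ :=
  r ^ 2 / |r ^ 2 - μ| *
      (∫ θ : S2, (‖phiHat V μ u (r • (θ : R3))‖ ^ 2 - ‖phiHat V μ u (√μ • (θ : R3))‖ ^ 2) ∂dOmega)
    + ∫ θ : S2, ‖phiHat V μ u (√μ • (θ : R3))‖ ^ 2 ∂dOmega

/-- `W` is the bounded operator on `L²(Ω_μ)` whose quadratic form is
`⟨u|𝒲_μ|u⟩ = ∫_0^∞ formWIntegrand dr`, the radial integral being absolutely convergent for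
every `u`. There is at most one such operator, and it is self-adjoint. -/
def HasFormW (V : R3 → ℝ) (μ : ℝ) (W : L2Fermi μ →L[ℂ] L2Fermi μ) : Prop :=
  ∀ u : L2Fermi μ, IntegrableOn (formWIntegrand V μ u) (Ioi 0) ∧
    inner ℂ u (W u) = ((∫ r in Ioi (0 : ℝ), formWIntegrand V μ u r : ℝ) : ℂ)

/-- The operators with the prescribed quadratic form are unique. -/
lemma HasFormW.unique {V : R3 → ℝ} {μ : ℝ} {W W' : L2Fermi μ →L[ℂ] L2Fermi μ}
    (h : HasFormW V μ W) (h' : HasFormW V μ W') : W = W' := by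
  have : (W : L2Fermi μ →ₗ[ℂ] L2Fermi μ) = W' := by
    rw [← ext_inner_map]
    intro u
    have := (h u).2.trans (h' u).2.symm
    have h2 := congrArg (starRingEnd ℂ) this
    rw [inner_conj_symm, inner_conj_symm] at h2
    exact h2
  exact ContinuousLinearMap.coe_injective this

open Classical in
/-- The operator `𝒲_μ` defined via its quadratic form. -/
def opW (V : R3 → ℝ) (μ : ℝ) : L2Fermi μ →L[ℂ] L2Fermi μ :=
  if h : ∃ W, HasFormW V μ W then h.choose else 0

/-- `ℬ_μ = λ π/(2√μ) 𝒱_μ - λ² π/(2μ) 𝒲_μ`. -/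
def opB (V : R3 → ℝ) (μ lam : ℝ) : L2Fermi μ →L[ℂ] L2Fermi μ :=
  (lam * (π / (2 * √μ))) • opV V μ - (lam ^ 2 * (π / (2 * μ))) • opW V μ

/-- `e_μ = inf spec 𝒱_μ`. -/
def eMu (V : R3 → ℝ) (μ : ℝ) : ℝ := infSpec (opV V μ)

/-- `b_μ(λ) = inf spec ℬ_μ`. -/
def bMu (V : R3 → ℝ) (μ lam : ℝ) : ℝ := infSpec (opB V μ lam)

/-! ### The operator `K_{T,μ} + λ V` and the critical temperature -/

section Form

variable {H : Type*} [NormedAddCommGroup H] [InnerProductSpace ℂ H]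

/-- The graph of the operator `A` associated with a sesquilinear form `a` with form domain `D`
(conjugate linear in the first variable):
`ψ ∈ dom A` and `A ψ = f` iff `ψ ∈ D` and `a(φ, ψ) = ⟨φ, f⟩` for all `φ ∈ D`. -/
def FormOp (D : Set H) (a : H → H → ℂ) (ψ f : H) : Prop :=
  ψ ∈ D ∧ ∀ φ ∈ D, a φ ψ = inner ℂ φ f

/-- `z` is in the resolvent set of the operator `A` associated with the form `a`: there is a bounded
everywhere defined two-sided inverse `R` of `A - z : dom A → H`. -/
def InFormResolventSet (D : Set H) (a : H → H → ℂ) (z : ℂ) : Prop :=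
  ∃ R : H →L[ℂ] H,
    (∀ g : H, FormOp D a (R g) (g + z • R g)) ∧
    (∀ ψ f : H, FormOp D a ψ f → R (f - z • ψ) = ψ)

/-- The infimum (in `[-∞, ∞]`) of the real spectrum of the operator associated with the form `a`;
for a self-adjoint operator the whole spectrum is real. -/
def formInfSpec (D : Set H) (a : H → H → ℂ) : EReal :=
  ⨅ x ∈ {x : ℝ | ¬ InFormResolventSet D a (x : ℂ)}, (x : EReal)

end Form

/-- The symbol of `K_{T,μ}`: `(p² - μ) (e^{(p²-μ)/T} + 1) / (e^{(p²-μ)/T} - 1)`. -/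
def kSymbol (T μ : ℝ) (p : R3) : ℝ :=
  (‖p‖ ^ 2 - μ) * (Real.exp ((‖p‖ ^ 2 - μ) / T) + 1) / (Real.exp ((‖p‖ ^ 2 - μ) / T) - 1)

/-- The Sobolev space `H¹(ℝ³)`, as a subset of `L²(ℝ³)`. -/
def H1 : Set L2R3 := {ψ | MemLp (fun ξ : R3 => (‖ξ‖ : ℂ) * (𝓕 ψ : L2R3) ξ) 2}

/-- The form of `K_{T,μ} + λ V` on `H¹(ℝ³)`. Since Mathlib's Fourier transform on `L²(ℝ³)` is the
unitary one with phase `e^{-2πi ξ·x}`, the momentum is `p = 2π ξ`. -/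
def formKV (V : R3 → ℝ) (μ lam T : ℝ) (φ ψ : L2R3) : ℂ :=
  (∫ ξ : R3, (kSymbol T μ ((2 * π) • ξ) : ℂ) *
      (starRingEnd ℂ ((𝓕 φ : L2R3) ξ) * (𝓕 ψ : L2R3) ξ))
    + (lam : ℂ) * ∫ x : R3, (V x : ℂ) * (starRingEnd ℂ (φ x) * ψ x)

/-- `inf spec (K_{T,μ} + λ V)`, where `K_{T,μ} + λ V` is the form sum on `L²(ℝ³)`. -/
def infSpecKV (V : R3 → ℝ) (μ lam T : ℝ) : EReal := formInfSpec H1 (formKV V μ lam T)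

/-- The critical temperature `T_c = inf {T > 0 : inf spec (K_{T,μ} + λ V) ≥ 0}`. -/
def criticalTemperature (V : R3 → ℝ) (μ lam : ℝ) : ℝ :=
  sInf {T : ℝ | 0 < T ∧ 0 ≤ infSpecKV V μ lam T}

end BCS

end

/-!
The proof is a Birman–Schwinger argument carried out on the Fermi sphere.

Let `v = |V|^{1/2}`, `s = sgn V` and let `X = v K_{T,μ}^{-1/2}`, which is bounded by Sobolev's
inequality (`exists_sobolev`, `exists_norm_bsOp_sq_le`). Substituting `ψ = K^{-1/2} f` in the form of
`K_{T,μ} + λV` turns `inf spec (K_{T,μ} + λV) ≥ 0` into `1 + λ X* s X ≥ 0`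
(`zero_le_formInfSpec_iff`, `zero_le_infSpecKV_iff`). The symbol of `K_{T,μ}^{-1}` becomes singular on
the Fermi sphere as `T → 0`, and correspondingly
`X X* = (m(T)/μ) F* F + R_T`, where `F f` is the trace of the Fourier transform of `v f` on the Fermi
sphere and `m(T) = ∫ (r² / K_{T,μ}(r) - 1) dr`. Because the spherical averages of `|(v f)^|²` are
Lipschitz in the radius, uniformly for `‖f‖ ≤ 1` (`abs_sphereDensity_sub_le`), the remainders `R_T`
stay bounded and converge in norm to an operator `R` (`exists_remOp_limit`).

Inverting `s + λ R_T` eliminates the regular part: the condition is equivalent, for small `λ` and `T`,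
to `λ (m(T)/μ) F (s + λ R_T)⁻¹ F* ≥ -1` on `L²(Ω_μ)`
(`neg_one_le_mul_reducedInf`, `mul_reducedInf_le_neg_one`). Here
`F (s + λ R_T)⁻¹ F* = F s F* - λ F s R s F* + o(λ)`, and `F s F* = √μ 𝒱_μ`
(`fermiTrace_signOp_adjoint`), while `F s R s F*` has the form defining `𝒲_μ`
(`hasFormW_of_limit`); so the bottom of the right-hand side is a multiple of `b_μ(λ)` up to `o(λ)`.
Finally `m(T)/√μ = ln(μ/T) + γ - 2 + ln(8/π) + o(1)` (`tendsto_radialM`), and solving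
`λ (m(T)/μ) · (bottom) = -1` for `T` gives the asymptotics of `T_c`
(`threshold_asymptotics`, `criticalTemperature_asymptotics`).
-/

noncomputable section

namespace BCS

/-! ### Lower bounds of self-adjoint operators -/

section Spectrum

variable {H : Type*} [NormedAddCommGroup H] [InnerProductSpace ℂ H]

lemma re_inner_real_smul (c : ℝ) (u w : H) :
    (inner ℂ u (c • w)).re = c * (inner ℂ u w).re := by
  rw [inner_smul_right_eq_smul, Complex.real_smul, Complex.re_ofReal_mul]

lemma re_inner_self (u : H) : (inner ℂ u u).re = ‖u‖ ^ 2 := by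
  rw [inner_self_eq_norm_sq_to_K]
  norm_cast

/-- Cauchy–Schwarz inequality for the quadratic form of a symmetric non-negative operator. -/
lemma sq_re_inner_le_of_nonneg {P : H →L[ℂ] H} (hP : (P : H →ₗ[ℂ] H).IsSymmetric)
    (h0 : ∀ u, 0 ≤ (inner ℂ u (P u)).re) (f g : H) :
    (inner ℂ f (P g)).re ^ 2 ≤ (inner ℂ f (P f)).re * (inner ℂ g (P g)).re := by
  have hs : (inner ℂ g (P f)).re = (inner ℂ f (P g)).re := by
    have := hP g f
    simp only [ContinuousLinearMap.coe_coe] at this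
    rw [← this, ← inner_conj_symm, Complex.conj_re]
  have hq : ∀ t : ℝ, 0 ≤ (inner ℂ g (P g)).re * (t * t) + (2 * (inner ℂ f (P g)).re) * t
      + (inner ℂ f (P f)).re := by
    intro t
    have h := h0 (f + t • g)
    have e : P (f + t • g) = P f + t • P g := by
      rw [map_add, ContinuousLinearMap.map_smul_of_tower]
    rw [e, inner_add_left, inner_add_right, inner_add_right] at h
    simp only [Complex.add_re, re_inner_real_smul] at h
    rw [inner_smul_left_eq_smul, inner_smul_left_eq_smul] at h
    simp only [Complex.real_smul, Complex.re_ofReal_mul, hs] at h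
    linarith
  have := discrim_le_zero hq
  rw [discrim] at this
  nlinarith

lemma abs_re_inner_le (A : H →L[ℂ] H) (u : H) : |(inner ℂ u (A u)).re| ≤ ‖A‖ * ‖u‖ ^ 2 := by
  refine (Complex.abs_re_le_norm _).trans ((norm_inner_le_norm _ _).trans ?_)
  have := A.le_opNorm u
  nlinarith [norm_nonneg u]

variable [CompleteSpace H]

lemma algebraMap_le_iff_re_inner {A : H →L[ℂ] H} (hA : IsSelfAdjoint A) (c : ℝ) :
    algebraMap ℝ (H →L[ℂ] H) c ≤ A ↔ ∀ u, c * ‖u‖ ^ 2 ≤ (inner ℂ u (A u)).re := by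
  have key : ∀ u, (A - algebraMap ℝ (H →L[ℂ] H) c).reApplyInnerSelf u
      = (inner ℂ u (A u)).re - c * ‖u‖ ^ 2 := by
    intro u
    rw [ContinuousLinearMap.reApplyInnerSelf_apply, inner_re_symm,
      Algebra.algebraMap_eq_smul_one, _root_.sub_apply, inner_sub_right,
      _root_.smul_apply, one_apply_eq_self]
    change (inner ℂ u (A u) - inner ℂ u (c • u)).re = _
    rw [Complex.sub_re, re_inner_real_smul, re_inner_self]
  rw [ContinuousLinearMap.le_def, ContinuousLinearMap.isPositive_def]
  constructor
  · rintro ⟨-, h⟩ u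
    have := h u
    rw [key] at this
    linarith
  · intro h
    refine ⟨?_, fun u => by rw [key]; linarith [h u]⟩
    refine ContinuousLinearMap.isSelfAdjoint_iff_isSymmetric.1 (hA.sub ?_)
    exact IsSelfAdjoint.algebraMap _ (by simp [isSelfAdjoint_iff])

lemma bddBelow_spectrum (A : H →L[ℂ] H) : BddBelow (spectrum ℝ A) :=
  (spectrum.isBounded A).bddBelow

lemma sInf_spectrum_mem [Nontrivial H] {A : H →L[ℂ] H} (hA : IsSelfAdjoint A) :
    sInf (spectrum ℝ A) ∈ spectrum ℝ A :=
  (spectrum.isClosed A).csInf_mem (ContinuousFunctionalCalculus.spectrum_nonempty A hA)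
    (bddBelow_spectrum A)

lemma le_sInf_spectrum_iff [Nontrivial H] {A : H →L[ℂ] H} (hA : IsSelfAdjoint A) (c : ℝ) :
    c ≤ sInf (spectrum ℝ A) ↔ ∀ u, c * ‖u‖ ^ 2 ≤ (inner ℂ u (A u)).re := by
  rw [← algebraMap_le_iff_re_inner hA, algebraMap_le_iff_le_spectrum (a := A) (ha := hA)]
  exact ⟨fun h x hx => h.trans (csInf_le (bddBelow_spectrum A) hx),
    fun h => le_csInf (ContinuousFunctionalCalculus.spectrum_nonempty A hA) h⟩

lemma sInf_spectrum_le_add [Nontrivial H] {A B : H →L[ℂ] H} (hA : IsSelfAdjoint A)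
    (hB : IsSelfAdjoint B) : sInf (spectrum ℝ A) ≤ sInf (spectrum ℝ B) + ‖A - B‖ := by
  rw [← sub_le_iff_le_add, le_sInf_spectrum_iff hB]
  intro u
  have h1 := (le_sInf_spectrum_iff hA _).1 le_rfl u
  have h2 := (abs_le.1 (abs_re_inner_le (A - B) u)).2
  rw [_root_.sub_apply, inner_sub_right, Complex.sub_re] at h2
  nlinarith

/-- The infimum of the spectrum is Lipschitz in the operator norm. -/
lemma abs_sInf_spectrum_sub_le [Nontrivial H] {A B : H →L[ℂ] H} (hA : IsSelfAdjoint A)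
    (hB : IsSelfAdjoint B) : |sInf (spectrum ℝ A) - sInf (spectrum ℝ B)| ≤ ‖A - B‖ := by
  have h1 := sInf_spectrum_le_add hA hB
  have h2 := sInf_spectrum_le_add hB hA
  rw [norm_sub_rev] at h2
  exact abs_sub_le_iff.2 ⟨by linarith, by linarith⟩

lemma sInf_spectrum_smul [Nontrivial H] {A : H →L[ℂ] H} (hA : IsSelfAdjoint A) {c : ℝ}
    (hc : 0 < c) : sInf (spectrum ℝ (c • A)) = c * sInf (spectrum ℝ A) := by
  have hcA : IsSelfAdjoint (c • A) := (IsSelfAdjoint.all c).smul hA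
  have e : ∀ u, (inner ℂ u ((c • A) u)).re = c * (inner ℂ u (A u)).re := fun u => by
    rw [show (c • A) u = c • A u from rfl, re_inner_real_smul]
  apply le_antisymm
  · rw [← div_le_iff₀' hc, le_sInf_spectrum_iff hA]
    intro u
    have := (le_sInf_spectrum_iff hcA _).1 le_rfl u
    rw [e] at this
    rw [div_mul_eq_mul_div, div_le_iff₀' hc]
    exact this
  · rw [le_sInf_spectrum_iff hcA]
    intro u
    rw [e, mul_assoc]
    exact mul_le_mul_of_nonneg_left ((le_sInf_spectrum_iff hA _).1 le_rfl u) hc.le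

/-- A self-adjoint operator with a strictly positive lower bound is invertible. -/
lemma isUnit_of_pos_le {A : H →L[ℂ] H} (hA : IsSelfAdjoint A) {δ : ℝ} (hδ : 0 < δ)
    (h : ∀ u, δ * ‖u‖ ^ 2 ≤ (inner ℂ u (A u)).re) : IsUnit A := by
  rw [← spectrum.zero_notMem_iff ℝ]
  intro h0
  have := (algebraMap_le_iff_le_spectrum (a := A) (ha := hA)).1
    ((algebraMap_le_iff_re_inner hA δ).2 h) 0 h0
  linarith

/-- A self-adjoint operator is bounded in norm by a bound of its quadratic form. -/
lemma norm_le_of_abs_re_inner_le {A : H →L[ℂ] H} (hA : IsSelfAdjoint A) {C : ℝ} (hC : 0 < C)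
    (h : ∀ u, |(inner ℂ u (A u)).re| ≤ C * ‖u‖ ^ 2) : ‖A‖ ≤ C := by
  refine A.opNorm_le_bound hC.le fun y => ?_
  have hsym := ContinuousLinearMap.isSelfAdjoint_iff_isSymmetric.1 hA
  have pol : ∀ x : H, 4 * (inner ℂ x (A y)).re ≤ C * (2 * (‖x‖ ^ 2 + ‖y‖ ^ 2)) := by
    intro x
    have hs : (inner ℂ y (A x)).re = (inner ℂ x (A y)).re := by
      have := hsym y x
      simp only [ContinuousLinearMap.coe_coe] at this
      rw [← this, ← inner_conj_symm, Complex.conj_re]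
    have h1 := (abs_le.1 (h (x + y))).2
    have h2 := (abs_le.1 (h (x - y))).1
    have h3 := parallelogram_law_with_norm ℂ x y
    simp only [map_add, map_sub, inner_add_left, inner_add_right, inner_sub_left, inner_sub_right,
      Complex.add_re, Complex.sub_re, hs] at h1 h2
    nlinarith
  have h1 := pol (C⁻¹ • A y)
  rw [inner_smul_left_eq_smul, Complex.real_smul, Complex.re_ofReal_mul,
    re_inner_self, norm_smul, norm_inv, Real.norm_of_nonneg hC.le] at h1
  have h2 : ‖A y‖ ^ 2 ≤ (C * ‖y‖) ^ 2 := by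
    have e : C * (2 * ((C⁻¹ * ‖A y‖) ^ 2 + ‖y‖ ^ 2))
        = 2 * (C⁻¹ * ‖A y‖ ^ 2) + 2 * C * ‖y‖ ^ 2 := by
      field_simp
    rw [e] at h1
    have h3 : C⁻¹ * ‖A y‖ ^ 2 ≤ C * ‖y‖ ^ 2 := by linarith
    rw [inv_mul_le_iff₀ hC] at h3
    nlinarith
  exact le_of_sq_le_sq h2 (by positivity)

end Spectrum

/-! ### Form sums whose form domain is the range of a bounded operator -/

section FormSum

variable {H : Type*} [NormedAddCommGroup H] [InnerProductSpace ℂ H] [CompleteSpace H]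

open ContinuousLinearMap (adjoint)

/-- A form on `range S` that reads `⟨f, Q g⟩` in the coordinates `S f`, `S g`, with `Q` bounded,
self-adjoint and coercive modulo `S* S`. The spectrum of its operator is non-negative
exactly when `Q ≥ 0`. For `x < 0` the resolvent is `S (Q - x S* S)⁻¹ S*`; conversely, if `x < 0`
is the bottom of the form, Cauchy–Schwarz for `Q - x S* S` shows that a bounded resolvent at `x`
would push the bottom of the form strictly above `x`. -/
lemma zero_le_formInfSpec_iff {D : Set H} {a : H → H → ℂ} {S Q : H →L[ℂ] H}
    (hD : D = range S) (ha : ∀ f g, a (S f) (S g) = inner ℂ f (Q g)) (hQ : IsSelfAdjoint Q)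
    {C δ : ℝ} (hC : 0 < C) (hδ : 0 < δ)
    (hcoer : ∀ f, δ * ‖f‖ ^ 2 ≤ (inner ℂ f (Q f)).re + C * ‖S f‖ ^ 2) :
    0 ≤ formInfSpec D a ↔ ∀ f, 0 ≤ (inner ℂ f (Q f)).re := by
  have hP : ∀ x : ℝ, IsSelfAdjoint (Q - x • (adjoint S ∘L S)) := fun x =>
    hQ.sub (IsSelfAdjoint.smul (IsSelfAdjoint.all x)
      (ContinuousLinearMap.IsPositive.isSelfAdjoint
        (ContinuousLinearMap.isPositive_adjoint_comp_self S)))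
  have hPq : ∀ (x : ℝ) f g, inner ℂ f ((Q - x • (adjoint S ∘L S)) g)
      = inner ℂ f (Q g) - x * inner ℂ (S f) (S g) := by
    intro x f g
    rw [_root_.sub_apply, inner_sub_right]
    congr 1
    change inner ℂ f (x • (adjoint S (S g))) = _
    rw [inner_smul_right_eq_smul, Complex.real_smul, ContinuousLinearMap.adjoint_inner_right]
  have hPre : ∀ (x : ℝ) f, (inner ℂ f ((Q - x • (adjoint S ∘L S)) f)).re
      = (inner ℂ f (Q f)).re - x * ‖S f‖ ^ 2 := by
    intro x f
    rw [hPq, Complex.sub_re, Complex.re_ofReal_mul, re_inner_self]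
  constructor
  · intro h
    by_contra! hneg
    obtain ⟨f₀, hf₀⟩ := hneg
    have hSf₀ : 0 < ‖S f₀‖ ^ 2 := by
      by_contra! h0
      have h1 := hcoer f₀
      nlinarith [sq_nonneg ‖S f₀‖, sq_nonneg ‖f₀‖]
    -- The bottom `m` of the form, as an infimum of Rayleigh quotients.
    set Z : Set ℝ := {y | ∃ f, S f ≠ 0 ∧ y = (inner ℂ f (Q f)).re / ‖S f‖ ^ 2} with hZ
    have hZb : BddBelow Z := by
      refine ⟨-C, ?_⟩
      rintro y ⟨f, hf, rfl⟩
      have : 0 < ‖S f‖ := norm_pos_iff.2 hf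
      rw [le_div_iff₀ (by positivity)]
      have := hcoer f
      nlinarith [mul_nonneg hδ.le (sq_nonneg ‖f‖)]
    have hmem : (inner ℂ f₀ (Q f₀)).re / ‖S f₀‖ ^ 2 ∈ Z :=
      ⟨f₀, by rintro h0; simp [h0] at hSf₀, rfl⟩
    set m := sInf Z with hm
    have hm0 : m < 0 := (csInf_le hZb hmem).trans_lt (div_neg_of_neg_of_pos hf₀ hSf₀)
    have hpos : ∀ f, 0 ≤ (inner ℂ f ((Q - m • (adjoint S ∘L S)) f)).re := by
      intro f
      rw [hPre]
      by_cases hf : S f = 0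
      · have := hcoer f
        rw [hf] at this ⊢
        simp only [norm_zero] at this ⊢
        nlinarith [mul_nonneg hδ.le (sq_nonneg ‖f‖)]
      · have h1 : m ≤ (inner ℂ f (Q f)).re / ‖S f‖ ^ 2 := csInf_le hZb ⟨f, hf, rfl⟩
        have : 0 < ‖S f‖ := norm_pos_iff.2 hf
        rw [le_div_iff₀ (by positivity)] at h1
        linarith
    have hres : InFormResolventSet D a (m : ℂ) := by
      by_contra hn
      have h1 : formInfSpec D a ≤ (m : EReal) := iInf₂_le m hn
      have h2 := h.trans h1
      rw [EReal.coe_nonneg] at h2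
      linarith
    obtain ⟨R, hR, -⟩ := hres
    -- Cauchy–Schwarz for `Q - m S* S` between `f` and `g`, where `S g` is the resolvent at `m`
    -- applied to `S f`.
    have hgain : ∀ f, ‖S f‖ ^ 2 ≤ ((inner ℂ f (Q f)).re - m * ‖S f‖ ^ 2) * ‖R‖ := by
      intro f
      obtain ⟨hRD, hRf⟩ := hR (S f)
      rw [hD] at hRD
      obtain ⟨g, hg⟩ := hRD
      have e : ∀ φ : H, inner ℂ φ (Q g) - m * inner ℂ (S φ) (S g) = inner ℂ (S φ) (S f) := by
        intro φ
        have := hRf (S φ) (hD ▸ mem_range_self φ)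
        rw [← hg, ha, inner_add_right, inner_smul_right] at this
        rw [this]
        ring
      have hsym := ContinuousLinearMap.isSelfAdjoint_iff_isSymmetric.1 (hP m)
      have cs := sq_re_inner_le_of_nonneg hsym hpos f g
      rw [hPq, e, hPre, hPq, e, re_inner_self] at cs
      have h3 : (inner ℂ (S g) (S f)).re ≤ ‖R‖ * ‖S f‖ ^ 2 := by
        rw [hg, ← inner_conj_symm, Complex.conj_re]
        exact (le_abs_self _).trans (abs_re_inner_le R (S f))
      have h4 := hpos f
      rw [hPre] at h4
      have h5 : (‖S f‖ ^ 2) ^ 2 ≤ ((inner ℂ f (Q f)).re - m * ‖S f‖ ^ 2) * (‖R‖ * ‖S f‖ ^ 2) :=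
        cs.trans (mul_le_mul_of_nonneg_left h3 h4)
      rcases (sq_nonneg ‖S f‖).eq_or_lt with h6 | h6
      · rw [← h6]
        rw [← h6] at h4
        exact mul_nonneg h4 (norm_nonneg _)
      · refine le_of_mul_le_mul_right ?_ h6
        nlinarith
    have hRpos : 0 < ‖R‖ := by
      by_contra! h0
      have h1 := hgain f₀
      have : ‖R‖ = 0 := le_antisymm h0 (norm_nonneg _)
      rw [this, mul_zero] at h1
      linarith
    -- The last bound says that every Rayleigh quotient is at least `m + ‖R‖⁻¹`.
    have : m + ‖R‖⁻¹ ≤ m := by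
      refine le_csInf ⟨_, hmem⟩ ?_
      rintro y ⟨f, hf, rfl⟩
      have h0 : 0 < ‖S f‖ := norm_pos_iff.2 hf
      rw [le_div_iff₀ (by positivity)]
      have h1 := hgain f
      rw [← div_le_iff₀ hRpos] at h1
      rw [add_mul, inv_mul_eq_div]
      linarith
    linarith [inv_pos.2 hRpos]
  · intro h
    refine le_iInf₂ fun x hx => ?_
    rw [EReal.coe_nonneg]
    by_contra! hx0
    refine hx ?_
    -- `t` with `t C ≤ -x` and `t ≤ 1`
    set t : ℝ := -x / (C - x) with ht
    have hCx : 0 < C - x := by linarith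
    have ht0 : 0 < t := div_pos (by linarith) hCx
    have ht1 : t ≤ 1 := by rw [ht, div_le_one hCx]; linarith
    have htC : t * C ≤ -x := by
      rw [ht, div_mul_eq_mul_div, div_le_iff₀ hCx]; nlinarith
    have hunit : IsUnit (Q - x • (adjoint S ∘L S)) := by
      refine isUnit_of_pos_le (hP x) (mul_pos ht0 hδ) fun u => ?_
      rw [hPre]
      have h1 := hcoer u
      have h2 := h u
      have h3 := mul_le_mul_of_nonneg_left h1 ht0.le
      have h4 := mul_le_mul_of_nonneg_right htC (sq_nonneg ‖S u‖)
      nlinarith [mul_nonneg (sub_nonneg.2 ht1) h2]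
    obtain ⟨w, hw⟩ := hunit
    have hwr : ∀ y, (Q - x • (adjoint S ∘L S)) (((w⁻¹ : (H →L[ℂ] H)ˣ) : H →L[ℂ] H) y) = y := fun y => by
      rw [← hw]
      change ((w : H →L[ℂ] H) * ((w⁻¹ : (H →L[ℂ] H)ˣ) : H →L[ℂ] H)) y = y
      rw [Units.mul_inv]; rfl
    have hwl : ∀ y, ((w⁻¹ : (H →L[ℂ] H)ˣ) : H →L[ℂ] H) ((Q - x • (adjoint S ∘L S)) y) = y :=
      fun y => by
      rw [← hw]
      change (((w⁻¹ : (H →L[ℂ] H)ˣ) : H →L[ℂ] H) * (w : H →L[ℂ] H)) y = y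
      rw [Units.inv_mul]; rfl
    refine ⟨S ∘L ((w⁻¹ : (H →L[ℂ] H)ˣ) : H →L[ℂ] H) ∘L adjoint S, fun g => ⟨?_, ?_⟩, ?_⟩
    · rw [hD]; exact mem_range_self _
    · intro φ hφ
      rw [hD] at hφ
      obtain ⟨f, rfl⟩ := hφ
      simp only [ContinuousLinearMap.comp_apply]
      set y := ((w⁻¹ : (H →L[ℂ] H)ˣ) : H →L[ℂ] H) (adjoint S g) with hy
      have h1 := hPq x f y
      rw [hwr (adjoint S g), ContinuousLinearMap.adjoint_inner_right] at h1
      rw [ha, inner_add_right, inner_smul_right, h1]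
      ring
    · rintro ψ F ⟨hψ, hF⟩
      rw [hD] at hψ
      obtain ⟨g, rfl⟩ := hψ
      simp only [ContinuousLinearMap.comp_apply]
      have h1 : adjoint S (F - (x : ℂ) • S g) = (Q - x • (adjoint S ∘L S)) g := by
        refine ext_inner_left ℂ fun f => ?_
        have := hF (S f) (hD ▸ mem_range_self f)
        rw [ContinuousLinearMap.adjoint_inner_right, hPq, inner_sub_right, inner_smul_right,
          ← this, ha]
      rw [h1, hwl]

end FormSum

end BCS

namespace BCS

/-! ### The Birman–Schwinger principle -/

section BirmanSchwinger

open ContinuousLinearMap (adjoint)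

/-- Invertibility of `1 + B A` passes to `1 + A B`, whose inverse is `1 - A (1 + B A)⁻¹ B`. -/
lemma isUnit_one_add_comp_comm {H K : Type*} [NormedAddCommGroup H] [InnerProductSpace ℂ H]
    [NormedAddCommGroup K] [InnerProductSpace ℂ K] {A : H →L[ℂ] K} {B : K →L[ℂ] H}
    (h : IsUnit (1 + B ∘L A)) : IsUnit (1 + A ∘L B) := by
  obtain ⟨w, hw⟩ := h
  set N : H →L[ℂ] H := ((w⁻¹ : (H →L[ℂ] H)ˣ) : H →L[ℂ] H) with hN
  have h1 : ∀ x, N x + B (A (N x)) = x := fun x => by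
    have : ((w : H →L[ℂ] H) * N) x = x := by rw [hN, Units.mul_inv]; rfl
    rwa [hw] at this
  have h2 : ∀ x, N (x + B (A x)) = x := fun x => by
    have : (N * (w : H →L[ℂ] H)) x = x := by rw [hN, Units.inv_mul]; rfl
    rwa [hw] at this
  refine isUnit_iff_exists.2 ⟨1 - A ∘L N ∘L B, ?_, ?_⟩
  · ext y
    change y - A (N (B y)) + A (B (y - A (N (B y)))) = y
    have := congrArg A (h1 (B y))
    rw [map_add] at this
    rw [map_sub, map_sub, ← this]
    abel
  · ext y
    change y + A (B y) - A (N (B (y + A (B y)))) = y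
    rw [map_add B, h2 (B y)]
    abel

variable {H K Ω : Type*}
  [NormedAddCommGroup H] [InnerProductSpace ℂ H] [CompleteSpace H]
  [NormedAddCommGroup K] [InnerProductSpace ℂ K] [CompleteSpace K]
  [NormedAddCommGroup Ω] [InnerProductSpace ℂ Ω] [CompleteSpace Ω]

/-- The inverse `(s + a R)⁻¹`, used for symmetries `s` (`s² = 1`) and small `a`, when it equals
`(1 + a s R)⁻¹ s`. -/
def dressedInv (s R : K →L[ℂ] K) (a : ℝ) : K →L[ℂ] K := Ring.inverse (s + a • R)

/-- The operator `F (s + a R)⁻¹ F*` to which the Birman–Schwinger operator reduces once the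
singular rank-`F` part has been split off. -/
def reducedOp (F : K →L[ℂ] Ω) (s R : K →L[ℂ] K) (a : ℝ) : Ω →L[ℂ] Ω :=
  F ∘L dressedInv s R a ∘L adjoint F

variable {s R : K →L[ℂ] K}

lemma isUnit_add_smul (hs2 : s * s = 1) (hs1 : ‖s‖ ≤ 1) {a : ℝ} (ha : |a| * ‖R‖ ≤ 1 / 2) :
    IsUnit (s + a • R) := by
  have e : s + a • R = s * (1 - (-(a • (s * R)))) := by
    rw [sub_neg_eq_add, mul_add, mul_one, mul_smul_comm, ← mul_assoc, hs2, one_mul]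
  rw [e]
  refine IsUnit.mul (isUnit_iff_exists.2 ⟨s, hs2, hs2⟩) (isUnit_one_sub_of_norm_lt_one ?_)
  rw [norm_neg, norm_smul, Real.norm_eq_abs]
  have : ‖s * R‖ ≤ ‖R‖ := (norm_mul_le _ _).trans (by nlinarith [norm_nonneg R])
  nlinarith [abs_nonneg a]

lemma dressedInv_mul (hs2 : s * s = 1) (hs1 : ‖s‖ ≤ 1) {a : ℝ} (ha : |a| * ‖R‖ ≤ 1 / 2) :
    dressedInv s R a * (s + a • R) = 1 :=
  Ring.inverse_mul_cancel _ (isUnit_add_smul hs2 hs1 ha)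

lemma mul_dressedInv (hs2 : s * s = 1) (hs1 : ‖s‖ ≤ 1) {a : ℝ} (ha : |a| * ‖R‖ ≤ 1 / 2) :
    (s + a • R) * dressedInv s R a = 1 :=
  Ring.mul_inverse_cancel _ (isUnit_add_smul hs2 hs1 ha)

lemma dressedInv_eq (hs2 : s * s = 1) (hs1 : ‖s‖ ≤ 1) {a : ℝ} (ha : |a| * ‖R‖ ≤ 1 / 2) :
    dressedInv s R a = s - a • (s * R * dressedInv s R a) := by
  have h := congrArg (s * ·) (mul_dressedInv (R := R) hs2 hs1 ha)
  simp only [mul_one, add_mul, mul_add, ← mul_assoc, hs2, one_mul, smul_mul_assoc,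
    mul_smul_comm] at h
  exact eq_sub_of_add_eq h

lemma norm_dressedInv_le (hs2 : s * s = 1) (hs1 : ‖s‖ ≤ 1) {a : ℝ} (ha : |a| * ‖R‖ ≤ 1 / 2) :
    ‖dressedInv s R a‖ ≤ 2 := by
  have h := congrArg norm (dressedInv_eq (R := R) hs2 hs1 ha)
  have h1 : ‖s - a • (s * R * dressedInv s R a)‖
      ≤ ‖s‖ + |a| * (‖s‖ * ‖R‖ * ‖dressedInv s R a‖) := by
    refine (norm_sub_le _ _).trans ?_
    rw [norm_smul, Real.norm_eq_abs]
    gcongr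
    exact (norm_mul_le _ _).trans (mul_le_mul_of_nonneg_right (norm_mul_le _ _) (norm_nonneg _))
  have h2 : |a| * (‖s‖ * ‖R‖ * ‖dressedInv s R a‖) ≤ 1 / 2 * ‖dressedInv s R a‖ := by
    have : |a| * (‖s‖ * ‖R‖) ≤ 1 / 2 := by
      have := mul_nonneg (abs_nonneg a) (norm_nonneg R)
      nlinarith [norm_nonneg s]
    calc _ = |a| * (‖s‖ * ‖R‖) * ‖dressedInv s R a‖ := by ring
      _ ≤ _ := mul_le_mul_of_nonneg_right this (norm_nonneg _)
  linarith

/-- Second order expansion of the dressed inverse. -/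
lemma norm_dressedInv_sub_le (hs2 : s * s = 1) (hs1 : ‖s‖ ≤ 1) {a : ℝ}
    (ha : |a| * ‖R‖ ≤ 1 / 2) :
    ‖dressedInv s R a - (s - a • (s * R * s))‖ ≤ 2 * a ^ 2 * ‖R‖ ^ 2 := by
  have h := dressedInv_eq (R := R) hs2 hs1 ha
  have e : dressedInv s R a - (s - a • (s * R * s))
      = (a * a) • (s * R * (s * R * dressedInv s R a)) := by
    conv_lhs => rw [h, h]
    rw [mul_sub, mul_smul_comm, smul_sub, smul_smul]
    abel
  rw [e, norm_smul, Real.norm_eq_abs, abs_mul_self]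
  have h3 : ∀ Y : K →L[ℂ] K, ‖s * R * Y‖ ≤ ‖R‖ * ‖Y‖ := fun Y =>
    (norm_mul_le _ _).trans (mul_le_mul_of_nonneg_right ((norm_mul_le _ _).trans
      (by nlinarith [norm_nonneg R])) (norm_nonneg _))
  have h1 : ‖s * R * (s * R * dressedInv s R a)‖ ≤ ‖R‖ * (‖R‖ * 2) :=
    (h3 _).trans (mul_le_mul_of_nonneg_left ((h3 _).trans
      (mul_le_mul_of_nonneg_left (norm_dressedInv_le hs2 hs1 ha) (norm_nonneg _))) (norm_nonneg _))
  nlinarith [mul_self_nonneg a]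

lemma norm_dressedInv_sub_dressedInv_le (hs2 : s * s = 1) (hs1 : ‖s‖ ≤ 1) {a b : ℝ}
    (ha : |a| * ‖R‖ ≤ 1 / 2) (hb : |b| * ‖R‖ ≤ 1 / 2) :
    ‖dressedInv s R a - dressedInv s R b‖ ≤ 4 * ‖R‖ * |a - b| := by
  have e : dressedInv s R a - dressedInv s R b
      = (b - a) • (dressedInv s R a * R * dressedInv s R b) := by
    have h1 : dressedInv s R a = dressedInv s R a * ((s + b • R) * dressedInv s R b) := by
      rw [mul_dressedInv hs2 hs1 hb, mul_one]
    have h2 : dressedInv s R b = dressedInv s R a * (s + a • R) * dressedInv s R b := by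
      rw [dressedInv_mul hs2 hs1 ha, one_mul]
    conv_lhs => rw [h1]
    conv_lhs => enter [2]; rw [h2]
    rw [← mul_assoc, ← sub_mul, ← mul_sub, add_sub_add_left_eq_sub, ← sub_smul, mul_smul_comm,
      smul_mul_assoc]
  rw [e, norm_smul, Real.norm_eq_abs, abs_sub_comm b a]
  have h1 := norm_dressedInv_le (R := R) hs2 hs1 ha
  have h2 := norm_dressedInv_le (R := R) hs2 hs1 hb
  have h3 : ‖dressedInv s R a * R * dressedInv s R b‖ ≤ 2 * ‖R‖ * 2 :=
    (norm_mul_le _ _).trans (mul_le_mul ((norm_mul_le _ _).trans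
      (mul_le_mul_of_nonneg_right h1 (norm_nonneg _))) h2 (norm_nonneg _) (by positivity))
  nlinarith [abs_nonneg (a - b)]

lemma isSelfAdjoint_reducedOp (F : K →L[ℂ] Ω) (hs : IsSelfAdjoint s) (hR : IsSelfAdjoint R)
    (a : ℝ) : IsSelfAdjoint (reducedOp F s R a) := by
  refine IsSelfAdjoint.conj_adjoint ?_ F
  have h : IsSelfAdjoint (s + a • R) := hs.add ((IsSelfAdjoint.all a).smul hR)
  rw [isSelfAdjoint_iff, dressedInv, ← Ring.inverse_star, h.star_eq]

lemma norm_comp_adjoint_le (F : K →L[ℂ] Ω) (N : K →L[ℂ] K) :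
    ‖F ∘L N ∘L adjoint F‖ ≤ ‖F‖ ^ 2 * ‖N‖ := by
  have h1 := ContinuousLinearMap.opNorm_comp_le F (N ∘L adjoint F)
  have h2 := ContinuousLinearMap.opNorm_comp_le N (adjoint F)
  rw [LinearIsometryEquiv.norm_map] at h2
  nlinarith [norm_nonneg F]

/-- The bottom of the spectrum of the reduced operator. -/
def reducedInf (F : K →L[ℂ] Ω) (s R : K →L[ℂ] K) (a : ℝ) : ℝ :=
  sInf (spectrum ℝ (reducedOp F s R a))

lemma abs_reducedInf_sub_le [Nontrivial Ω] (F : K →L[ℂ] Ω) (hs : IsSelfAdjoint s)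
    (hR : IsSelfAdjoint R) (hs2 : s * s = 1) (hs1 : ‖s‖ ≤ 1) {a b : ℝ}
    (ha : |a| * ‖R‖ ≤ 1 / 2) (hb : |b| * ‖R‖ ≤ 1 / 2) :
    |reducedInf F s R a - reducedInf F s R b| ≤ 4 * ‖F‖ ^ 2 * ‖R‖ * |a - b| := by
  refine (abs_sInf_spectrum_sub_le (isSelfAdjoint_reducedOp F hs hR a)
    (isSelfAdjoint_reducedOp F hs hR b)).trans ?_
  have e : reducedOp F s R a - reducedOp F s R b
      = F ∘L (dressedInv s R a - dressedInv s R b) ∘L adjoint F := by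
    ext u
    simp [reducedOp]
  rw [e]
  refine (norm_comp_adjoint_le _ _).trans ?_
  have := norm_dressedInv_sub_dressedInv_le (R := R) hs2 hs1 ha hb
  nlinarith [sq_nonneg ‖F‖]

/-- The Birman–Schwinger operator `1 + a X* s X` is invertible exactly when the reduced one is,
if `X X* = c F* F + R`. -/
lemma isUnit_one_add_iff {X : H →L[ℂ] K} {F : K →L[ℂ] Ω} {c : ℝ}
    (hX : X ∘L adjoint X = c • (adjoint F ∘L F) + R) (hs2 : s * s = 1) (hs1 : ‖s‖ ≤ 1) {a : ℝ}
    (ha : |a| * ‖R‖ ≤ 1 / 2) :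
    IsUnit (1 + a • (adjoint X ∘L s ∘L X)) ↔ IsUnit (1 + (a * c) • reducedOp F s R a) := by
  have hsu : IsUnit s := isUnit_iff_exists.2 ⟨s, hs2, hs2⟩
  have hNu := isUnit_add_smul (R := R) hs2 hs1 ha
  set N := dressedInv s R a with hN
  have e1 : IsUnit (1 + a • (adjoint X ∘L s ∘L X)) ↔ IsUnit (1 + X ∘L (a • (adjoint X ∘L s))) :=
    ⟨fun h => isUnit_one_add_comp_comm (A := X) (B := a • (adjoint X ∘L s)) h,
      fun h => isUnit_one_add_comp_comm (A := a • (adjoint X ∘L s)) (B := X) h⟩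
  have e2 : 1 + X ∘L (a • (adjoint X ∘L s))
      = (s + a • R) * (1 + ((a * c) • (N ∘L adjoint F)) ∘L F) * s := by
    have h1 : X ∘L (a • (adjoint X ∘L s)) = a • ((X ∘L adjoint X) * s) := by
      ext u; simp
    have h2 : ((a * c) • (N ∘L adjoint F)) ∘L F = (a * c) • (N * (adjoint F ∘L F)) := by
      ext u; simp
    rw [h1, h2, hX, mul_add, mul_one, mul_smul_comm, ← mul_assoc, mul_dressedInv hs2 hs1 ha,
      one_mul, add_mul, add_mul, add_mul, hs2, smul_add, smul_mul_assoc, smul_mul_assoc,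
      smul_mul_assoc, smul_smul]
    abel
  have e3 : IsUnit ((s + a • R) * (1 + ((a * c) • (N ∘L adjoint F)) ∘L F) * s)
      ↔ IsUnit (1 + ((a * c) • (N ∘L adjoint F)) ∘L F) := by
    constructor
    · intro h
      obtain ⟨p, hp⟩ := hNu
      obtain ⟨q, hq⟩ := hsu
      rw [← hp, ← hq] at h
      exact (Units.isUnit_units_mul p _).1 ((Units.isUnit_mul_units _ q).1 h)
    · exact fun h => (hNu.mul h).mul hsu
  have e4 : F ∘L ((a * c) • (N ∘L adjoint F)) = (a * c) • reducedOp F s R a := by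
    ext u; simp [reducedOp, hN]
  rw [e1, e2, e3, ← e4]
  exact ⟨fun h => isUnit_one_add_comp_comm (A := F) h, fun h => isUnit_one_add_comp_comm (B := F) h⟩

lemma re_inner_one_add_smul {H : Type*} [NormedAddCommGroup H] [InnerProductSpace ℂ H]
    (B : H →L[ℂ] H) (a : ℝ) (f : H) :
    (inner ℂ f ((1 + a • B) f)).re = ‖f‖ ^ 2 + a * (inner ℂ f (B f)).re := by
  change (inner ℂ f (f + a • B f)).re = _
  rw [inner_add_right, Complex.add_re, re_inner_self, re_inner_real_smul]

lemma isUnit_one_add_smul_of_nonneg {B : H →L[ℂ] H} (hB : IsSelfAdjoint B) {a t : ℝ}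
    (hpos : ∀ f, 0 ≤ ‖f‖ ^ 2 + a * (inner ℂ f (B f)).re) (ht0 : 0 ≤ t) (ht1 : t < 1) :
    IsUnit (1 + (t * a) • B) := by
  refine isUnit_of_pos_le (δ := 1 - t) ?_ (by linarith) fun u => ?_
  · exact (IsSelfAdjoint.one _).add ((IsSelfAdjoint.all (t * a)).smul hB)
  · rw [re_inner_one_add_smul]
    nlinarith [hpos u]

section Criterion

variable {X : H →L[ℂ] K} {F : K →L[ℂ] Ω} {c a : ℝ}

/-- If `1 + a X* s X ≥ 0` then the reduced operator satisfies `1 + a c F (s + a R)⁻¹ F* ≥ 0`: the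
bottom of `1 + t a c F (s + t a R)⁻¹ F*` depends continuously on `t`, and it cannot
vanish for `t < 1` because `1 + t a X* s X` is invertible. -/
lemma neg_one_le_mul_reducedInf [Nontrivial Ω]
    (hX : X ∘L adjoint X = c • (adjoint F ∘L F) + R) (hs : IsSelfAdjoint s)
    (hR : IsSelfAdjoint R) (hs2 : s * s = 1) (hs1 : ‖s‖ ≤ 1) (ha0 : 0 < a)
    (ha : a * ‖R‖ ≤ 1 / 2)
    (hpos : ∀ f, 0 ≤ ‖f‖ ^ 2 + a * (inner ℂ f ((adjoint X ∘L s ∘L X) f)).re) :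
    -1 ≤ a * c * reducedInf F s R a := by
  by_contra! hlt
  have hta : ∀ t ∈ Icc (0 : ℝ) 1, |t * a| * ‖R‖ ≤ 1 / 2 := by
    intro t ht
    rw [abs_of_nonneg (mul_nonneg ht.1 ha0.le)]
    nlinarith [ht.1, ht.2, norm_nonneg R, mul_nonneg ha0.le (norm_nonneg R)]
  have hcont : ContinuousOn (fun t : ℝ => t * a * c * reducedInf F s R (t * a)) (Icc 0 1) := by
    refine ContinuousOn.mul (by fun_prop) ?_
    have hL : LipschitzOnWith (Real.toNNReal (4 * ‖F‖ ^ 2 * ‖R‖ * a))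
        (fun t : ℝ => reducedInf F s R (t * a)) (Icc 0 1) := by
      refine LipschitzOnWith.of_dist_le_mul fun x hx y hy => ?_
      rw [Real.dist_eq, Real.dist_eq, Real.coe_toNNReal _ (by positivity)]
      refine (abs_reducedInf_sub_le F hs hR hs2 hs1 (hta x hx) (hta y hy)).trans (le_of_eq ?_)
      rw [← sub_mul, abs_mul, abs_of_pos ha0]
      ring
    exact hL.continuousOn
  -- At this `t` the bottom of the spectrum of the reduced operator is `-1 / (t a c)`.
  obtain ⟨t, ht, hteq⟩ := intermediate_value_Icc' zero_le_one hcont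
    (show (-1 : ℝ) ∈ Icc _ _ by constructor <;> (simp; try linarith))
  have ht1 : t < 1 := by
    refine lt_of_le_of_ne ht.2 ?_
    rintro rfl
    simp only [one_mul] at hteq
    linarith
  have hB : IsSelfAdjoint (adjoint X ∘L s ∘L X) := by
    have := IsSelfAdjoint.adjoint_conj hs X
    exact this
  have hu := (isUnit_one_add_iff hX hs2 hs1 (hta t ht)).1
    (isUnit_one_add_smul_of_nonneg hB hpos ht.1 ht1)
  have hmem := sInf_spectrum_mem (isSelfAdjoint_reducedOp F hs hR (t * a))
  rw [spectrum.mem_iff] at hmem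
  refine hmem ?_
  have hk : t * a * c ≠ 0 := by
    intro h0
    simp [h0] at hteq
  have e : algebraMap ℝ (Ω →L[ℂ] Ω) (reducedInf F s R (t * a)) - reducedOp F s R (t * a)
      = -(t * a * c)⁻¹ • (1 + (t * a * c) • reducedOp F s R (t * a)) := by
    have : reducedInf F s R (t * a) = -(t * a * c)⁻¹ := by
      rw [eq_neg_iff_add_eq_zero, ← mul_right_inj' hk, mul_add, mul_inv_cancel₀ hk, mul_zero]
      linarith
    rw [this, Algebra.algebraMap_eq_smul_one, smul_add, smul_smul, neg_mul, inv_mul_cancel₀ hk,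
      neg_one_smul, sub_eq_add_neg]
  change IsUnit (algebraMap ℝ (Ω →L[ℂ] Ω) (reducedInf F s R (t * a)) - reducedOp F s R (t * a))
  rw [e]
  exact hu.smul (Units.mk0 (-(t * a * c)⁻¹) (neg_ne_zero.2 (inv_ne_zero hk)))

/-- If `1 + a X* s X` is not non-negative then the reduced operator has a bottom at most
`-1 / (a c)`. -/
lemma mul_reducedInf_le_neg_one [Nontrivial Ω]
    (hX : X ∘L adjoint X = c • (adjoint F ∘L F) + R) (hs : IsSelfAdjoint s)
    (hR : IsSelfAdjoint R) (hs2 : s * s = 1) (hs1 : ‖s‖ ≤ 1) (hc : 0 < c) (ha0 : 0 < a)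
    (ha : a * ‖R‖ ≤ 1 / 2)
    (hneg : ¬ ∀ f, 0 ≤ ‖f‖ ^ 2 + a * (inner ℂ f ((adjoint X ∘L s ∘L X) f)).re)
    (hsmall : reducedInf F s R 0 + 2 * (4 * ‖F‖ ^ 2 * ‖R‖) * a ≤ 0) :
    a * c * reducedInf F s R a ≤ -1 := by
  have hB : IsSelfAdjoint (adjoint X ∘L s ∘L X) := IsSelfAdjoint.adjoint_conj hs X
  have haB : IsSelfAdjoint (a • (adjoint X ∘L s ∘L X)) := (IsSelfAdjoint.all a).smul hB
  have hnt : Nontrivial H := by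
    by_contra hn
    rw [not_nontrivial_iff_subsingleton] at hn
    refine hneg fun f => ?_
    rw [Subsingleton.elim f 0]
    simp
  set β := sInf (spectrum ℝ (a • (adjoint X ∘L s ∘L X))) with hβ
  have hβ1 : β < -1 := by
    by_contra! h
    refine hneg fun f => ?_
    have h1 := (le_sInf_spectrum_iff haB _).1 h f
    rw [show (a • (adjoint X ∘L s ∘L X)) f = a • ((adjoint X ∘L s ∘L X) f) from rfl,
      re_inner_real_smul] at h1
    linarith
  have hmem := sInf_spectrum_mem haB
  rw [← hβ, spectrum.mem_iff] at hmem
  -- Scaling by `t` moves the bottom `β` of `a X* s X` to `-1`, so `1 + t a X* s X` is singular.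
  set t := -β⁻¹ with ht
  have ht0 : 0 < t := by rw [ht, neg_pos]; exact inv_lt_zero.2 (by linarith)
  have htβ : t * β = -1 := by rw [ht, neg_mul, inv_mul_cancel₀ (by linarith)]
  have ht1 : t < 1 := by nlinarith
  have hta : |t * a| * ‖R‖ ≤ 1 / 2 := by
    rw [abs_of_nonneg (mul_nonneg ht0.le ha0.le)]
    nlinarith [norm_nonneg R, mul_nonneg ha0.le (norm_nonneg R)]
  have haa : |a| * ‖R‖ ≤ 1 / 2 := by rwa [abs_of_pos ha0]
  have hnu : ¬ IsUnit (1 + (t * a) • (adjoint X ∘L s ∘L X)) := by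
    intro hu
    refine hmem ?_
    have e : algebraMap ℝ (H →L[ℂ] H) β - a • (adjoint X ∘L s ∘L X)
        = β • (1 + (t * a) • (adjoint X ∘L s ∘L X)) := by
      rw [smul_add, smul_smul, ← mul_assoc, mul_comm β t, htβ, Algebra.algebraMap_eq_smul_one,
        neg_one_mul, neg_smul, sub_eq_add_neg]
    rw [e]
    exact hu.smul (Units.mk0 β (by linarith))
  rw [isUnit_one_add_iff hX hs2 hs1 hta] at hnu
  have hk : 0 < t * a * c := by positivity
  have hg : reducedInf F s R (t * a) ≤ -(t * a * c)⁻¹ := by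
    refine csInf_le (bddBelow_spectrum _) ?_
    rw [spectrum.mem_iff]
    intro hu
    refine hnu ?_
    have e : 1 + (t * a * c) • reducedOp F s R (t * a) = -(t * a * c) •
        (algebraMap ℝ (Ω →L[ℂ] Ω) (-(t * a * c)⁻¹) - reducedOp F s R (t * a)) := by
      rw [smul_sub, Algebra.algebraMap_eq_smul_one, smul_smul, neg_mul_neg, mul_inv_cancel₀ hk.ne',
        one_smul, neg_smul, sub_neg_eq_add]
    rw [e]
    exact hu.smul (Units.mk0 (-(t * a * c)) (neg_ne_zero.2 hk.ne'))
  have hg1 : t * a * c * reducedInf F s R (t * a) ≤ -1 := by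
    have := mul_le_mul_of_nonneg_left hg hk.le
    rwa [mul_neg, mul_inv_cancel₀ hk.ne'] at this
  have h1 := (abs_le.1 (abs_reducedInf_sub_le F hs hR hs2 hs1 haa hta)).2
  have h2 := (abs_le.1 (abs_reducedInf_sub_le F hs hR hs2 hs1 hta
    (show |(0 : ℝ)| * ‖R‖ ≤ 1 / 2 by simp))).2
  have e1 : |a - t * a| = (1 - t) * a := by
    rw [abs_of_nonneg (by nlinarith)]; ring
  have e2 : |t * a - 0| = t * a := by rw [sub_zero, abs_of_nonneg (by positivity)]
  rw [e1] at h1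
  rw [e2] at h2
  set L := 4 * ‖F‖ ^ 2 * ‖R‖ with hL
  have hL0 : 0 ≤ L := by positivity
  -- With `g` for `reducedInf` and `L` for its Lipschitz constant, `g a ≤ g (t a) + L (1 - t) a` and
  -- `g (t a) ≤ g 0 + L t a`; hence `g a - t g (t a) ≤ (1 - t) (g 0 + 2 L a) ≤ 0`.
  have h3 : reducedInf F s R a ≤ t * reducedInf F s R (t * a) := by
    nlinarith [mul_nonneg hL0 ha0.le, mul_nonneg (mul_nonneg hL0 ha0.le) (sub_nonneg.2 ht1.le)]
  calc a * c * reducedInf F s R a ≤ a * c * (t * reducedInf F s R (t * a)) :=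
        mul_le_mul_of_nonneg_left h3 (by positivity)
    _ = t * a * c * reducedInf F s R (t * a) := by ring
    _ ≤ -1 := hg1

end Criterion

end BirmanSchwinger

end BCS

namespace BCS

/-! ### Polar coordinates and spherical means of plane waves -/

section Polar

variable {G : Type*} [NormedAddCommGroup G] [NormedSpace ℝ G]

/-- Integration in polar coordinates on `ℝ³`, together with the integrability of the radial
integrand. -/
lemma integral_polar {h : R3 → G} (hh : Integrable h) :
    IntegrableOn (fun r : ℝ => r ^ 2 • ∫ θ : S2, h (r • (θ : R3)) ∂dOmega) (Ioi 0) ∧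
      ∫ p, h p = ∫ r in Ioi (0 : ℝ), r ^ 2 • ∫ θ : S2, h (r • (θ : R3)) ∂dOmega := by
  have hdim : Module.finrank ℝ R3 - 1 = 2 := by simp
  have mp := (volume : Measure R3).measurePreserving_homeomorphUnitSphereProd
  rw [hdim] at mp
  set g : S2 × Ioi (0 : ℝ) → G := fun z => h (z.2.1 • z.1.1) with hg
  have hcomp : ∀ x : ({0}ᶜ : Set R3), g (homeomorphUnitSphereProd R3 x) = h x := by
    intro x
    have hx : ‖(x : R3)‖ ≠ 0 := norm_ne_zero_iff.2 x.2
    simp [hg, smul_smul, hx]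
  have hint : Integrable g (dOmega.prod (Measure.volumeIoiPow 2)) := by
    rw [← mp.integrable_comp_emb (Homeomorph.measurableEmbedding _)]
    have : g ∘ (homeomorphUnitSphereProd R3) = h ∘ Subtype.val := funext hcomp
    rw [this, ← integrableOn_iff_comap_subtypeVal (by measurability)]
    exact hh.integrableOn
  have hdens : ∀ r : Ioi (0 : ℝ), (ENNReal.ofReal (r.1 ^ 2)).toReal = r.1 ^ 2 := fun r =>
    ENNReal.toReal_ofReal (by positivity)
  constructor
  · have h1 := hint.integral_prod_right
    rw [Measure.volumeIoiPow, integrable_withDensity_iff_integrable_smul' (by fun_prop)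
      (by simp)] at h1
    simp only [hdens] at h1
    rw [integrableOn_iff_comap_subtypeVal measurableSet_Ioi]
    exact h1
  · calc ∫ p, h p = ∫ x : ({0}ᶜ : Set R3), h x ∂((volume : Measure R3).comap (↑)) := by
          rw [integral_subtype_comap (measurableSet_singleton _).compl h, restrict_compl_singleton]
      _ = ∫ z, g z ∂(dOmega.prod (Measure.volumeIoiPow 2)) := by
          rw [← mp.integral_comp (Homeomorph.measurableEmbedding _)]
          exact integral_congr_ae (Eventually.of_forall fun x => (hcomp x).symm)
      _ = ∫ r, ∫ θ, g (θ, r) ∂dOmega ∂(Measure.volumeIoiPow 2) := integral_prod_symm _ hint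
      _ = _ := by
          rw [Measure.volumeIoiPow, integral_withDensity_eq_integral_toReal_smul (by fun_prop)
            (by simp)]
          simp only [hdens]
          exact integral_subtype_comap measurableSet_Ioi
            (fun r : ℝ => r ^ 2 • ∫ θ : S2, h (r • (θ : R3)) ∂dOmega)

end Polar

/-- The spherical mean `∫_{S²} e^{-i z·θ} dΩ(θ)` (not normalised). -/
def sphereWave (z : R3) : ℂ := ∫ θ : S2, Complex.exp (-Complex.I * (inner ℝ z (θ : R3) : ℝ)) ∂dOmega

lemma norm_planeWave (t : ℝ) : ‖Complex.exp (-Complex.I * (t : ℂ))‖ = 1 := by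
  rw [show -Complex.I * (t : ℂ) = ((-t : ℝ) : ℂ) * Complex.I by push_cast; ring,
    Complex.norm_exp_ofReal_mul_I]

lemma continuous_sphereWave : Continuous sphereWave := by
  refine continuous_of_dominated (bound := fun _ => 1) ?_ ?_ (integrable_const _) ?_
  · exact fun z => Continuous.aestronglyMeasurable (by fun_prop)
  · exact fun z => Eventually.of_forall fun θ => (norm_planeWave _).le
  · exact Eventually.of_forall fun θ => by fun_prop

lemma dOmega_univ : dOmega.real univ = 4 * π := by
  rw [Measure.toSphere_real_apply_univ, measureReal_def, EuclideanSpace.volume_ball_fin_three]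
  simp
  rw [ENNReal.toReal_ofReal (by positivity)]
  ring

lemma norm_sphereWave_le (z : R3) : ‖sphereWave z‖ ≤ 4 * π := by
  rw [← dOmega_univ, sphereWave]
  refine (norm_integral_le_of_norm_le_const
    (Eventually.of_forall fun θ => (norm_planeWave _).le)).trans ?_
  rw [one_mul]

/-- The closed form `4π (sin ka - ka cos ka) / k³` of the Fourier transform of a ball. -/
lemma integral_ball_slices {k : ℝ} (hk : k ≠ 0) (a : ℝ) :
    ∫ t in (-a)..a, π * (a ^ 2 - t ^ 2) * Real.cos (k * t)
      = 4 * π * (Real.sin (k * a) - k * a * Real.cos (k * a)) / k ^ 3 := by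
  have hd : ∀ t : ℝ, HasDerivAt (fun t : ℝ => π * ((a ^ 2 - t ^ 2) * (Real.sin (k * t) / k)
      - 2 * t * (Real.cos (k * t) / k ^ 2) + 2 * (Real.sin (k * t) / k ^ 3)))
      (π * (a ^ 2 - t ^ 2) * Real.cos (k * t)) t := by
    intro t
    have h1 : HasDerivAt (fun t : ℝ => k * t) k t := by simpa using (hasDerivAt_id t).const_mul k
    have hs := h1.sin
    have hc := h1.cos
    have hq : HasDerivAt (fun t : ℝ => a ^ 2 - t ^ 2) (-(2 * t)) t := by
      simpa using ((hasDerivAt_id t).pow 2).const_sub (a ^ 2)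
    have hl : HasDerivAt (fun t : ℝ => 2 * t) 2 t := by simpa using (hasDerivAt_id t).const_mul 2
    refine ((((hq.mul (hs.div_const k)).sub (hl.mul (hc.div_const (k ^ 2)))).add
      ((hs.div_const (k ^ 3)).const_mul 2)).const_mul π).congr_deriv ?_
    field_simp
    ring
  rw [intervalIntegral.integral_eq_sub_of_hasDerivAt (fun t _ => hd t)
    (Continuous.intervalIntegrable (by fun_prop) _ _)]
  simp only [mul_neg, Real.sin_neg, Real.cos_neg]
  field_simp
  ring

/-- Slicing a ball of `ℝ³` into discs. -/
lemma integral_ball_fst (f : ℝ → ℂ) (hf : Continuous f) {a : ℝ} (ha : 0 < a) :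
    ∫ x in Metric.ball (0 : R3) a, f (x 0)
      = ∫ t in (-a)..a, ((π * (a ^ 2 - t ^ 2) : ℝ) : ℂ) * f t := by
  have mp1 : MeasurePreserving (WithLp.ofLp : R3 → Fin 3 → ℝ) :=
    PiLp.volume_preserving_ofLp (Fin 3)
  have mp2 := volume_preserving_piFinSuccAbove (fun _ : Fin 3 => ℝ) 0
  have mp3 : MeasurePreserving (WithLp.toLp 2 : (Fin 2 → ℝ) → EuclideanSpace ℝ (Fin 2)) :=
    PiLp.volume_preserving_toLp (Fin 2)
  have mp := ((MeasurePreserving.id (volume : Measure ℝ)).prod mp3).comp (mp2.comp mp1)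
  set G : ℝ × EuclideanSpace ℝ (Fin 2) → ℂ :=
    {z | z.1 ^ 2 + ‖z.2‖ ^ 2 < a ^ 2}.indicator (fun z => f z.1) with hG
  have hmeas : MeasurableSet {z : ℝ × EuclideanSpace ℝ (Fin 2) | z.1 ^ 2 + ‖z.2‖ ^ 2 < a ^ 2} :=
    measurableSet_lt (by fun_prop) (by fun_prop)
  have hGm : StronglyMeasurable G := by
    refine StronglyMeasurable.indicator ?_ hmeas
    exact (hf.comp continuous_fst).stronglyMeasurable
  set Φ := (Prod.map id (WithLp.toLp 2 : (Fin 2 → ℝ) → EuclideanSpace ℝ (Fin 2))) ∘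
    ((MeasurableEquiv.piFinSuccAbove (fun _ : Fin 3 => ℝ) 0) ∘ (WithLp.ofLp : R3 → Fin 3 → ℝ))
    with hΦ
  have hcomp : G ∘ Φ = (Metric.ball (0 : R3) a).indicator (fun x => f (x 0)) := by
    funext x
    have h1 : (Φ x).1 = x 0 := rfl
    have h2 : (Φ x).1 ^ 2 + ‖(Φ x).2‖ ^ 2 = ‖x‖ ^ 2 := by
      rw [EuclideanSpace.norm_sq_eq, EuclideanSpace.norm_sq_eq, Fin.sum_univ_two,
        Fin.sum_univ_three]
      simp only [Real.norm_eq_abs, sq_abs]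
      change x 0 ^ 2 + (x 1 ^ 2 + x 2 ^ 2) = _
      ring
    have h3 : ‖x‖ ^ 2 < a ^ 2 ↔ ‖x‖ < a := by
      rw [sq_lt_sq, abs_of_nonneg (norm_nonneg _), abs_of_pos ha]
    rw [← h2, h1] at h3
    simp only [hG, Function.comp_apply, indicator, mem_ofPred_eq, mem_ball_zero_iff, h3, h1]
  have hball : Integrable ((Metric.ball (0 : R3) a).indicator (fun x => f (x 0))) := by
    rw [integrable_indicator_iff measurableSet_ball]
    have hc : Continuous (fun x : R3 => f (x 0)) := by fun_prop
    exact (hc.continuousOn.integrableOn_compact (isCompact_closedBall 0 a)).mono_set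
      Metric.ball_subset_closedBall
  have hGi : Integrable G (volume.prod volume) := by
    rw [← mp.integrable_comp hGm.aestronglyMeasurable]
    exact hcomp ▸ hball
  -- The slice at height `t` is a disc of radius `√(a² - t²)`.
  have hslice : ∀ t : ℝ, ∫ y, G (t, y)
      = (Ioc (-a) a).indicator (fun t => ((π * (a ^ 2 - t ^ 2) : ℝ) : ℂ) * f t) t := by
    intro t
    have e : (fun y => G (t, y)) = {y : EuclideanSpace ℝ (Fin 2) | t ^ 2 + ‖y‖ ^ 2 < a ^ 2}.indicator
        (fun _ => f t) := by
      funext y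
      simp only [hG, indicator, mem_ofPred_eq]
    rw [e, integral_indicator (measurableSet_lt (by fun_prop) (by fun_prop)), setIntegral_const]
    by_cases ht : t ^ 2 < a ^ 2
    · have e2 : {y : EuclideanSpace ℝ (Fin 2) | t ^ 2 + ‖y‖ ^ 2 < a ^ 2}
          = Metric.ball 0 (√(a ^ 2 - t ^ 2)) := by
        ext y
        rw [mem_ofPred_eq, mem_ball_zero_iff, Real.lt_sqrt (norm_nonneg _)]
        constructor <;> intro h <;> linarith
      have habs := abs_lt.1 ((sq_lt_sq.1 ht).trans_eq (abs_of_pos ha))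
      rw [e2, indicator_of_mem (show t ∈ Ioc (-a) a from ⟨habs.1, habs.2.le⟩), measureReal_def,
        EuclideanSpace.volume_ball_fin_two, ← ENNReal.ofReal_pow (Real.sqrt_nonneg _),
        Real.sq_sqrt (by linarith), ← ENNReal.ofReal_mul (by linarith),
        ENNReal.toReal_ofReal (mul_nonneg (by linarith) pi_pos.le), Complex.real_smul, mul_comm π]
    · have e2 : {y : EuclideanSpace ℝ (Fin 2) | t ^ 2 + ‖y‖ ^ 2 < a ^ 2} = ∅ := by
        ext y
        simp only [mem_ofPred_eq, mem_empty_iff_false, iff_false, not_lt]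
        nlinarith [sq_nonneg ‖y‖]
      rw [e2]
      by_cases hta : t ∈ Ioc (-a) a
      · have : a ^ 2 - t ^ 2 = 0 := by
          have := hta.1; have := hta.2; nlinarith
        rw [indicator_of_mem hta, this]
        simp
      · rw [indicator_of_notMem hta]
        simp
  rw [← integral_indicator measurableSet_ball, ← hcomp]
  have h1 : ∫ x, (G ∘ Φ) x = ∫ z, G z ∂(volume.prod volume) := by
    rw [← mp.map_eq, integral_map mp.measurable.aemeasurable hGm.aestronglyMeasurable]
    rfl
  rw [h1, integral_prod _ hGi]
  simp only [hslice]
  rw [integral_indicator measurableSet_Ioc, intervalIntegral.integral_of_le (by linarith)]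

/-- A rotation takes any vector to the first coordinate axis. -/
lemma exists_isometry_axis (z : R3) :
    ∃ e : R3 ≃ₗᵢ[ℝ] R3, ∀ x, inner ℝ z (e x) = ‖z‖ * x 0 := by
  set w : R3 := ‖z‖ • EuclideanSpace.single 0 (1 : ℝ) with hw
  have hn : ‖z‖ = ‖w‖ := by simp [hw, norm_smul]
  set ρ := (ℝ ∙ (z - w))ᗮ.reflection with hρ
  have h1 : ρ z = w := Submodule.reflection_sub hn
  refine ⟨ρ, fun x => ?_⟩
  have h2 : inner ℝ z (ρ x) = inner ℝ (ρ z) (ρ (ρ x)) := (ρ.inner_map_map _ _).symm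
  have h3 : ρ (ρ x) = x := Submodule.reflection_reflection _ _
  rw [h2, h3, h1, hw, real_inner_smul_left, EuclideanSpace.inner_single_left]
  simp

/-- The Fourier transform of a ball. -/
lemma integral_ball_planeWave {z : R3} (hz : z ≠ 0) {a : ℝ} (ha : 0 < a) :
    ∫ x in Metric.ball (0 : R3) a, Complex.exp (-Complex.I * (inner ℝ z x : ℝ))
      = ((4 * π * (Real.sin (‖z‖ * a) - ‖z‖ * a * Real.cos (‖z‖ * a)) / ‖z‖ ^ 3 : ℝ) : ℂ) := by
  obtain ⟨e, he⟩ := exists_isometry_axis z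
  have h1 : ∫ x in Metric.ball (0 : R3) a, Complex.exp (-Complex.I * (inner ℝ z x : ℝ))
      = ∫ x in Metric.ball (0 : R3) a, Complex.exp (-Complex.I * ((‖z‖ * x 0 : ℝ) : ℂ)) := by
    rw [← e.measurePreserving.setIntegral_preimage_emb
      e.toHomeomorph.measurableEmbedding _ (Metric.ball (0 : R3) a)]
    have : e ⁻¹' Metric.ball (0 : R3) a = Metric.ball 0 a := by
      ext x; simp
    rw [this]
    simp only [he]
  rw [h1, integral_ball_fst (fun t => Complex.exp (-Complex.I * ((‖z‖ * t : ℝ) : ℂ)))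
    (by fun_prop) ha, ← integral_ball_slices (norm_ne_zero_iff.2 hz) a]
  -- the odd part of the plane wave integrates to zero
  have hodd : ∫ t in (-a)..a, π * (a ^ 2 - t ^ 2) * Real.sin (‖z‖ * t) = 0 := by
    have h := intervalIntegral.integral_comp_neg (a := -a) (b := a)
      (fun t => π * (a ^ 2 - t ^ 2) * Real.sin (‖z‖ * t))
    simp only [neg_sq, mul_neg, Real.sin_neg, neg_neg] at h
    rw [intervalIntegral.integral_neg] at h
    linarith
  have hsplit : ∀ t : ℝ, ((π * (a ^ 2 - t ^ 2) : ℝ) : ℂ) *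
      Complex.exp (-Complex.I * ((‖z‖ * t : ℝ) : ℂ))
      = ((π * (a ^ 2 - t ^ 2) * Real.cos (‖z‖ * t) : ℝ) : ℂ)
        - Complex.I * ((π * (a ^ 2 - t ^ 2) * Real.sin (‖z‖ * t) : ℝ) : ℂ) := by
    intro t
    rw [show -Complex.I * ((‖z‖ * t : ℝ) : ℂ) = ((-(‖z‖ * t) : ℝ) : ℂ) * Complex.I by
      push_cast; ring, Complex.exp_mul_I, ← Complex.ofReal_cos, ← Complex.ofReal_sin, Real.cos_neg,
      Real.sin_neg]
    push_cast
    ring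
  simp only [hsplit]
  rw [intervalIntegral.integral_sub (Continuous.intervalIntegrable (by fun_prop) _ _)
    (Continuous.intervalIntegrable (by fun_prop) _ _), intervalIntegral.integral_const_mul,
    intervalIntegral.integral_ofReal, intervalIntegral.integral_ofReal, hodd]
  simp

/-- The spherical mean of a plane wave, `4π sin(|z|) / |z|`; obtained by differentiating the
Fourier transform of a ball in its radius. -/
lemma sphereWave_eq {z : R3} (hz : z ≠ 0) :
    sphereWave z = ((4 * π * (Real.sin ‖z‖ / ‖z‖) : ℝ) : ℂ) := by
  have hk : ‖z‖ ≠ 0 := norm_ne_zero_iff.2 hz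
  -- Polar coordinates turn the integral over a ball into a radial integral of `sphereWave`.
  have hball : ∀ a : ℝ, 0 < a → ∫ r in (0 : ℝ)..a, ((r ^ 2 : ℝ) : ℂ) * sphereWave (r • z)
      = ((4 * π * (Real.sin (‖z‖ * a) - ‖z‖ * a * Real.cos (‖z‖ * a)) / ‖z‖ ^ 3 : ℝ) : ℂ) := by
    intro a ha
    rw [← integral_ball_planeWave hz ha]
    have hint : Integrable ((Metric.ball (0 : R3) a).indicator
        (fun x => Complex.exp (-Complex.I * (inner ℝ z x : ℝ)))) := by
      rw [integrable_indicator_iff measurableSet_ball]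
      have hc : Continuous (fun x : R3 => Complex.exp (-Complex.I * (inner ℝ z x : ℝ))) := by
        fun_prop
      exact (hc.continuousOn.integrableOn_compact (isCompact_closedBall 0 a)).mono_set
        Metric.ball_subset_closedBall
    rw [← integral_indicator measurableSet_ball, (integral_polar hint).2,
      intervalIntegral.integral_of_le ha.le, integral_Ioc_eq_integral_Ioo]
    have e : ∀ r ∈ Ioi (0 : ℝ), (r ^ 2 • ∫ θ : S2, (Metric.ball (0 : R3) a).indicator
        (fun x => Complex.exp (-Complex.I * (inner ℝ z x : ℝ))) (r • (θ : R3)) ∂dOmega)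
        = (Iio a).indicator (fun r : ℝ => ((r ^ 2 : ℝ) : ℂ) * sphereWave (r • z)) r := by
      intro r hr
      have hnorm : ∀ θ : S2, ‖r • (θ : R3)‖ = r := by
        intro θ
        rw [norm_smul, Real.norm_of_nonneg (le_of_lt hr), norm_eq_of_mem_sphere, mul_one]
      by_cases hra : r < a
      · rw [indicator_of_mem (show r ∈ Iio a from hra), Complex.real_smul, sphereWave]
        congr 1
        refine integral_congr_ae (Eventually.of_forall fun θ => ?_)
        simp only
        rw [indicator_of_mem (by rw [mem_ball_zero_iff, hnorm]; exact hra), real_inner_smul_left,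
          real_inner_smul_right]
      · rw [indicator_of_notMem (show r ∉ Iio a from hra)]
        have : ∀ θ : S2, (Metric.ball (0 : R3) a).indicator
            (fun x => Complex.exp (-Complex.I * (inner ℝ z x : ℝ))) (r • (θ : R3)) = 0 := by
          intro θ
          rw [indicator_of_notMem (by rw [mem_ball_zero_iff, hnorm]; exact hra)]
        simp only [this, integral_zero, smul_zero]
    rw [setIntegral_congr_fun measurableSet_Ioi e, setIntegral_indicator measurableSet_Iio]
    rfl
  have hc : Continuous (fun r : ℝ => ((r ^ 2 : ℝ) : ℂ) * sphereWave (r • z)) := by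
    have := continuous_sphereWave
    fun_prop
  have hd1 : HasDerivAt (fun a : ℝ => ∫ r in (0 : ℝ)..a, ((r ^ 2 : ℝ) : ℂ) * sphereWave (r • z))
      (((1 ^ 2 : ℝ) : ℂ) * sphereWave ((1 : ℝ) • z)) 1 :=
    intervalIntegral.integral_hasDerivAt_right (hc.intervalIntegrable _ _)
      (hc.stronglyMeasurableAtFilter _ _) hc.continuousAt
  have hd2 : HasDerivAt (fun a : ℝ => 4 * π * (Real.sin (‖z‖ * a)
      - ‖z‖ * a * Real.cos (‖z‖ * a)) / ‖z‖ ^ 3) (4 * π * (Real.sin ‖z‖ / ‖z‖)) 1 := by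
    have h1 : HasDerivAt (fun t : ℝ => ‖z‖ * t) ‖z‖ 1 := by
      simpa using (hasDerivAt_id (1 : ℝ)).const_mul ‖z‖
    refine (((h1.sin.sub (h1.mul h1.cos)).const_mul (4 * π)).div_const (‖z‖ ^ 3)).congr_deriv ?_
    simp only [mul_one]
    field_simp
    ring
  have hd3 := hd2.ofReal_comp
  have hev : (fun a : ℝ => ∫ r in (0 : ℝ)..a, ((r ^ 2 : ℝ) : ℂ) * sphereWave (r • z)) =ᶠ[𝓝 1]
      (fun a : ℝ => ((4 * π * (Real.sin (‖z‖ * a)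
        - ‖z‖ * a * Real.cos (‖z‖ * a)) / ‖z‖ ^ 3 : ℝ) : ℂ)) := by
    filter_upwards [Ioi_mem_nhds zero_lt_one] with a ha using hball a ha
  -- Both sides are now differentiated in the radius at `1`.
  have := (hd3.congr_of_eventuallyEq hev).unique hd1
  simpa using this.symm

lemma abs_sinc_sub_le {a b : ℝ} (ha : 0 < a) (hb : 0 < b) :
    |Real.sin a / a - Real.sin b / b| ≤ 2 * |a - b| / b := by
  have e : Real.sin a / a - Real.sin b / b
      = ((b - a) * (Real.sin a / a) + (Real.sin a - Real.sin b)) / b := by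
    field_simp; ring
  have h1 : |Real.sin a / a| ≤ 1 := by
    rw [abs_div, abs_of_pos ha, div_le_one ha]
    simpa [abs_of_pos ha] using Real.abs_sin_le_abs (x := a)
  have h2 : |Real.sin a - Real.sin b| ≤ |a - b| := by
    have := Real.lipschitzWith_sin.dist_le_mul a b
    simpa [Real.dist_eq] using this
  rw [e, abs_div, abs_of_pos hb]
  gcongr
  refine (abs_add_le _ _).trans ?_
  rw [abs_mul, abs_sub_comm b a]
  nlinarith [abs_nonneg (a - b)]

/-- Spherical averaging makes the plane wave Lipschitz in the radius, uniformly in the position: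
the gain that replaces decay assumptions on the potential. -/
lemma norm_sphereWave_sub_le (z : R3) {r r' : ℝ} (hr : 0 < r) (hr' : 0 < r') :
    ‖sphereWave (r • z) - sphereWave (r' • z)‖ ≤ 8 * π / r' * |r - r'| := by
  by_cases hz : z = 0
  · subst hz
    simp only [smul_zero, sub_self, norm_zero]
    positivity
  · have hn : 0 < ‖z‖ := norm_pos_iff.2 hz
    have e : ∀ r : ℝ, 0 < r → sphereWave (r • z)
        = ((4 * π * (Real.sin (r * ‖z‖) / (r * ‖z‖)) : ℝ) : ℂ) := by
      intro r hr
      rw [sphereWave_eq (smul_ne_zero hr.ne' hz), norm_smul, Real.norm_of_nonneg hr.le]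
    rw [e r hr, e r' hr', ← Complex.ofReal_sub, Complex.norm_real, ← mul_sub, norm_mul,
      Real.norm_of_nonneg (by positivity)]
    have := abs_sinc_sub_le (mul_pos hr hn) (mul_pos hr' hn)
    rw [← sub_mul, abs_mul, abs_of_pos hn, ← mul_assoc, mul_div_mul_right _ _ hn.ne'] at this
    calc 4 * π * ‖_‖ ≤ 4 * π * (2 * |r - r'| / r') := by gcongr; exact this
      _ = _ := by ring

end BCS

namespace BCS

/-! ### The function `tanh x / x` -/

lemma hasDerivAt_tanh (x : ℝ) : HasDerivAt Real.tanh (1 / Real.cosh x ^ 2) x := by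
  have h := (Real.hasDerivAt_sinh x).div (Real.hasDerivAt_cosh x) (Real.cosh_pos x).ne'
  have e : Real.tanh = fun x => Real.sinh x / Real.cosh x := funext Real.tanh_eq_sinh_div_cosh
  rw [e]
  refine h.congr_deriv ?_
  rw [← Real.cosh_sq_sub_sinh_sq x]
  ring

lemma continuous_tanh : Continuous Real.tanh :=
  continuous_iff_continuousAt.2 fun x => (hasDerivAt_tanh x).continuousAt

lemma abs_tanh_le (x : ℝ) : |Real.tanh x| ≤ |x| := by
  have h := Convex.norm_image_sub_le_of_norm_hasDerivWithin_le (C := 1) (s := univ)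
    (fun x _ => (hasDerivAt_tanh x).hasDerivWithinAt) (fun x _ => ?_) convex_univ
    (mem_univ 0) (mem_univ x)
  · simpa using h
  · rw [Real.norm_of_nonneg (by positivity), div_le_one (by positivity)]
    nlinarith [Real.one_le_cosh x]

lemma one_sub_tanh (x : ℝ) : 1 - Real.tanh x = 2 / (Real.exp (2 * x) + 1) := by
  rw [Real.tanh_eq, two_mul, Real.exp_add, Real.exp_neg]
  have := Real.exp_pos x
  field_simp
  ring

lemma one_sub_tanh_nonneg (x : ℝ) : 0 ≤ 1 - Real.tanh x := by
  rw [one_sub_tanh]; positivity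

lemma one_sub_tanh_le_exp (x : ℝ) : 1 - Real.tanh x ≤ 2 * Real.exp (-(2 * x)) := by
  rw [one_sub_tanh, Real.exp_neg, ← div_eq_mul_inv]
  gcongr
  linarith

lemma one_sub_tanh_le {x : ℝ} (hx : 0 ≤ x) : 1 - Real.tanh x ≤ 1 / (1 + x) := by
  rw [one_sub_tanh, div_le_div_iff₀ (by positivity) (by positivity)]
  have := Real.add_one_le_exp (2 * x)
  linarith

/-- The continuous extension of `tanh x / x`, with value `1` at `0`. -/
def tanhc : ℝ → ℝ := dslope Real.tanh 0

lemma tanhc_zero : tanhc 0 = 1 := by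
  rw [tanhc, dslope_same, (hasDerivAt_tanh 0).deriv]
  simp

lemma tanhc_of_ne {x : ℝ} (hx : x ≠ 0) : tanhc x = Real.tanh x / x := by
  rw [tanhc, dslope_of_ne _ hx, slope_def_field, Real.tanh_zero, sub_zero, sub_zero]

lemma continuous_tanhc : Continuous tanhc := by
  rw [← continuousOn_univ]
  exact (continuousOn_dslope univ_mem).2
    ⟨continuous_tanh.continuousOn, (hasDerivAt_tanh 0).differentiableAt⟩

lemma tanhc_neg (x : ℝ) : tanhc (-x) = tanhc x := by
  by_cases hx : x = 0
  · simp [hx]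
  · rw [tanhc_of_ne hx, tanhc_of_ne (neg_ne_zero.2 hx), Real.tanh_neg, neg_div_neg_eq]

lemma tanhc_abs (x : ℝ) : tanhc |x| = tanhc x := by
  rcases abs_choice x with h | h <;> rw [h]
  exact tanhc_neg x

lemma abs_mul_tanhc (x : ℝ) : |x| * tanhc x = Real.tanh |x| := by
  rw [← tanhc_abs]
  by_cases hx : |x| = 0
  · simp [hx]
  · rw [tanhc_of_ne hx, mul_div_cancel₀ _ hx]

lemma one_div_le_tanhc (x : ℝ) : 1 / (1 + |x|) ≤ tanhc x := by
  by_cases hx : x = 0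
  · simp [hx, tanhc_zero]
  · have h0 : 0 < |x| := abs_pos.2 hx
    have h1 := one_sub_tanh_le h0.le
    rw [← abs_mul_tanhc] at h1
    have h2 : |x| * (1 / (1 + |x|)) ≤ |x| * tanhc x := by
      have : |x| * (1 / (1 + |x|)) = 1 - 1 / (1 + |x|) := by field_simp; ring
      linarith
    exact le_of_mul_le_mul_left h2 h0

lemma tanhc_pos (x : ℝ) : 0 < tanhc x := lt_of_lt_of_le (by positivity) (one_div_le_tanhc x)

lemma tanhc_le_one (x : ℝ) : tanhc x ≤ 1 := by
  by_cases hx : x = 0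
  · simp [hx, tanhc_zero]
  · rw [← tanhc_abs, tanhc_of_ne (abs_ne_zero.2 hx), div_le_one (abs_pos.2 hx)]
    have := abs_tanh_le |x|
    rw [abs_abs] at this
    exact (le_abs_self _).trans this

/-! ### The integral of `tanh x / x` and Euler's constant -/

/-- `∫_0^A (1 - e^{-x}) / x dx - ln A → γ`, by parts from `Γ'(1) = -γ`. -/
lemma tendsto_integral_one_sub_exp_div :
    Tendsto (fun A : ℝ => (∫ x in (0 : ℝ)..A, (1 - Real.exp (-x)) / x) - Real.log A) atTop
      (𝓝 Real.eulerMascheroniConstant) := by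
  have hG : ∫ t in Ioi (0 : ℝ), Real.log t * Real.exp (-t) = -Real.eulerMascheroniConstant := by
    have h1 : HasDerivAt Complex.Gamma
        (∫ t : ℝ in Ioi 0, (t : ℂ) ^ ((1 : ℂ) - 1) * (Real.log t * Real.exp (-t))) 1 := by
      refine (Complex.hasDerivAt_GammaIntegral (s := 1) (by simp)).congr_of_eventuallyEq ?_
      have : {s : ℂ | 0 < s.re} ∈ 𝓝 (1 : ℂ) :=
        (isOpen_lt continuous_const Complex.continuous_re).mem_nhds (by simp)
      filter_upwards [this] with s hs using Complex.Gamma_eq_integral hs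
    have h2 := h1.unique Complex.hasDerivAt_Gamma_one
    have h3 : ∫ t : ℝ in Ioi 0, (t : ℂ) ^ ((1 : ℂ) - 1) * (Real.log t * Real.exp (-t))
        = ((∫ t in Ioi (0 : ℝ), Real.log t * Real.exp (-t) : ℝ) : ℂ) := by
      rw [← integral_complex_ofReal]
      simp
    rw [h3] at h2
    exact_mod_cast h2
  have hint : IntegrableOn (fun t => Real.log t * Real.exp (-t)) (Ioi 0) := by
    by_contra h
    rw [integral_undef h] at hG
    linarith [Real.one_half_lt_eulerMascheroniConstant]
  have hbd : ∀ x : ℝ, |(1 - Real.exp (-x)) / x| ≤ Real.exp |x| := by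
    intro x
    by_cases hx : x = 0
    · simp [hx]
    · rw [abs_div, div_le_iff₀ (abs_pos.2 hx)]
      rcases le_total 0 x with h | h
      · rw [abs_of_nonneg h, abs_of_nonneg (by simpa using h)]
        have := Real.add_one_le_exp (-x)
        have := Real.one_le_exp h
        nlinarith
      · rw [abs_of_nonpos h, abs_of_nonpos (by simpa using h)]
        have h1 := Real.add_one_le_exp (- -x)
        have h2 := Real.exp_pos (-x)
        have h3 : Real.exp (-x) * Real.exp (- -x) = 1 := by rw [← Real.exp_add]; simp
        nlinarith
  have hparts : ∀ A : ℝ, 0 < A → ∫ x in (0 : ℝ)..A, (1 - Real.exp (-x)) / x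
      = (1 - Real.exp (-A)) * Real.log A - ∫ x in (0 : ℝ)..A, Real.log x * Real.exp (-x) := by
    intro A hA
    have hi1 : IntervalIntegrable (fun x => (1 - Real.exp (-x)) / x) volume 0 A := by
      rw [intervalIntegrable_iff_integrableOn_Ioc_of_le hA.le]
      refine Measure.integrableOn_of_bounded (M := Real.exp A) (by simp)
        (Measurable.aestronglyMeasurable (by fun_prop)) ?_
      filter_upwards [ae_restrict_mem measurableSet_Ioc] with x hx
      refine (hbd x).trans (Real.exp_le_exp.2 ?_)
      rw [abs_of_pos hx.1]; exact hx.2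
    have hi2 : IntervalIntegrable (fun x => Real.log x * Real.exp (-x)) volume 0 A := by
      rw [intervalIntegrable_iff_integrableOn_Ioc_of_le hA.le]
      exact hint.mono_set Ioc_subset_Ioi_self
    have hc : ContinuousOn (fun x => (1 - Real.exp (-x)) * Real.log x) (Icc 0 A) := by
      intro x hx
      rcases hx.1.eq_or_lt with h | h
      · subst h
        refine ContinuousAt.continuousWithinAt ?_
        have h0 : Tendsto (fun x : ℝ => Real.exp |x| * |x * Real.log x|) (𝓝 0) (𝓝 0) := by
          have hcc : Continuous (fun x : ℝ => Real.exp |x| * |x * Real.log x|) := by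
            have := Real.continuous_mul_log
            fun_prop
          simpa using hcc.tendsto 0
        refine (ContinuousAt.congr (f := fun x => (1 - Real.exp (-x)) * Real.log x) ?_
          (Eventually.of_forall fun _ => rfl))
        rw [ContinuousAt]
        simp only [Real.log_zero, mul_zero]
        refine squeeze_zero_norm (fun x => ?_) h0
        by_cases hx : x = 0
        · simp [hx]
        · have e : (1 - Real.exp (-x)) * Real.log x
              = (1 - Real.exp (-x)) / x * (x * Real.log x) := by field_simp
          rw [e, Real.norm_eq_abs, abs_mul]
          exact mul_le_mul_of_nonneg_right (hbd x) (abs_nonneg _)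
      · refine ContinuousAt.continuousWithinAt ?_
        exact ContinuousAt.mul (by fun_prop) (Real.continuousAt_log h.ne')
    have hd : ∀ x ∈ Ioo 0 A, HasDerivAt (fun x => (1 - Real.exp (-x)) * Real.log x)
        (Real.log x * Real.exp (-x) + (1 - Real.exp (-x)) / x) x := by
      intro x hx
      have he : HasDerivAt (fun x : ℝ => 1 - Real.exp (-x)) (Real.exp (-x)) x := by
        have := ((hasDerivAt_neg x).exp).const_sub 1
        simpa using this
      refine (he.mul (Real.hasDerivAt_log hx.1.ne')).congr_deriv ?_
      ring
    have h := intervalIntegral.integral_eq_sub_of_hasDerivAt_of_le hA.le hc hd (hi2.add hi1)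
    rw [intervalIntegral.integral_add hi2 hi1] at h
    simp only [Real.log_zero, mul_zero, sub_zero] at h
    linarith
  have ht := intervalIntegral_tendsto_integral_Ioi 0 hint tendsto_id
  rw [hG] at ht
  have hlog : Tendsto (fun A : ℝ => Real.exp (-A) * Real.log A) atTop (𝓝 0) := by
    refine squeeze_zero' (g := fun A => A ^ (1 : ℕ) * Real.exp (-A)) ?_ ?_
      (Real.tendsto_pow_mul_exp_neg_atTop_nhds_zero 1)
    · filter_upwards [eventually_ge_atTop 1] with A hA
      exact mul_nonneg (Real.exp_pos _).le (Real.log_nonneg hA)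
    · filter_upwards [eventually_ge_atTop 1] with A hA
      rw [mul_comm, pow_one]
      exact mul_le_mul_of_nonneg_right (Real.log_le_self (by linarith)) (Real.exp_pos _).le
  have := (hlog.neg).sub ht
  simp only [neg_zero, sub_neg_eq_add, zero_add] at this
  refine this.congr' ?_
  filter_upwards [eventually_gt_atTop 0] with A hA
  rw [hparts A hA, id]
  ring

lemma intervalIntegrable_one_sub_exp_div {a A : ℝ} (ha : 0 < a) (hA : 0 ≤ A) :
    IntervalIntegrable (fun x => (1 - Real.exp (-(a * x))) / x) volume 0 A := by
  rw [intervalIntegrable_iff_integrableOn_Ioc_of_le hA]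
  refine Measure.integrableOn_of_bounded (M := a) (by simp)
    (Measurable.aestronglyMeasurable (by fun_prop)) ?_
  filter_upwards [ae_restrict_mem measurableSet_Ioc] with x hx
  have h1 := Real.add_one_le_exp (-(a * x))
  have h2 : Real.exp (-(a * x)) ≤ 1 := Real.exp_le_one_iff.2 (by nlinarith [hx.1])
  rw [Real.norm_of_nonneg (div_nonneg (by linarith) hx.1.le), div_le_iff₀ hx.1]
  linarith

lemma tendsto_integral_one_sub_exp_mul_div {a : ℝ} (ha : 0 < a) :
    Tendsto (fun A : ℝ => (∫ x in (0 : ℝ)..A, (1 - Real.exp (-(a * x))) / x) - Real.log A) atTop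
      (𝓝 (Real.eulerMascheroniConstant + Real.log a)) := by
  have h := (tendsto_integral_one_sub_exp_div.comp
    (tendsto_id.const_mul_atTop ha)).add_const (Real.log a)
  refine h.congr' ?_
  filter_upwards [eventually_gt_atTop 0] with A hA
  simp only [Function.comp_apply, id]
  rw [Real.log_mul ha.ne' hA.ne']
  have e := intervalIntegral.integral_comp_mul_left (a := 0) (b := A)
    (fun y => (1 - Real.exp (-y)) / y) ha.ne'
  rw [mul_zero, smul_eq_mul, inv_mul_eq_div, eq_div_iff ha.ne', mul_comm,
    ← intervalIntegral.integral_const_mul] at e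
  have e2 : ∀ x : ℝ, a * ((1 - Real.exp (-(a * x))) / (a * x)) = (1 - Real.exp (-(a * x))) / x := by
    intro x
    rw [← mul_div_assoc, mul_div_mul_left _ _ ha.ne']
  simp only [e2] at e
  rw [← e]
  ring

/-- With `q = e^{-2x}`, the alternating sums
`2 ∑_{n ≤ 2M} (-1)^{n+1} (1 - qⁿ) + (1 - q^{2M+1})` equal `(1 + q^{2M+1}) tanh x`; integrating
against `dx / x` produces the partial Wallis products. -/
lemma tendsto_integral_tanhc_mul (M : ℕ) :
    Tendsto (fun A : ℝ => (∫ x in (0 : ℝ)..A,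
        tanhc x * (1 + Real.exp (-((2 * (2 * M + 1) : ℝ) * x)))) - Real.log A) atTop
      (𝓝 (Real.eulerMascheroniConstant + Real.log 2 - Real.log (Real.Wallis.W M))) := by
  have key : ∀ x : ℝ, x ≠ 0 → ∀ c : ℝ, tanhc x * c
      = (1 - Real.exp (-(2 * x))) / (1 + Real.exp (-(2 * x))) * c / x := by
    intro x hx c
    rw [tanhc_of_ne hx, Real.tanh_eq, Real.exp_neg, Real.exp_neg, two_mul, Real.exp_add]
    have := Real.exp_pos x
    field_simp
  induction M with
  | zero =>
    have h := tendsto_integral_one_sub_exp_mul_div (a := 2) two_pos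
    have hW : Real.Wallis.W 0 = 1 := by simp [Real.Wallis.W]
    rw [hW, Real.log_one, sub_zero]
    refine h.congr fun A => ?_
    congr 1
    refine intervalIntegral.integral_congr_ae ?_
    filter_upwards [compl_mem_ae_iff.2 (measure_singleton (0 : ℝ))] with x hx _
    rw [key x hx]
    simp only [CharP.cast_eq_zero, mul_zero, zero_add, mul_one]
    have := Real.exp_pos (-(2 * x))
    field_simp
  | succ M ih =>
    have h1 : (0 : ℝ) < 2 * (2 * M + 1) := by positivity
    have h2 : (0 : ℝ) < 2 * (2 * M + 2) := by positivity
    have h3 : (0 : ℝ) < 2 * (2 * M + 3) := by positivity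
    have h := ((ih.add (tendsto_integral_one_sub_exp_mul_div h1)).sub
      ((tendsto_integral_one_sub_exp_mul_div h2).const_mul 2)).add
      (tendsto_integral_one_sub_exp_mul_div h3)
    have hlim : Real.eulerMascheroniConstant + Real.log 2 - Real.log (Real.Wallis.W M)
        + (Real.eulerMascheroniConstant + Real.log (2 * (2 * M + 1)))
        - 2 * (Real.eulerMascheroniConstant + Real.log (2 * (2 * M + 2)))
        + (Real.eulerMascheroniConstant + Real.log (2 * (2 * M + 3)))
        = Real.eulerMascheroniConstant + Real.log 2 - Real.log (Real.Wallis.W (M + 1)) := by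
      have hp1 : (0 : ℝ) < 2 * M + 1 := by positivity
      have hp2 : (0 : ℝ) < 2 * M + 2 := by positivity
      have hp3 : (0 : ℝ) < 2 * M + 3 := by positivity
      rw [Real.Wallis.W_succ, Real.log_mul (Real.Wallis.W_pos M).ne' (by positivity),
        Real.log_mul (div_pos hp2 hp1).ne' (div_pos hp2 hp3).ne', Real.log_div hp2.ne' hp1.ne',
        Real.log_div hp2.ne' hp3.ne', Real.log_mul two_ne_zero hp1.ne',
        Real.log_mul two_ne_zero hp2.ne', Real.log_mul two_ne_zero hp3.ne']
      ring
    rw [hlim] at h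
    refine h.congr' ?_
    filter_upwards [eventually_ge_atTop 0] with A hA
    have i1 := intervalIntegrable_one_sub_exp_div h1 hA
    have i2 := intervalIntegrable_one_sub_exp_div h2 hA
    have i3 := intervalIntegrable_one_sub_exp_div h3 hA
    have i0 : IntervalIntegrable
        (fun x => tanhc x * (1 + Real.exp (-((2 * (2 * M + 1) : ℝ) * x)))) volume 0 A := by
      refine Continuous.intervalIntegrable ?_ _ _
      have := continuous_tanhc
      fun_prop
    have e : (∫ x in (0 : ℝ)..A, tanhc x * (1 + Real.exp (-((2 * (2 * M + 1) : ℝ) * x))))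
        + (∫ x in (0 : ℝ)..A, (1 - Real.exp (-((2 * (2 * M + 1) : ℝ) * x))) / x)
        - 2 * (∫ x in (0 : ℝ)..A, (1 - Real.exp (-((2 * (2 * M + 2) : ℝ) * x))) / x)
        + (∫ x in (0 : ℝ)..A, (1 - Real.exp (-((2 * (2 * M + 3) : ℝ) * x))) / x)
        = ∫ x in (0 : ℝ)..A, tanhc x *
          (1 + Real.exp (-((2 * (2 * (M + 1 : ℕ) + 1) : ℝ) * x))) := by
      rw [← intervalIntegral.integral_const_mul, ← intervalIntegral.integral_add i0 i1,
        ← intervalIntegral.integral_sub (i0.add i1) (i2.const_mul 2),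
        ← intervalIntegral.integral_add ((i0.add i1).sub (i2.const_mul 2)) i3]
      refine intervalIntegral.integral_congr_ae ?_
      filter_upwards [compl_mem_ae_iff.2 (measure_singleton (0 : ℝ))] with x hx _
      have hx' : x ≠ 0 := hx
      rw [key x hx, key x hx]
      set q := Real.exp (-(2 * x)) with hq
      have hq0 : 0 < q := Real.exp_pos _
      have f1 : Real.exp (-((2 * (2 * M + 1) : ℝ) * x)) = q ^ (2 * M + 1) := by
        rw [hq, ← Real.exp_nat_mul]; congr 1; push_cast; ring
      have f2 : Real.exp (-((2 * (2 * M + 2) : ℝ) * x)) = q ^ (2 * M + 1) * q := by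
        rw [← pow_succ, hq, ← Real.exp_nat_mul]; congr 1; push_cast; ring
      have f3 : Real.exp (-((2 * (2 * M + 3) : ℝ) * x)) = q ^ (2 * M + 1) * q ^ 2 := by
        rw [← pow_add, hq, ← Real.exp_nat_mul]; congr 1; push_cast; ring
      have f4 : Real.exp (-((2 * (2 * (M + 1 : ℕ) + 1) : ℝ) * x)) = q ^ (2 * M + 1) * q ^ 2 := by
        rw [← f3]; congr 1; push_cast; ring
      rw [f1, f2, f3, f4]
      field_simp
      ring
    rw [← e]
    ring

/-- `∫_0^A tanh x / x dx - ln A → γ + ln (4/π)`. -/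
lemma tendsto_integral_tanhc :
    Tendsto (fun A : ℝ => (∫ x in (0 : ℝ)..A, tanhc x) - Real.log A) atTop
      (𝓝 (Real.eulerMascheroniConstant + Real.log (4 / π))) := by
  have hW : Tendsto (fun M : ℕ => Real.eulerMascheroniConstant + Real.log 2
      - Real.log (Real.Wallis.W M)) atTop
      (𝓝 (Real.eulerMascheroniConstant + Real.log (4 / π))) := by
    have h := (Real.tendsto_prod_pi_div_two.log (by positivity)).const_sub
      (Real.eulerMascheroniConstant + Real.log 2)
    have e : Real.eulerMascheroniConstant + Real.log 2 - Real.log (π / 2)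
        = Real.eulerMascheroniConstant + Real.log (4 / π) := by
      rw [add_sub_assoc, ← Real.log_div two_ne_zero (by positivity)]
      congr 2
      field_simp
      norm_num
    rw [e] at h
    exact h
  -- With the factor `1 + exp(-2(2M+1)x)` the integral is a finite sum of explicit ones
  -- (`tendsto_integral_tanhc_mul`); dropping it costs `O(1/M)` uniformly in `A`.
  have hrem : ∀ (M : ℕ) (A : ℝ), 0 ≤ A →
      |(∫ x in (0 : ℝ)..A, tanhc x) - ∫ x in (0 : ℝ)..A,
        tanhc x * (1 + Real.exp (-((2 * (2 * M + 1) : ℝ) * x)))| ≤ 1 / (M + 1) := by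
    intro M A hA
    have hc := continuous_tanhc
    set n : ℝ := 2 * (2 * M + 1) with hn
    have hn0 : 0 < n := by positivity
    rw [← intervalIntegral.integral_sub (Continuous.intervalIntegrable (by fun_prop) _ _)
      (Continuous.intervalIntegrable (by fun_prop) _ _)]
    have h1 : |∫ x in (0 : ℝ)..A, (tanhc x - tanhc x * (1 + Real.exp (-(n * x))))|
        ≤ ∫ x in (0 : ℝ)..A, Real.exp (-(n * x)) := by
      rw [← Real.norm_eq_abs]
      refine intervalIntegral.norm_integral_le_of_norm_le hA ?_
        (Continuous.intervalIntegrable (by fun_prop) _ _)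
      refine Eventually.of_forall fun x _ => ?_
      have e : tanhc x - tanhc x * (1 + Real.exp (-(n * x))) = -(tanhc x * Real.exp (-(n * x))) := by
        ring
      rw [e, norm_neg, Real.norm_of_nonneg (mul_nonneg (tanhc_pos x).le (Real.exp_pos _).le)]
      exact mul_le_of_le_one_left (Real.exp_pos _).le (tanhc_le_one x)
    have h2 : ∫ x in (0 : ℝ)..A, Real.exp (-(n * x)) = (1 - Real.exp (-(n * A))) / n := by
      have hd : ∀ x ∈ uIcc 0 A, HasDerivAt (fun x => -Real.exp (-(n * x)) / n)
          (Real.exp (-(n * x))) x := by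
        intro x _
        have h1 : HasDerivAt (fun x : ℝ => -(n * x)) (-n) x := by
          simpa [neg_mul] using (hasDerivAt_id x).const_mul (-n)
        refine ((h1.exp.neg).div_const n).congr_deriv ?_
        field_simp
      rw [intervalIntegral.integral_eq_sub_of_hasDerivAt hd
        (Continuous.intervalIntegrable (by fun_prop) _ _)]
      simp
      ring
    refine h1.trans ?_
    rw [h2, div_le_div_iff₀ hn0 (by positivity)]
    have := Real.exp_pos (-(n * A))
    have hM : (0 : ℝ) ≤ M := by positivity
    nlinarith
  rw [Metric.tendsto_atTop]
  intro ε hε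
  have hM1 := (Metric.tendsto_atTop.1 hW) (ε / 3) (by positivity)
  obtain ⟨M1, hM1⟩ := hM1
  obtain ⟨M2, hM2⟩ := exists_nat_one_div_lt (show 0 < ε / 3 by positivity)
  set M := max M1 M2 with hM
  have hM3 : 1 / ((M : ℝ) + 1) < ε / 3 := by
    refine lt_of_le_of_lt ?_ hM2
    have : (M2 : ℝ) ≤ M := by exact_mod_cast le_max_right _ _
    gcongr
  have hM4 := hM1 M (le_max_left _ _)
  obtain ⟨A0, hA0⟩ := (Metric.tendsto_atTop.1 (tendsto_integral_tanhc_mul M)) (ε / 3) (by positivity)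
  refine ⟨max A0 0, fun A hA => ?_⟩
  have h1 := hA0 A (le_trans (le_max_left _ _) hA)
  have h2 := hrem M A (le_trans (le_max_right _ _) hA)
  rw [Real.dist_eq] at h1 hM4 ⊢
  rw [abs_lt] at h1 hM4 ⊢
  rw [abs_le] at h2
  constructor <;> linarith [h1.1, h1.2, h2.1, h2.2, hM4.1, hM4.2]

end BCS

namespace BCS

/-! ### The reciprocal of the symbol and its singular radial integral -/

/-- The reciprocal `tanh((r² - μ)/2T) / (r² - μ)` of the symbol of `K_{T,μ}` at `|p| = r`, extended
continuously through `r = √μ`. -/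
def kInv (T μ r : ℝ) : ℝ := tanhc ((r ^ 2 - μ) / (2 * T)) / (2 * T)

section kInv

variable {T μ : ℝ}

lemma continuous_kInv : Continuous (kInv T μ) := by
  have := continuous_tanhc
  unfold kInv
  fun_prop

lemma kInv_pos (hT : 0 < T) (r : ℝ) : 0 < kInv T μ r :=
  div_pos (tanhc_pos _) (by positivity)

lemma kInv_le (hT : 0 < T) (r : ℝ) : kInv T μ r ≤ 1 / (2 * T) := by
  unfold kInv
  gcongr
  exact tanhc_le_one _

lemma kInv_eq (hT : 0 < T) {r : ℝ} (hr : r ^ 2 - μ ≠ 0) :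
    kInv T μ r = Real.tanh (|r ^ 2 - μ| / (2 * T)) / |r ^ 2 - μ| := by
  have h0 : 0 < |r ^ 2 - μ| := abs_pos.2 hr
  have e : |(r ^ 2 - μ) / (2 * T)| = |r ^ 2 - μ| / (2 * T) := by
    rw [abs_div, abs_of_pos (show 0 < 2 * T by positivity)]
  rw [kInv, ← tanhc_abs, e, tanhc_of_ne (by positivity)]
  field_simp

lemma abs_mul_kInv_le (hT : 0 < T) (r : ℝ) : |r ^ 2 - μ| * kInv T μ r ≤ 1 := by
  by_cases hr : r ^ 2 - μ = 0
  · simp [hr]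
  · rw [kInv_eq hT hr, mul_div_cancel₀ _ (abs_ne_zero.2 hr)]
    exact (Real.tanh_lt_one _).le

lemma inv_le_kInv (hT : 0 < T) (r : ℝ) : 1 / (|r ^ 2 - μ| + 2 * T) ≤ kInv T μ r := by
  unfold kInv
  rw [le_div_iff₀ (by positivity)]
  refine le_trans (le_of_eq ?_) (one_div_le_tanhc _)
  rw [abs_div, abs_of_pos (show 0 < 2 * T by positivity)]
  have := abs_nonneg (r ^ 2 - μ)
  field_simp
  ring

/-- The symbol of `K_{T,μ}` is the reciprocal of `kInv` off the Fermi sphere. -/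
lemma kSymbol_mul_kInv (hT : 0 < T) {p : R3} (hp : ‖p‖ ^ 2 ≠ μ) :
    kSymbol T μ p * kInv T μ ‖p‖ = 1 := by
  have hs : ‖p‖ ^ 2 - μ ≠ 0 := sub_ne_zero.2 hp
  have hT2 : 2 * T ≠ 0 := by positivity
  set s := ‖p‖ ^ 2 - μ with hsdef
  rw [kSymbol, kInv, ← hsdef, tanhc_of_ne (div_ne_zero hs hT2), Real.tanh_eq]
  have hE : Real.exp (s / T) = Real.exp (s / (2 * T)) * Real.exp (s / (2 * T)) := by
    rw [← Real.exp_add]; congr 1; field_simp; ring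
  have hE1 : Real.exp (s / T) - 1 ≠ 0 := by
    intro h
    have : Real.exp (s / T) = 1 := by linarith
    rw [Real.exp_eq_one_iff] at this
    exact div_ne_zero hs hT.ne' this
  rw [Real.exp_neg]
  have hpos := Real.exp_pos (s / (2 * T))
  rw [hE] at hE1 ⊢
  set q := Real.exp (s / (2 * T))
  have hq : q ^ 2 - 1 ≠ 0 := by rwa [sq]
  have hq2 : q ^ 2 + 1 ≠ 0 := by positivity
  field_simp

lemma sq_mul_kInv_le (hT : 0 < T) (hμ : 0 < μ) (r : ℝ) :
    r ^ 2 * kInv T μ r ≤ 1 + μ / (2 * T) := by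
  have h1 := abs_mul_kInv_le (μ := μ) hT r
  have h2 := kInv_le (μ := μ) hT r
  have h3 := (kInv_pos (μ := μ) hT r).le
  have h4 : (r ^ 2 - μ) * kInv T μ r ≤ 1 :=
    (mul_le_mul_of_nonneg_right (le_abs_self _) h3).trans h1
  have h5 : μ * kInv T μ r ≤ μ * (1 / (2 * T)) := mul_le_mul_of_nonneg_left h2 hμ.le
  rw [mul_one_div] at h5
  linarith

end kInv

/-- The radial integral `m(T) = ∫_0^∞ (r² / K_{T,μ}(r) - 1) dr`, which carries the logarithmic
divergence at low temperature. -/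
def radialM (μ T : ℝ) : ℝ := ∫ r in Ioi (0 : ℝ), (r ^ 2 * kInv T μ r - 1)

section RadialM

variable {μ : ℝ}

/-- Away from the Fermi sphere the integrand of `m(T)` is `O(1/r²)`, uniformly for bounded `T`. -/
lemma abs_far_le (hμ : 0 < μ) {T : ℝ} (hT : 0 < T) {r : ℝ} (hr : 2 * μ ≤ r ^ 2) :
    |r ^ 2 * kInv T μ r - 1| ≤ 2 * (μ + 4 * T) / r ^ 2 := by
  have hs : 0 < r ^ 2 - μ := by linarith
  have hr2 : 0 < r ^ 2 := by linarith
  set s := r ^ 2 - μ with hsdef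
  have hrs : r ^ 2 = s + μ := by rw [hsdef]; ring
  have h1 := one_sub_tanh_le (x := s / (2 * T)) (by positivity)
  have h2 := one_sub_tanh_nonneg (s / (2 * T))
  set τ := Real.tanh (s / (2 * T)) with hτ
  have h3 : 1 - τ ≤ 2 * T / s := by
    refine h1.trans ?_
    rw [div_le_div_iff₀ (by positivity) hs]
    have : s / (2 * T) * (2 * T) = s := by field_simp
    nlinarith
  rw [kInv_eq hT (by rw [← hsdef]; exact hs.ne'), ← hsdef, abs_of_pos hs, ← hτ]
  have e : r ^ 2 * (τ / s) - 1 = (μ - (1 - τ) * r ^ 2) / s := by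
    rw [hrs]; field_simp; ring
  have h5 : r ^ 2 ≤ 2 * s := by linarith
  have h4 : |μ - (1 - τ) * r ^ 2| ≤ μ + 4 * T := by
    have h6 : (1 - τ) * r ^ 2 ≤ 4 * T := by
      calc (1 - τ) * r ^ 2 ≤ 2 * T / s * (2 * s) :=
            mul_le_mul h3 h5 hr2.le (by positivity)
        _ = 4 * T := by field_simp; ring
    have h7 : 0 ≤ (1 - τ) * r ^ 2 := mul_nonneg h2 hr2.le
    rw [abs_le]
    constructor <;> linarith
  rw [e, abs_div, abs_of_pos hs, div_le_div_iff₀ hs hr2]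
  calc |μ - (1 - τ) * r ^ 2| * r ^ 2 ≤ (μ + 4 * T) * (2 * s) :=
        mul_le_mul h4 h5 hr2.le (by positivity)
    _ = _ := by ring

lemma integrableOn_const_div_sq (C : ℝ) {a : ℝ} (ha : 0 < a) :
    IntegrableOn (fun r : ℝ => C / r ^ 2) (Ioi a) := by
  have h : IntegrableOn (fun r : ℝ => C * r ^ (-2 : ℝ)) (Ioi a) :=
    (integrableOn_Ioi_rpow_of_lt (a := -2) (by norm_num) ha).const_mul C
  refine h.congr_fun (fun r hr => ?_) measurableSet_Ioi
  have hr0 : 0 < r := ha.trans hr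
  simp only
  rw [Real.rpow_neg hr0.le, div_eq_mul_inv]
  norm_cast

lemma sqrt_two_mul_sq_le (hμ : 0 < μ) {r : ℝ} (hr : r ∈ Ioi (√(2 * μ))) : 2 * μ ≤ r ^ 2 := by
  have h0 : (0 : ℝ) ≤ √(2 * μ) := Real.sqrt_nonneg _
  have h1 : √(2 * μ) < r := hr
  have h2 := Real.sq_sqrt (show 0 ≤ 2 * μ by positivity)
  nlinarith

lemma integrableOn_radialM (hμ : 0 < μ) {T : ℝ} (hT : 0 < T) :
    IntegrableOn (fun r => r ^ 2 * kInv T μ r - 1) (Ioi 0) := by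
  have hc : Continuous (fun r => r ^ 2 * kInv T μ r - 1) := by
    have := continuous_kInv (T := T) (μ := μ)
    fun_prop
  have h0 : 0 < √(2 * μ) := Real.sqrt_pos.2 (by positivity)
  rw [← Ioc_union_Ioi_eq_Ioi h0.le]
  refine IntegrableOn.union (hc.integrableOn_Ioc) ?_
  refine (integrableOn_const_div_sq (2 * (μ + 4 * T)) h0).mono' hc.aestronglyMeasurable ?_
  filter_upwards [ae_restrict_mem measurableSet_Ioi] with r hr
  exact abs_far_le hμ hT (sqrt_two_mul_sq_le hμ hr)

/-- The singular part of `m(T)` near the Fermi sphere, under the substitution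
`x = (r² - μ) / 2T`. The cut-off `√(2μ)` makes the range of `x` symmetric. -/
lemma integral_near_eq {T : ℝ} (hμ : 0 < μ) (hT : 0 < T) :
    ∫ r in Ioc 0 (√(2 * μ)), r * kInv T μ r = ∫ x in (0 : ℝ)..(μ / (2 * T)), tanhc x := by
  have hc := continuous_tanhc
  have h0 : 0 ≤ √(2 * μ) := Real.sqrt_nonneg _
  rw [← intervalIntegral.integral_of_le h0]
  have hd : ∀ r ∈ uIcc 0 (√(2 * μ)),
      HasDerivAt (fun r : ℝ => (r ^ 2 - μ) / (2 * T)) (r / T) r := by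
    intro r _
    have h1 : HasDerivAt (fun r : ℝ => r ^ 2 - μ) (2 * r) r := by
      simpa using ((hasDerivAt_id r).pow 2).sub_const μ
    refine (h1.div_const (2 * T)).congr_deriv ?_
    field_simp
  have h := intervalIntegral.integral_comp_mul_deriv hd (by fun_prop) hc
  have e1 : ((0 : ℝ) ^ 2 - μ) / (2 * T) = -(μ / (2 * T)) := by ring
  have e2 : (√(2 * μ) ^ 2 - μ) / (2 * T) = μ / (2 * T) := by
    rw [Real.sq_sqrt (by positivity)]; ring
  rw [e1, e2, ← intervalIntegral.integral_add_adjacent_intervals (b := 0)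
    (hc.intervalIntegrable _ _) (hc.intervalIntegrable _ _)] at h
  have h2 := intervalIntegral.integral_comp_neg (a := 0) (b := μ / (2 * T)) tanhc
  simp only [tanhc_neg, neg_zero] at h2
  rw [← h2] at h
  have h3 : ∫ r in (0 : ℝ)..√(2 * μ), r * kInv T μ r
      = (1 / 2) * ∫ r in (0 : ℝ)..√(2 * μ), (tanhc ∘ fun r : ℝ => (r ^ 2 - μ) / (2 * T)) r * (r / T) := by
    rw [← intervalIntegral.integral_const_mul]
    congr 1
    funext r
    simp only [kInv, Function.comp_apply]
    field_simp
  rw [h3, h]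
  ring

lemma tendsto_tanh_div {s : ℝ} (hs : 0 < s) :
    Tendsto (fun T : ℝ => Real.tanh (s / (2 * T))) (𝓝[>] 0) (𝓝 1) := by
  have h1 : Tendsto (fun T : ℝ => s / (2 * T)) (𝓝[>] 0) atTop := by
    have := (tendsto_inv_nhdsGT_zero (𝕜 := ℝ)).const_mul_atTop (show 0 < s / 2 by positivity)
    refine this.congr fun T => ?_
    ring
  have h2 : Tendsto (fun x : ℝ => 1 - 2 * Real.exp (-(2 * x))) atTop (𝓝 1) := by
    have := ((Real.tendsto_exp_neg_atTop_nhds_zero.comp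
      (tendsto_id.const_mul_atTop (two_pos (α := ℝ)))).const_mul 2).const_sub 1
    simpa using this
  have h3 : Tendsto Real.tanh atTop (𝓝 1) :=
    tendsto_of_tendsto_of_tendsto_of_le_of_le h2 tendsto_const_nhds
      (fun x => by linarith [one_sub_tanh_le_exp x]) (fun x => (Real.tanh_lt_one x).le)
  exact h3.comp h1

lemma tendsto_kInv {r : ℝ} (hr : r ^ 2 - μ ≠ 0) :
    Tendsto (fun T => kInv T μ r) (𝓝[>] 0) (𝓝 (1 / |r ^ 2 - μ|)) := by
  have h := (tendsto_tanh_div (abs_pos.2 hr)).div_const |r ^ 2 - μ|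
  refine h.congr' ?_
  filter_upwards [self_mem_nhdsWithin] with T hT
  rw [kInv_eq hT hr]

lemma sq_sub_ne_zero (hμ : 0 < μ) {r : ℝ} (hr : 0 < r) (h : r ≠ √μ) : r ^ 2 - μ ≠ 0 := by
  intro h0
  refine h ?_
  rw [eq_comm, Real.sqrt_eq_iff_mul_self_eq hμ.le hr.le]
  linarith

lemma ae_ne (a : ℝ) (s : Set ℝ) : ∀ᵐ r ∂(volume.restrict s), r ≠ a :=
  ae_restrict_of_ae (compl_mem_ae_iff.2 (measure_singleton a))

/-- The part of `m(T)` on `(0, √(2μ)]` that is left after subtracting `√μ r / K_{T,μ}(r)` from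
`r² / K_{T,μ}(r)`. The factor `r - √μ` cancels the singularity, so its limit is an elementary
integral. -/
lemma tendsto_integral_near (hμ : 0 < μ) :
    Tendsto (fun T => ∫ r in Ioc 0 (√(2 * μ)), (r * (r - √μ) * kInv T μ r - 1)) (𝓝[>] 0)
      (𝓝 (√μ * (-2 + 2 * Real.log 2 - Real.log (√2 + 1)))) := by
  set κ := √μ with hκ
  have hκ0 : 0 < κ := Real.sqrt_pos.2 hμ
  have hκ2 : κ ^ 2 = μ := Real.sq_sqrt hμ.le
  have hs2 : √(2 * μ) = √2 * κ := by rw [Real.sqrt_mul two_pos.le]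
  have h12 : (1 : ℝ) ≤ √2 := Real.one_le_sqrt.2 one_le_two
  have hle : κ ≤ √(2 * μ) := by rw [hs2]; nlinarith
  have hlim : Tendsto (fun T => ∫ r in Ioc 0 (√(2 * μ)), (r * (r - κ) * kInv T μ r - 1)) (𝓝[>] 0)
      (𝓝 (∫ r in Ioc 0 (√(2 * μ)), (r * (r - κ) * (1 / |r ^ 2 - μ|) - 1))) := by
    refine tendsto_integral_filter_of_dominated_convergence (fun _ => 2) ?_ ?_
      (integrableOn_const measure_Ioc_lt_top.ne) ?_
    · refine Eventually.of_forall fun T => Continuous.aestronglyMeasurable ?_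
      have := continuous_kInv (T := T) (μ := μ)
      fun_prop
    · filter_upwards [self_mem_nhdsWithin] with T hT
      filter_upwards [ae_restrict_mem measurableSet_Ioc] with r hr
      have h1 := abs_mul_kInv_le (μ := μ) hT r
      have h2 := (kInv_pos (μ := μ) hT r).le
      have e : |r ^ 2 - μ| = |r - κ| * (r + κ) := by
        have e0 : r ^ 2 - μ = (r - κ) * (r + κ) := by rw [← hκ2]; ring
        rw [e0, abs_mul, abs_of_pos (show 0 < r + κ by linarith [hr.1])]
      have h3 : |r * (r - κ) * kInv T μ r| ≤ 1 := by
        rw [abs_mul, abs_mul, abs_of_pos hr.1, abs_of_nonneg h2]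
        refine le_trans ?_ h1
        rw [e]
        have : r * |r - κ| ≤ |r - κ| * (r + κ) := by nlinarith [abs_nonneg (r - κ)]
        exact mul_le_mul_of_nonneg_right this h2
      rw [Real.norm_eq_abs]
      refine (abs_sub _ _).trans ?_
      rw [abs_one]
      linarith
    · filter_upwards [ae_restrict_mem measurableSet_Ioc, ae_ne κ _] with r hr hne
      exact ((tendsto_kInv (sq_sub_ne_zero hμ hr.1 hne)).const_mul _).sub_const 1
  -- The integrand is `-1 - r / (r + κ)` below `κ` and `-κ / (r + κ)` above.
  have hval : ∫ r in Ioc 0 (√(2 * μ)), (r * (r - κ) * (1 / |r ^ 2 - μ|) - 1)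
      = κ * (-2 + 2 * Real.log 2 - Real.log (√2 + 1)) := by
    have hinv : ∀ a b : ℝ, 0 ≤ a → a ≤ b →
        IntervalIntegrable (fun r : ℝ => 1 / (r + κ)) volume a b ∧
        ∫ r in a..b, 1 / (r + κ) = Real.log (b + κ) - Real.log (a + κ) := by
      intro a b ha hab
      have hi : IntervalIntegrable (fun r : ℝ => 1 / (r + κ)) volume a b := by
        refine ContinuousOn.intervalIntegrable fun r hr => ?_
        rw [uIcc_of_le hab] at hr
        refine ContinuousAt.continuousWithinAt ?_
        have : r + κ ≠ 0 := by linarith [hr.1]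
        fun_prop (disch := assumption)
      refine ⟨hi, intervalIntegral.integral_eq_sub_of_hasDerivAt
        (f := fun r => Real.log (r + κ)) (fun r hr => ?_) hi⟩
      rw [uIcc_of_le hab] at hr
      exact ((hasDerivAt_id r).add_const κ).log (by simp only [id]; linarith [hr.1])
    have i1 := hinv 0 κ le_rfl hκ0.le
    have i2 := hinv κ (√(2 * μ)) hκ0.le hle
    have e1 : EqOn (fun r => r * (r - κ) * (1 / |r ^ 2 - μ|) - 1)
        (fun r => -2 + κ * (1 / (r + κ))) (Ioo 0 κ) := by
      intro r hr
      have h1 : |r ^ 2 - μ| = (κ - r) * (r + κ) := by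
        rw [← hκ2, abs_of_nonpos (by nlinarith [hr.1, hr.2])]; ring
      have h2 : κ - r ≠ 0 := by linarith [hr.2]
      have h3 : r + κ ≠ 0 := by linarith [hr.1]
      simp only [h1]
      field_simp
      ring
    have e2 : EqOn (fun r => r * (r - κ) * (1 / |r ^ 2 - μ|) - 1)
        (fun r => -κ * (1 / (r + κ))) (Ioc κ (√(2 * μ))) := by
      intro r hr
      have h1 : |r ^ 2 - μ| = (r - κ) * (r + κ) := by
        rw [← hκ2, abs_of_nonneg (by nlinarith [hr.1])]; ring
      have h2 : r - κ ≠ 0 := by linarith [hr.1]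
      have h3 : r + κ ≠ 0 := by linarith [hr.1]
      simp only [h1]
      field_simp
      ring
    have j1 : IntegrableOn (fun r => -2 + κ * (1 / (r + κ))) (Ioc 0 κ) := by
      have := (intervalIntegrable_const (c := (-2 : ℝ))).add (i1.1.const_mul κ)
      rwa [intervalIntegrable_iff_integrableOn_Ioc_of_le hκ0.le] at this
    have j2 : IntegrableOn (fun r => -κ * (1 / (r + κ))) (Ioc κ (√(2 * μ))) := by
      have := i2.1.const_mul (-κ)
      rwa [intervalIntegrable_iff_integrableOn_Ioc_of_le hle] at this
    have k1 : IntegrableOn (fun r => r * (r - κ) * (1 / |r ^ 2 - μ|) - 1) (Ioc 0 κ) := by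
      rw [integrableOn_Ioc_iff_integrableOn_Ioo] at j1 ⊢
      exact j1.congr_fun e1.symm measurableSet_Ioo
    have k2 : IntegrableOn (fun r => r * (r - κ) * (1 / |r ^ 2 - μ|) - 1) (Ioc κ (√(2 * μ))) :=
      j2.congr_fun e2.symm measurableSet_Ioc
    rw [← Ioc_union_Ioc_eq_Ioc hκ0.le hle, setIntegral_union (Ioc_disjoint_Ioc_of_le le_rfl)
      measurableSet_Ioc k1 k2, setIntegral_congr_fun measurableSet_Ioc e2,
      integral_Ioc_eq_integral_Ioo, setIntegral_congr_fun measurableSet_Ioo e1,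
      ← integral_Ioc_eq_integral_Ioo, ← intervalIntegral.integral_of_le hκ0.le,
      ← intervalIntegral.integral_of_le hle, intervalIntegral.integral_add
      intervalIntegrable_const (i1.1.const_mul κ), intervalIntegral.integral_const_mul,
      intervalIntegral.integral_const_mul, i1.2, i2.2, hs2, intervalIntegral.integral_const]
    have f1 : √2 * κ + κ = (√2 + 1) * κ := by ring
    have f2 : κ + κ = 2 * κ := by ring
    rw [f1, f2, Real.log_mul (by positivity : √2 + 1 ≠ 0) hκ0.ne',
      Real.log_mul two_ne_zero hκ0.ne', zero_add]
    simp only [sub_zero, smul_eq_mul]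
    ring
  rw [hval] at hlim
  exact hlim

/-- The part of `m(T)` on `(√(2μ), ∞)`, where the integrand stays bounded as `T → 0`. -/
lemma tendsto_integral_far (hμ : 0 < μ) :
    Tendsto (fun T => ∫ r in Ioi (√(2 * μ)), (r ^ 2 * kInv T μ r - 1)) (𝓝[>] 0)
      (𝓝 (√μ * Real.log (√2 + 1))) := by
  set κ := √μ with hκ
  have hκ0 : 0 < κ := Real.sqrt_pos.2 hμ
  have hκ2 : κ ^ 2 = μ := Real.sq_sqrt hμ.le
  have hs2 : √(2 * μ) = √2 * κ := by rw [Real.sqrt_mul two_pos.le]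
  have h12 : (1 : ℝ) < √2 := by rw [Real.lt_sqrt] <;> norm_num
  have h0 : 0 < √(2 * μ) := Real.sqrt_pos.2 (by positivity)
  have hlt : κ < √(2 * μ) := by rw [hs2]; nlinarith
  have hbound : ∀ T ∈ Ioo (0 : ℝ) 1, ∀ r ∈ Ioi (√(2 * μ)),
      ‖r ^ 2 * kInv T μ r - 1‖ ≤ 2 * (μ + 4) / r ^ 2 := by
    intro T hT r hr
    refine (abs_far_le hμ hT.1 (sqrt_two_mul_sq_le hμ hr)).trans ?_
    gcongr
    linarith [hT.2]
  have hmem : Ioo (0 : ℝ) 1 ∈ 𝓝[>] (0 : ℝ) := Ioo_mem_nhdsGT one_pos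
  have hpt : ∀ r ∈ Ioi (√(2 * μ)), Tendsto (fun T => r ^ 2 * kInv T μ r - 1) (𝓝[>] 0)
      (𝓝 (κ / 2 * (1 / (r - κ) - 1 / (r + κ)))) := by
    intro r hr
    have hr1 : κ < r := hlt.trans hr
    have h := ((tendsto_kInv (sq_sub_ne_zero hμ (h0.trans hr) hr1.ne')).const_mul
      (r ^ 2)).sub_const 1
    convert h using 2
    have h1 : |r ^ 2 - μ| = (r - κ) * (r + κ) := by
      rw [← hκ2, abs_of_nonneg (by nlinarith)]; ring
    have h2 : r - κ ≠ 0 := by linarith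
    have h3 : r + κ ≠ 0 := by linarith
    rw [h1]
    field_simp
    ring
  have hlim : Tendsto (fun T => ∫ r in Ioi (√(2 * μ)), (r ^ 2 * kInv T μ r - 1)) (𝓝[>] 0)
      (𝓝 (∫ r in Ioi (√(2 * μ)), κ / 2 * (1 / (r - κ) - 1 / (r + κ)))) := by
    refine tendsto_integral_filter_of_dominated_convergence (fun r => 2 * (μ + 4) / r ^ 2) ?_ ?_
      (integrableOn_const_div_sq _ h0) ?_
    · refine Eventually.of_forall fun T => Continuous.aestronglyMeasurable ?_
      have := continuous_kInv (T := T) (μ := μ)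
      fun_prop
    · filter_upwards [hmem] with T hT
      filter_upwards [ae_restrict_mem measurableSet_Ioi] with r hr using hbound T hT r hr
    · filter_upwards [ae_restrict_mem measurableSet_Ioi] with r hr using hpt r hr
  have hval : ∫ r in Ioi (√(2 * μ)), κ / 2 * (1 / (r - κ) - 1 / (r + κ))
      = κ * Real.log (√2 + 1) := by
    have hint : IntegrableOn (fun r => κ / 2 * (1 / (r - κ) - 1 / (r + κ))) (Ioi (√(2 * μ))) := by
      refine (integrableOn_const_div_sq (2 * (μ + 4)) h0).mono'
        (Measurable.aestronglyMeasurable (by fun_prop)) ?_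
      filter_upwards [ae_restrict_mem measurableSet_Ioi] with r hr
      refine le_of_tendsto (hpt r hr).norm ?_
      filter_upwards [hmem] with T hT using hbound T hT r hr
    -- The antiderivative vanishes at infinity.
    have hd : ∀ r ∈ Ici (√(2 * μ)), HasDerivAt
        (fun r => κ / 2 * Real.log ((r - κ) / (r + κ)))
        (κ / 2 * (1 / (r - κ) - 1 / (r + κ))) r := by
      intro r hr
      have hr1 : κ < r := hlt.trans_le hr
      have h2 : 0 < r - κ := by linarith
      have h3 : 0 < r + κ := by linarith
      have := ((((hasDerivAt_id r).sub_const κ).div ((hasDerivAt_id r).add_const κ)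
        h3.ne').log (div_pos h2 h3).ne').const_mul (κ / 2)
      refine this.congr_deriv ?_
      simp only [id, Pi.div_apply]
      field_simp
    have hat : Tendsto (fun r : ℝ => κ / 2 * Real.log ((r - κ) / (r + κ))) atTop (𝓝 0) := by
      have h1 : Tendsto (fun r : ℝ => 1 - 2 * κ * (r + κ)⁻¹) atTop (𝓝 1) := by
        have := ((tendsto_inv_atTop_zero.comp
          (tendsto_atTop_add_const_right atTop κ tendsto_id)).const_mul (2 * κ)).const_sub 1
        simpa using this
      have h2 : Tendsto (fun r : ℝ => (r - κ) / (r + κ)) atTop (𝓝 1) := by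
        refine h1.congr' ?_
        filter_upwards [eventually_gt_atTop 0] with r hr
        have : r + κ ≠ 0 := by linarith
        field_simp
        ring
      simpa using (h2.log one_ne_zero).const_mul (κ / 2)
    rw [integral_Ioi_of_hasDerivAt_of_tendsto' hd hint hat, hs2]
    have f1 : (√2 * κ - κ) / (√2 * κ + κ) = ((√2 + 1) ^ 2)⁻¹ := by
      have hsq : √2 ^ 2 = 2 := Real.sq_sqrt two_pos.le
      rw [div_eq_iff (by positivity), inv_mul_eq_div, eq_div_iff (by positivity)]
      ring_nf
      rw [show √2 ^ 3 = √2 ^ 2 * √2 by ring, hsq]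
      ring
    rw [f1, Real.log_inv, Real.log_pow]
    push_cast
    ring
  rw [hval] at hlim
  exact hlim

/-- Low temperature asymptotics of `m(T)`. -/
lemma tendsto_radialM (hμ : 0 < μ) :
    Tendsto (fun T => radialM μ T / √μ - Real.log (μ / T)) (𝓝[>] 0)
      (𝓝 (Real.eulerMascheroniConstant - 2 + Real.log (8 / π))) := by
  have hκ0 : 0 < √μ := Real.sqrt_pos.2 hμ
  have h0 : 0 < √(2 * μ) := Real.sqrt_pos.2 (by positivity)
  have hA : Tendsto (fun T : ℝ => μ / (2 * T)) (𝓝[>] 0) atTop := by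
    have := (tendsto_inv_nhdsGT_zero (𝕜 := ℝ)).const_mul_atTop (show 0 < μ / 2 by positivity)
    refine this.congr fun T => ?_
    ring
  have h := (((tendsto_integral_near hμ).add (tendsto_integral_far hμ)).div_const (√μ)).add
    ((tendsto_integral_tanhc.comp hA).sub_const (Real.log 2))
  have hlim : (√μ * (-2 + 2 * Real.log 2 - Real.log (√2 + 1)) + √μ * Real.log (√2 + 1)) / √μ
      + (Real.eulerMascheroniConstant + Real.log (4 / π) - Real.log 2)
      = Real.eulerMascheroniConstant - 2 + Real.log (8 / π) := by
    have e8 : Real.log (8 / π) = Real.log 2 + Real.log (4 / π) := by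
      rw [← Real.log_mul two_ne_zero (by positivity)]
      congr 1; ring
    rw [e8]
    field_simp
    ring
  rw [hlim] at h
  refine h.congr' ?_
  filter_upwards [self_mem_nhdsWithin] with T hT
  have hT0 : 0 < T := hT
  have hc := continuous_kInv (T := T) (μ := μ)
  have hlog : Real.log (μ / (2 * T)) = Real.log (μ / T) - Real.log 2 := by
    rw [← Real.log_div (by positivity) two_ne_zero]
    congr 1; field_simp
  have hsplit : radialM μ T = ((∫ r in Ioc 0 (√(2 * μ)), (r * (r - √μ) * kInv T μ r - 1))
      + ∫ r in Ioi (√(2 * μ)), (r ^ 2 * kInv T μ r - 1))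
      + √μ * ∫ x in (0 : ℝ)..(μ / (2 * T)), tanhc x := by
    have hi := integrableOn_radialM hμ hT0
    rw [← integral_near_eq hμ hT0, ← integral_const_mul, add_right_comm, ← integral_add
      (Continuous.integrableOn_Ioc (by fun_prop)) (Continuous.integrableOn_Ioc (by fun_prop)),
      radialM, ← Ioc_union_Ioi_eq_Ioi h0.le, setIntegral_union Ioc_disjoint_Ioi_same
      measurableSet_Ioi (hi.mono_set Ioc_subset_Ioi_self)
      (hi.mono_set (Ioi_subset_Ioi h0.le))]
    congr 2
    funext r
    ring
  rw [hsplit, Function.comp_apply, hlog]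
  field_simp
  ring

end RadialM

end BCS

namespace BCS

/-! ### The Sobolev inequality `‖ψ‖₆ ≤ C ‖ |ξ| 𝓕ψ ‖₂` on `ℝ³` -/

lemma eLpNorm_two_sq {α E : Type*} [MeasurableSpace α] {ν : Measure α} [NormedAddCommGroup E]
    (f : α → E) : eLpNorm f 2 ν ^ 2 = ∫⁻ x, ‖f x‖ₑ ^ 2 ∂ν := by
  rw [eLpNorm_eq_lintegral_rpow_enorm_toReal two_ne_zero ENNReal.ofNat_ne_top]
  simp only [ENNReal.toReal_ofNat, ENNReal.rpow_two, one_div]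
  rw [← ENNReal.rpow_two, ← ENNReal.rpow_mul]
  norm_num

lemma lintegral_enorm_sq {α : Type*} [MeasurableSpace α] {ν : Measure α} (f : Lp ℂ 2 ν) :
    ∫⁻ x, ‖f x‖ₑ ^ 2 ∂ν = ENNReal.ofReal (‖f‖ ^ 2) := by
  rw [← eLpNorm_two_sq, ENNReal.ofReal_pow (norm_nonneg _), Lp.norm_def,
    ENNReal.ofReal_toReal (Lp.eLpNorm_ne_top f)]

/-- On `L¹ ∩ L²` the `L²` inverse Fourier transform is given by the integral. -/
lemma fourierInv_ae_eq {f : L2R3} (hf : Integrable f) :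
    (𝓕⁻ f : L2R3) =ᵐ[volume] 𝓕⁻ (f : R3 → ℂ) := by
  have hcont : Continuous (𝓕⁻ (f : R3 → ℂ)) :=
    VectorFourier.fourierIntegral_continuous Real.continuous_fourierChar
      ((continuous_inner (𝕜 := ℝ) (E := R3)).neg) hf
  refine ae_eq_of_integral_contDiff_smul_eq
    ((Lp.memLp (𝓕⁻ f : L2R3)).locallyIntegrable (by norm_num)) hcont.locallyIntegrable ?_
  intro g hg hgs
  have hg1 : ContDiff ℝ (↑(⊤ : ℕ∞)) (fun x => (g x : ℂ)) := Complex.ofRealCLM.contDiff.comp hg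
  have hg2 : HasCompactSupport (fun x => (g x : ℂ)) := hgs.comp_left Complex.ofReal_zero
  set G := hg2.toSchwartzMap hg1 with hG
  have hGx : ∀ x, G x = (g x : ℂ) := fun x => rfl
  have h1 := congrArg (fun D => D G) (Lp.fourierInv_toTemperedDistribution_eq f)
  simp only [TemperedDistribution.fourierInv_apply, Lp.toTemperedDistribution_apply] at h1
  have h2 := VectorFourier.integral_fourierIntegral_smul_eq_flip (L := -innerₗ R3)
    (μ := volume) (ν := volume) Real.continuous_fourierChar
    ((continuous_inner (𝕜 := ℝ) (E := R3)).neg) G.integrable hf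
  have h3 : (-innerₗ R3).flip = -innerₗ R3 := by
    ext x y
    simp [real_inner_comm]
  rw [h3] at h2
  have h4 : ∀ x, (𝓕⁻ G) x = VectorFourier.fourierIntegral 𝐞 volume (-innerₗ R3) G x := fun x => by
    rw [SchwartzMap.fourierInv_coe]; rfl
  simp only [h4] at h1
  rw [h1] at h2
  simp only [hGx] at h2
  simp only [Complex.real_smul]
  exact h2

lemma norm_fourierInv_le (f : R3 → ℂ) (x : R3) : ‖𝓕⁻ f x‖ ≤ ∫ ξ, ‖f ξ‖ :=
  VectorFourier.norm_fourierIntegral_le_integral_norm _ _ _ _ _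

/-- `‖ξ‖⁻²` is integrable near the origin of `ℝ³`, and its integral over a ball is linear in the
radius. -/
lemma integrableOn_ball_inv_sq (A : ℝ) :
    IntegrableOn (fun ξ : R3 => (‖ξ‖ ^ 2)⁻¹) (Metric.ball 0 A) ∧
      (0 < A → ∫ ξ in Metric.ball (0 : R3) A, (‖ξ‖ ^ 2)⁻¹ = 4 * π * A) := by
  have hd : Module.finrank ℝ R3 = 3 := by simp
  constructor
  · rw [integrableOn_fun_norm_addHaar (volume : Measure R3) (f := fun r => (r ^ 2)⁻¹), hd]
    refine IntegrableOn.congr_fun (f := fun _ => (1 : ℝ))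
      (integrableOn_const measure_Ioo_lt_top.ne) (fun r hr => ?_) measurableSet_Ioo
    have : r ≠ 0 := hr.1.ne'
    simp [this]
  · intro hA
    have e : ∀ ξ : R3, (Metric.ball (0 : R3) A).indicator (fun ξ : R3 => (‖ξ‖ ^ 2)⁻¹) ξ
        = (Iio A).indicator (fun r : ℝ => (r ^ 2)⁻¹) ‖ξ‖ := by
      intro ξ
      simp [indicator]
    rw [← integral_indicator measurableSet_ball]
    simp only [e]
    rw [integral_fun_norm_addHaar (volume : Measure R3) ((Iio A).indicator (fun r : ℝ => (r ^ 2)⁻¹)),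
      hd, measureReal_def, EuclideanSpace.volume_ball_fin_three]
    have e2 : ∀ y ∈ Ioi (0 : ℝ), y ^ (3 - 1) • (Iio A).indicator (fun r : ℝ => (r ^ 2)⁻¹) y
        = (Iio A).indicator (fun _ => (1 : ℝ)) y := by
      intro y hy
      have : y ≠ 0 := (show 0 < y from hy).ne'
      by_cases hyA : y ∈ Iio A
      · simp [indicator_of_mem hyA, this]
      · simp [indicator_of_notMem hyA]
    rw [setIntegral_congr_fun measurableSet_Ioi e2, setIntegral_indicator measurableSet_Iio]
    simp only [Ioi_inter_Iio, integral_const, MeasurableSet.univ, measureReal_restrict_apply,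
      univ_inter, Real.volume_real_Ioo_of_le hA.le, smul_eq_mul, nsmul_eq_mul]
    rw [ENNReal.toReal_mul, ENNReal.toReal_ofReal (by positivity)]
    simp
    ring

/-- The part of `𝓕ψ` in the ball of radius `A` produces a function bounded by `√(4πA) N`, where `N`
bounds `‖ |ξ| 𝓕ψ ‖₂`. -/
lemma integral_ball_norm_le {g : L2R3} {N A : ℝ} (hN : 0 < N) (hA : 0 < A)
    (hg : MemLp (fun ξ : R3 => (‖ξ‖ : ℂ) * g ξ) 2)
    (hgN : ∫ ξ, ‖(‖ξ‖ : ℂ) * g ξ‖ ^ 2 ≤ N ^ 2) :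
    IntegrableOn g (Metric.ball 0 A) ∧
      ∫ ξ in Metric.ball (0 : R3) A, ‖g ξ‖ ≤ √(4 * π * A) * N := by
  obtain ⟨h1, h2⟩ := integrableOn_ball_inv_sq A
  have h2 := h2 hA
  have hs : 0 < √(4 * π * A) := Real.sqrt_pos.2 (by positivity)
  have hs2 : √(4 * π * A) ^ 2 = 4 * π * A := Real.sq_sqrt (by positivity)
  set σ := √(4 * π * A) with hσ
  have h3 : Integrable (fun ξ : R3 => ‖(‖ξ‖ : ℂ) * g ξ‖ ^ 2) := hg.integrable_norm_pow two_ne_zero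
  have hdom : IntegrableOn (fun ξ : R3 => N / (2 * σ) * (‖ξ‖ ^ 2)⁻¹
      + σ / (2 * N) * ‖(‖ξ‖ : ℂ) * g ξ‖ ^ 2) (Metric.ball 0 A) :=
    (h1.const_mul _).add ((h3.integrableOn).const_mul _)
  have hpt : ∀ᵐ ξ ∂(volume.restrict (Metric.ball (0 : R3) A)), ‖g ξ‖ ≤ N / (2 * σ) * (‖ξ‖ ^ 2)⁻¹
      + σ / (2 * N) * ‖(‖ξ‖ : ℂ) * g ξ‖ ^ 2 := by
    refine ae_restrict_of_ae ?_
    filter_upwards [compl_mem_ae_iff.2 (measure_singleton (0 : R3))] with ξ hξ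
    have hξ0 : 0 < ‖ξ‖ := norm_pos_iff.2 hξ
    rw [norm_mul, Complex.norm_real, norm_norm]
    have e : N / (2 * σ) * (‖ξ‖ ^ 2)⁻¹ + σ / (2 * N) * (‖ξ‖ * ‖g ξ‖) ^ 2 - ‖g ξ‖
        = (N - σ * ‖ξ‖ ^ 2 * ‖g ξ‖) ^ 2 / (2 * σ * N * ‖ξ‖ ^ 2) := by
      field_simp
      ring
    have : 0 ≤ (N - σ * ‖ξ‖ ^ 2 * ‖g ξ‖) ^ 2 / (2 * σ * N * ‖ξ‖ ^ 2) := by positivity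
    linarith
  have hint : IntegrableOn g (Metric.ball 0 A) :=
    hdom.mono' (Lp.aestronglyMeasurable g).restrict hpt
  refine ⟨hint, (integral_mono_ae hint.norm hdom hpt).trans ?_⟩
  rw [integral_add (h1.const_mul _) ((h3.integrableOn).const_mul _), integral_const_mul,
    integral_const_mul, h2, ← hs2]
  have h4 : ∫ ξ in Metric.ball (0 : R3) A, ‖(‖ξ‖ : ℂ) * g ξ‖ ^ 2 ≤ N ^ 2 :=
    (setIntegral_le_integral h3 (Eventually.of_forall fun _ => by positivity)).trans hgN
  calc N / (2 * σ) * σ ^ 2 + σ / (2 * N) * ∫ ξ in Metric.ball (0 : R3) A, ‖(‖ξ‖ : ℂ) * g ξ‖ ^ 2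
      ≤ N / (2 * σ) * σ ^ 2 + σ / (2 * N) * N ^ 2 := by gcongr
    _ = σ * N := by field_simp; ring

/-- A level set of `ψ` is controlled by the frequencies that the level cannot see. -/
lemma volume_level_le {ψ : L2R3} {N t : ℝ} (hN : 0 < N) (ht : 0 < t)
    (hg : MemLp (fun ξ : R3 => (‖ξ‖ : ℂ) * (𝓕 ψ : L2R3) ξ) 2)
    (hgN : ∫ ξ, ‖(‖ξ‖ : ℂ) * (𝓕 ψ : L2R3) ξ‖ ^ 2 ≤ N ^ 2) :
    volume {x | t < ‖ψ x‖} ≤ ENNReal.ofReal (4 / t ^ 2) *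
      ∫⁻ ξ, {ξ : R3 | t ^ 2 ≤ 64 * π * N ^ 2 * ‖ξ‖}.indicator
        (fun ξ => ‖(𝓕 ψ : L2R3) ξ‖ₑ ^ 2) ξ := by
  set g : L2R3 := 𝓕 ψ with hgdef
  set A : ℝ := t ^ 2 / (64 * π * N ^ 2) with hA
  have hA0 : 0 < A := by positivity
  obtain ⟨hint, hle⟩ := integral_ball_norm_le hN hA0 hg hgN
  have hσ : √(4 * π * A) * N = t / 4 := by
    have : 4 * π * A = (t / (4 * N)) ^ 2 := by rw [hA]; field_simp; ring
    rw [this, Real.sqrt_sq (by positivity)]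
    field_simp
  rw [hσ] at hle
  have hlowM : MemLp ((Metric.ball (0 : R3) A).indicator g) 2 :=
    (Lp.memLp g).indicator measurableSet_ball
  set low : L2R3 := hlowM.toLp _ with hlow
  have hlowae : low =ᵐ[volume] (Metric.ball (0 : R3) A).indicator g := hlowM.coeFn_toLp
  have hlowint : Integrable low :=
    ((integrable_indicator_iff measurableSet_ball).2 hint).congr hlowae.symm
  have hbound : ∀ᵐ x, ‖(𝓕⁻ low : L2R3) x‖ ≤ t / 4 := by
    filter_upwards [fourierInv_ae_eq hlowint] with x hx
    rw [hx]
    refine (norm_fourierInv_le _ _).trans (le_trans (le_of_eq ?_) hle)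
    rw [← integral_indicator measurableSet_ball]
    refine integral_congr_ae ?_
    filter_upwards [hlowae] with ξ hξ
    rw [hξ, norm_indicator_eq_indicator_norm]
  set high : L2R3 := g - low with hhigh
  have hdec : ψ = 𝓕⁻ low + 𝓕⁻ high := by
    have h1 : (𝓕⁻ g : L2R3) = ψ := FourierTransform.fourierInv_fourier_eq ψ
    rw [hhigh, ← h1]
    have := (Lp.fourierTransformₗᵢ R3 ℂ).symm.map_sub g low
    change (𝓕⁻ (g - low) : L2R3) = 𝓕⁻ g - 𝓕⁻ low at this
    rw [this]
    abel
  have hsub : volume {x | t < ‖ψ x‖}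
      ≤ volume {x | ENNReal.ofReal (t ^ 2 / 4) ≤ ‖(𝓕⁻ high : L2R3) x‖ₑ ^ 2} := by
    refine measure_mono_ae ?_
    have h1 := Lp.coeFn_add (𝓕⁻ low : L2R3) (𝓕⁻ high)
    rw [← hdec] at h1
    filter_upwards [hbound, h1] with x hx1 hx2 (hx3 : t < ‖ψ x‖)
    rw [hx2, Pi.add_apply] at hx3
    have h4 := norm_add_le ((𝓕⁻ low : L2R3) x) ((𝓕⁻ high : L2R3) x)
    change ENNReal.ofReal (t ^ 2 / 4) ≤ ‖(𝓕⁻ high : L2R3) x‖ₑ ^ 2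
    rw [← ofReal_norm, ← ENNReal.ofReal_pow (norm_nonneg _)]
    refine ENNReal.ofReal_le_ofReal ?_
    have h5 : t / 2 ≤ ‖(𝓕⁻ high : L2R3) x‖ := by linarith
    nlinarith
  have hmarkov := meas_ge_le_lintegral_div (μ := (volume : Measure R3))
    (f := fun x => ‖(𝓕⁻ high : L2R3) x‖ₑ ^ 2)
    ((Lp.aestronglyMeasurable _).enorm.pow_const 2)
    (ε := ENNReal.ofReal (t ^ 2 / 4)) (by simp; positivity) ENNReal.ofReal_ne_top
  refine hsub.trans (hmarkov.trans (le_of_eq ?_))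
  rw [ENNReal.div_eq_inv_mul, ← ENNReal.ofReal_inv_of_pos (by positivity), inv_div]
  congr 1
  rw [lintegral_enorm_sq]
  have hn : ‖(𝓕⁻ high : L2R3)‖ = ‖high‖ := (Lp.fourierTransformₗᵢ R3 ℂ).symm.norm_map high
  rw [hn, ← lintegral_enorm_sq]
  refine lintegral_congr_ae ?_
  filter_upwards [Lp.coeFn_sub g low, hlowae] with ξ h1 h2
  rw [hhigh, h1, Pi.sub_apply, h2]
  have hiff : t ^ 2 ≤ 64 * π * N ^ 2 * ‖ξ‖ ↔ A ≤ ‖ξ‖ := by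
    rw [hA, div_le_iff₀ (by positivity)]
    constructor <;> intro h <;> linarith
  by_cases hξ : A ≤ ‖ξ‖
  · rw [indicator_of_notMem (by simpa using hξ), 
      indicator_of_mem (show ξ ∈ {ξ : R3 | t ^ 2 ≤ 64 * π * N ^ 2 * ‖ξ‖} from hiff.2 hξ), sub_zero]
  · rw [indicator_of_mem (by simpa using hξ), 
      indicator_of_notMem (show ξ ∉ {ξ : R3 | t ^ 2 ≤ 64 * π * N ^ 2 * ‖ξ‖} from
        fun h => hξ (hiff.1 h)), sub_self]
    simp

lemma lintegral_cube_le (a : ℝ) (ha : 0 ≤ a) :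
    ∫⁻ t in Ioi (0 : ℝ), {t : ℝ | t ^ 2 ≤ a}.indicator (fun t => ENNReal.ofReal (t ^ 3)) t
      = ENNReal.ofReal (a ^ 2 / 4) := by
  have hm : MeasurableSet {t : ℝ | t ^ 2 ≤ a} := measurableSet_le (by fun_prop) (by fun_prop)
  rw [lintegral_indicator hm, Measure.restrict_restrict hm]
  have e : {t : ℝ | t ^ 2 ≤ a} ∩ Ioi 0 = Ioc 0 (√a) := by
    ext t
    simp only [mem_inter_iff, mem_ofPred_eq, mem_Ioi, mem_Ioc]
    constructor
    · rintro ⟨h1, h2⟩; exact ⟨h2, Real.le_sqrt_of_sq_le h1⟩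
    · rintro ⟨h1, h2⟩; exact ⟨by rwa [Real.le_sqrt h1.le ha] at h2, h1⟩
  rw [e, ← ofReal_integral_eq_lintegral_ofReal]
  · rw [← intervalIntegral.integral_of_le (Real.sqrt_nonneg _), integral_pow]
    congr 1
    have : √a ^ 4 = a ^ 2 := by
      rw [show √a ^ 4 = (√a ^ 2) ^ 2 by ring, Real.sq_sqrt ha]
    norm_num
    rw [this]
  · exact Continuous.integrableOn_Ioc (by fun_prop)
  · filter_upwards [ae_restrict_mem measurableSet_Ioc] with t ht
    exact pow_nonneg ht.1.le 3

/-- The Sobolev inequality, by the layer cake formula and a level-dependent frequency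
cut-off (Chemin–Xu). -/
lemma lintegral_norm_pow_six_le {ψ : L2R3} {N : ℝ} (hN : 0 < N)
    (hg : MemLp (fun ξ : R3 => (‖ξ‖ : ℂ) * (𝓕 ψ : L2R3) ξ) 2)
    (hgN : ∫ ξ, ‖(‖ξ‖ : ℂ) * (𝓕 ψ : L2R3) ξ‖ ^ 2 ≤ N ^ 2) :
    ∫⁻ x, ENNReal.ofReal (‖ψ x‖ ^ (6 : ℝ)) ≤ ENNReal.ofReal (24576 * π ^ 2 * N ^ 6) := by
  set g : L2R3 := 𝓕 ψ with hgdef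
  rw [lintegral_rpow_eq_lintegral_meas_lt_mul volume (Eventually.of_forall fun x => norm_nonneg _)
    (Lp.aestronglyMeasurable ψ).norm.aemeasurable (by norm_num : (0 : ℝ) < 6)]
  set B : ℝ := 64 * π * N ^ 2 with hB
  have hB0 : 0 < B := by positivity
  -- a measurable representative of `𝓕ψ`, for Tonelli's theorem
  obtain ⟨G, hGm, hGae⟩ := (Lp.aestronglyMeasurable g)
  have hind : ∀ (t : ℝ) (ξ : R3), {ξ : R3 | t ^ 2 ≤ B * ‖ξ‖}.indicator
      (fun ξ => ‖G ξ‖ₑ ^ 2) ξ * ENNReal.ofReal (t ^ 3)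
      = ‖G ξ‖ₑ ^ 2 * {t : ℝ | t ^ 2 ≤ B * ‖ξ‖}.indicator (fun t => ENNReal.ofReal (t ^ 3)) t := by
    intro t ξ
    by_cases h : t ^ 2 ≤ B * ‖ξ‖
    · rw [indicator_of_mem (show ξ ∈ {ξ : R3 | t ^ 2 ≤ B * ‖ξ‖} from h),
        indicator_of_mem (show t ∈ {t : ℝ | t ^ 2 ≤ B * ‖ξ‖} from h)]
    · rw [indicator_of_notMem (show ξ ∉ {ξ : R3 | t ^ 2 ≤ B * ‖ξ‖} from h),
        indicator_of_notMem (show t ∉ {t : ℝ | t ^ 2 ≤ B * ‖ξ‖} from h)]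
      simp
  have hstep : ∀ t ∈ Ioi (0 : ℝ), volume {x | t < ‖ψ x‖} * ENNReal.ofReal (t ^ ((6 : ℝ) - 1))
      ≤ 4 * ∫⁻ ξ, ‖G ξ‖ₑ ^ 2 *
        {t : ℝ | t ^ 2 ≤ B * ‖ξ‖}.indicator (fun t => ENNReal.ofReal (t ^ 3)) t := by
    intro t ht
    have ht0 : 0 < t := ht
    refine (mul_le_mul_left (volume_level_le hN ht0 hg hgN) _).trans ?_
    have e1 : ENNReal.ofReal (t ^ ((6 : ℝ) - 1)) = ENNReal.ofReal (t ^ 2) * ENNReal.ofReal (t ^ 3) := by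
      rw [← ENNReal.ofReal_mul (by positivity), ← pow_add]
      congr 1
      rw [show (6 : ℝ) - 1 = ((5 : ℕ) : ℝ) by norm_num, Real.rpow_natCast]
    have e2 : ENNReal.ofReal (4 / t ^ 2) * ENNReal.ofReal (t ^ 2) = 4 := by
      rw [← ENNReal.ofReal_mul (by positivity), div_mul_cancel₀ _ (by positivity)]
      simp
    have e3 : ∫⁻ ξ, {ξ : R3 | t ^ 2 ≤ 64 * π * N ^ 2 * ‖ξ‖}.indicator (fun ξ => ‖g ξ‖ₑ ^ 2) ξ
        = ∫⁻ ξ, {ξ : R3 | t ^ 2 ≤ B * ‖ξ‖}.indicator (fun ξ => ‖G ξ‖ₑ ^ 2) ξ := by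
      refine lintegral_congr_ae ?_
      filter_upwards [hGae] with ξ hξ
      simp only [indicator, hξ, hB]
    rw [e1, e3, mul_mul_mul_comm, e2, ← lintegral_mul_const']
    · simp only [hind]; exact le_rfl
    · exact ENNReal.ofReal_ne_top
  have hmeas : Measurable (fun z : ℝ × R3 => ‖G z.2‖ₑ ^ 2 *
      {t : ℝ | t ^ 2 ≤ B * ‖z.2‖}.indicator (fun t => ENNReal.ofReal (t ^ 3)) z.1) := by
    have e : (fun z : ℝ × R3 => {t : ℝ | t ^ 2 ≤ B * ‖z.2‖}.indicator
        (fun t => ENNReal.ofReal (t ^ 3)) z.1)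
        = {z : ℝ × R3 | z.1 ^ 2 ≤ B * ‖z.2‖}.indicator (fun z => ENNReal.ofReal (z.1 ^ 3)) := by
      funext z
      simp only [indicator, mem_ofPred_eq]
    refine Measurable.mul ((hGm.measurable.comp measurable_snd).enorm.pow_const 2) ?_
    rw [e]
    exact Measurable.indicator (by fun_prop) (measurableSet_le (by fun_prop) (by fun_prop))
  calc ENNReal.ofReal 6 * ∫⁻ t in Ioi (0 : ℝ),
        volume {x | t < ‖ψ x‖} * ENNReal.ofReal (t ^ ((6 : ℝ) - 1))
      ≤ ENNReal.ofReal 6 * ∫⁻ t in Ioi (0 : ℝ), 4 * ∫⁻ ξ, ‖G ξ‖ₑ ^ 2 *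
        {t : ℝ | t ^ 2 ≤ B * ‖ξ‖}.indicator (fun t => ENNReal.ofReal (t ^ 3)) t := by
        gcongr 1
        exact setLIntegral_mono_ae' measurableSet_Ioi (Eventually.of_forall hstep)
    _ = ENNReal.ofReal 6 * (4 * ∫⁻ ξ, ‖G ξ‖ₑ ^ 2 * ENNReal.ofReal ((B * ‖ξ‖) ^ 2 / 4)) := by
        rw [lintegral_const_mul' _ _ (by norm_num), lintegral_lintegral_swap hmeas.aemeasurable]
        congr 2
        refine lintegral_congr fun ξ => ?_
        rw [lintegral_const_mul' _ _ (by simp), lintegral_cube_le _ (by positivity)]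
    _ = ENNReal.ofReal 6 * (4 * (ENNReal.ofReal (B ^ 2 / 4) *
          ∫⁻ ξ, ENNReal.ofReal (‖(‖ξ‖ : ℂ) * g ξ‖ ^ 2))) := by
        rw [← lintegral_const_mul' _ _ ENNReal.ofReal_ne_top]
        congr 2
        refine lintegral_congr_ae ?_
        filter_upwards [hGae] with ξ hξ
        rw [← hξ, ← ofReal_norm, ← ENNReal.ofReal_pow (norm_nonneg _),
          ← ENNReal.ofReal_mul (by positivity), ← ENNReal.ofReal_mul (by positivity), norm_mul,
          Complex.norm_real, norm_norm]
        congr 1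
        ring
    _ ≤ ENNReal.ofReal 6 * (4 * (ENNReal.ofReal (B ^ 2 / 4) * ENNReal.ofReal (N ^ 2))) := by
        rw [← ofReal_integral_eq_lintegral_ofReal (hg.integrable_norm_pow two_ne_zero)
          (Eventually.of_forall fun _ => by positivity)]
        gcongr
    _ = ENNReal.ofReal (24576 * π ^ 2 * N ^ 6) := by
        rw [show (4 : ℝ≥0∞) = ENNReal.ofReal 4 by simp, ← ENNReal.ofReal_mul (by positivity),
          ← ENNReal.ofReal_mul (by positivity), ← ENNReal.ofReal_mul (by positivity)]
        congr 1
        rw [hB]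
        ring

/-- Sobolev's inequality on `H¹(ℝ³)`. -/
lemma exists_sobolev : ∃ C : ℝ, 0 < C ∧ ∀ (ψ : L2R3) (N : ℝ), 0 ≤ N →
    MemLp (fun ξ : R3 => (‖ξ‖ : ℂ) * (𝓕 ψ : L2R3) ξ) 2 →
    ∫ ξ, ‖(‖ξ‖ : ℂ) * (𝓕 ψ : L2R3) ξ‖ ^ 2 ≤ N ^ 2 →
    eLpNorm ψ 6 volume ≤ ENNReal.ofReal (C * N) := by
  set C : ℝ := (24576 * π ^ 2) ^ ((1 : ℝ) / 6) with hC
  have hC0 : 0 < C := by positivity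
  refine ⟨C, hC0, fun ψ N hN hg hgN => ?_⟩
  have hpos : ∀ M : ℝ, 0 < M → N ≤ M → eLpNorm ψ 6 volume ≤ ENNReal.ofReal (C * M) := by
    intro M hM hNM
    have h := lintegral_norm_pow_six_le hM hg (hgN.trans (by gcongr))
    rw [eLpNorm_eq_lintegral_rpow_enorm_toReal (by norm_num) (by norm_num)]
    have e1 : ∀ x, ‖ψ x‖ₑ ^ (6 : ℝ≥0∞).toReal = ENNReal.ofReal (‖ψ x‖ ^ (6 : ℝ)) := by
      intro x
      rw [← ofReal_norm, ENNReal.toReal_ofNat, ENNReal.ofReal_rpow_of_nonneg (norm_nonneg _)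
        (by norm_num)]
    simp only [e1]
    refine (ENNReal.rpow_le_rpow h (by simp)).trans (le_of_eq ?_)
    rw [ENNReal.toReal_ofNat, ENNReal.ofReal_rpow_of_nonneg (by positivity) (by norm_num),
      Real.mul_rpow (by positivity) (by positivity), ← Real.rpow_natCast M, ← Real.rpow_mul hM.le]
    norm_num [hC]
  have hlim : Tendsto (fun M => ENNReal.ofReal (C * M)) (𝓝[>] N) (𝓝 (ENNReal.ofReal (C * N))) :=
    (ENNReal.continuous_ofReal.comp (by fun_prop : Continuous fun M : ℝ => C * M)).continuousWithinAt
  refine ge_of_tendsto hlim ?_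
  filter_upwards [self_mem_nhdsWithin] with M hM
  exact hpos M (lt_of_le_of_lt hN hM) (le_of_lt hM)

end BCS

namespace BCS

/-! ### Bounded operators given by pointwise formulas -/

section Builder

variable {H α : Type*} [NormedAddCommGroup H] [NormedSpace ℂ H] [MeasurableSpace α]
  {ν : Measure α}

/-- A family `T u` of functions that is linear in `u` up to null sets, and bounded in `L²`, is given
by a bounded operator into `L²`. -/
lemma exists_clm_of_ae (T : H → α → ℂ) (hT : ∀ u, AEStronglyMeasurable (T u) ν)
    (hadd : ∀ u w, T (u + w) =ᵐ[ν] fun x => T u x + T w x)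
    (hsmul : ∀ (c : ℂ) u, T (c • u) =ᵐ[ν] fun x => c * T u x)
    {C : ℝ} (hC : 0 ≤ C) (hb : ∀ u, eLpNorm (T u) 2 ν ≤ ENNReal.ofReal (C * ‖u‖)) :
    ∃ A : H →L[ℂ] Lp ℂ 2 ν, (∀ u, A u =ᵐ[ν] T u) ∧ ‖A‖ ≤ C := by
  have hM : ∀ u, MemLp (T u) 2 ν := fun u => ⟨hT u, (hb u).trans_lt ENNReal.ofReal_lt_top⟩
  let A₀ : H →ₗ[ℂ] Lp ℂ 2 ν :=
    { toFun := fun u => (hM u).toLp _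
      map_add' := fun u w => by
        refine Lp.ext ?_
        filter_upwards [(hM (u + w)).coeFn_toLp, (hM u).coeFn_toLp, (hM w).coeFn_toLp,
          Lp.coeFn_add ((hM u).toLp _) ((hM w).toLp _), hadd u w] with x h1 h2 h3 h4 h5
        rw [h1, h4, Pi.add_apply, h2, h3, h5]
      map_smul' := fun c u => by
        refine Lp.ext ?_
        filter_upwards [(hM (c • u)).coeFn_toLp, (hM u).coeFn_toLp,
          Lp.coeFn_smul c ((hM u).toLp _), hsmul c u] with x h1 h2 h4 h5
        rw [h1, RingHom.id_apply, h4, Pi.smul_apply, h2, h5, smul_eq_mul] }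
  have hA₀ : ∀ u, ‖A₀ u‖ ≤ C * ‖u‖ := fun u => by
    change ‖(hM u).toLp _‖ ≤ _
    rw [Lp.norm_toLp]
    exact ENNReal.toReal_le_of_le_ofReal (by positivity) (hb u)
  exact ⟨A₀.mkContinuous C hA₀, fun u => (hM u).coeFn_toLp,
    LinearMap.mkContinuous_norm_le _ hC _⟩

lemma exists_mul_clm (m : α → ℂ) (hm : AEStronglyMeasurable m ν) {C : ℝ} (hC : 0 ≤ C)
    (hb : ∀ x, ‖m x‖ ≤ C) :
    ∃ A : Lp ℂ 2 ν →L[ℂ] Lp ℂ 2 ν, (∀ u, A u =ᵐ[ν] fun x => m x * u x) ∧ ‖A‖ ≤ C := by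
  refine exists_clm_of_ae (fun (u : Lp ℂ 2 ν) x => m x * u x)
    (fun u => hm.mul (Lp.aestronglyMeasurable u)) (fun u w => ?_) (fun c u => ?_) hC (fun u => ?_)
  · filter_upwards [Lp.coeFn_add u w] with x hx
    rw [hx, Pi.add_apply, mul_add]
  · filter_upwards [Lp.coeFn_smul c u] with x hx
    rw [hx, Pi.smul_apply, smul_eq_mul, mul_left_comm]
  · refine (eLpNorm_le_mul_eLpNorm_of_ae_le_mul (g := u) (c := C)
      (Eventually.of_forall fun x => ?_) 2).trans ?_
    · rw [norm_mul]
      exact mul_le_mul_of_nonneg_right (hb x) (norm_nonneg _)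
    · rw [ENNReal.ofReal_mul hC, Lp.norm_def, ENNReal.ofReal_toReal (Lp.eLpNorm_ne_top u)]

end Builder

/-- Multiplication by a real function is symmetric. -/
lemma isSelfAdjoint_of_mul {α : Type*} [MeasurableSpace α] {ν : Measure α} {m : α → ℝ}
    {A : Lp ℂ 2 ν →L[ℂ] Lp ℂ 2 ν} (hA : ∀ u, A u =ᵐ[ν] fun x => (m x : ℂ) * u x) :
    IsSelfAdjoint A := by
  rw [ContinuousLinearMap.isSelfAdjoint_iff_isSymmetric]
  intro u w
  change inner ℂ (A u) w = inner ℂ u (A w)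
  rw [L2.inner_def, L2.inner_def]
  refine integral_congr_ae ?_
  filter_upwards [hA u, hA w] with x h1 h2
  rw [h1, h2]
  simp only [RCLike.inner_apply, map_mul, Complex.conj_ofReal]
  ring

/-- Fubini's theorem for an integrable product against a unimodular kernel. -/
lemma integral_phase_swap {α β : Type*} [MeasurableSpace α] [MeasurableSpace β]
    {ν : Measure α} {ω : Measure β} [SFinite ν] [SFinite ω] {φ : α → β → ℝ}
    (hφ : Measurable (Function.uncurry φ)) {g : α → ℂ} (hg : Integrable g ν) {h : β → ℂ}
    (hh : Integrable h ω) :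
    ∫ x, g x * ∫ y, Complex.exp (-Complex.I * (φ x y : ℝ)) * h y ∂ω ∂ν
      = ∫ y, (∫ x, g x * Complex.exp (-Complex.I * (φ x y : ℝ)) ∂ν) * h y ∂ω := by
  have hI : Integrable (Function.uncurry fun x y =>
      g x * (Complex.exp (-Complex.I * (φ x y : ℝ)) * h y)) (ν.prod ω) := by
    have h1 := (hg.mul_prod hh).bdd_mul (c := 1)
      (f := fun z : α × β => Complex.exp (-Complex.I * (Function.uncurry φ z : ℝ)))
      (Measurable.aestronglyMeasurable (by fun_prop))
      (Eventually.of_forall fun z => by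
        have : -Complex.I * ((Function.uncurry φ z : ℝ) : ℂ)
          = ((-Function.uncurry φ z : ℝ) : ℂ) * Complex.I := by push_cast; ring
        rw [this, Complex.norm_exp_ofReal_mul_I])
    refine h1.congr (Eventually.of_forall fun z => ?_)
    simp only [Function.uncurry]
    ring
  simp only [← integral_const_mul, ← integral_mul_const]
  rw [integral_integral_swap hI]
  simp only [mul_assoc]

/-! ### The factorization `V = |V|^{1/2} · sgn V · |V|^{1/2}` -/

/-- `v = |V|^{1/2}`. -/
def sqrtAbs (V : R3 → ℝ) (x : R3) : ℝ := √|V x|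

/-- The sign of `V`, with the value `1` where `V` vanishes, so that its square is `1`. -/
def signV (V : R3 → ℝ) (x : R3) : ℝ := if V x < 0 then -1 else 1

lemma signV_mul_self (V : R3 → ℝ) (x : R3) : signV V x * signV V x = 1 := by
  unfold signV; split_ifs <;> norm_num

lemma abs_signV (V : R3 → ℝ) (x : R3) : |signV V x| = 1 := by
  unfold signV; split_ifs <;> norm_num

lemma sqrtAbs_mul_signV_mul (V : R3 → ℝ) (x : R3) :
    sqrtAbs V x * signV V x * sqrtAbs V x = V x := by
  have h : sqrtAbs V x * sqrtAbs V x = |V x| := Real.mul_self_sqrt (abs_nonneg _)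
  rw [mul_right_comm, h, signV]
  split_ifs with h0
  · rw [abs_of_neg h0]; ring
  · rw [abs_of_nonneg (not_lt.1 h0)]; ring

lemma aestronglyMeasurable_signV {V : R3 → ℝ} (hV : AEStronglyMeasurable V) :
    AEStronglyMeasurable (signV V) := by
  have : Measurable (fun t : ℝ => if t < 0 then (-1 : ℝ) else 1) :=
    Measurable.ite measurableSet_Iio measurable_const measurable_const
  exact (this.comp_aemeasurable hV.aemeasurable).aestronglyMeasurable

lemma memLp_sqrtAbs {V : R3 → ℝ} {p : ℝ≥0∞} (hV : MemLp V p) : MemLp (sqrtAbs V) (2 * p) := by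
  have h := hV.norm_rpow_div (1 / 2)
  have e : p / (1 / 2) = 2 * p := by
    rw [ENNReal.div_eq_inv_mul, one_div, inv_inv]
  rw [e] at h
  refine h.ae_eq (Eventually.of_forall fun x => ?_)
  simp only [sqrtAbs, Real.sqrt_eq_rpow, Real.norm_eq_abs]
  norm_num

lemma memLp_sqrtAbs_two {V : R3 → ℝ} (hV : MemLp V 1) : MemLp (sqrtAbs V) 2 := by
  simpa using memLp_sqrtAbs hV

lemma memLp_sqrtAbs_three {V : R3 → ℝ} (hV : MemLp V (3 / 2)) : MemLp (sqrtAbs V) 3 := by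
  have e : (2 : ℝ≥0∞) * (3 / 2) = 3 := ENNReal.mul_div_cancel (by norm_num) (by norm_num)
  simpa only [e] using memLp_sqrtAbs hV

lemma exists_signOp {V : R3 → ℝ} (hV : AEStronglyMeasurable V) :
    ∃ A : L2R3 →L[ℂ] L2R3, (∀ u, A u =ᵐ[volume] fun x => (signV V x : ℂ) * u x) ∧ ‖A‖ ≤ 1 :=
  exists_mul_clm _ (Complex.continuous_ofReal.comp_aestronglyMeasurable
    (aestronglyMeasurable_signV hV)) zero_le_one fun x => by
      rw [Complex.norm_real, Real.norm_eq_abs, abs_signV]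

/-- Multiplication by the sign of `V`. -/
def signOp {V : R3 → ℝ} (hV : AEStronglyMeasurable V) : L2R3 →L[ℂ] L2R3 := (exists_signOp hV).choose

lemma signOp_ae {V : R3 → ℝ} (hV : AEStronglyMeasurable V) (u : L2R3) :
    signOp hV u =ᵐ[volume] fun x => (signV V x : ℂ) * u x := (exists_signOp hV).choose_spec.1 u

lemma norm_signOp_le {V : R3 → ℝ} (hV : AEStronglyMeasurable V) : ‖signOp hV‖ ≤ 1 :=
  (exists_signOp hV).choose_spec.2

lemma isSelfAdjoint_signOp {V : R3 → ℝ} (hV : AEStronglyMeasurable V) :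
    IsSelfAdjoint (signOp hV) := isSelfAdjoint_of_mul (signOp_ae hV)

lemma signOp_mul_self {V : R3 → ℝ} (hV : AEStronglyMeasurable V) :
    signOp hV * signOp hV = 1 := by
  ext1 u
  refine Lp.ext ?_
  rw [mul_apply_eq_comp]
  filter_upwards [signOp_ae hV (signOp hV u), signOp_ae hV u] with x h1 h2
  rw [h1, h2, ← mul_assoc, ← Complex.ofReal_mul, signV_mul_self]
  simp

/-! ### The Fourier transform of `|V|^{1/2} f` and its trace on the Fermi sphere -/

lemma integrable_sqrtAbs_mul {V : R3 → ℝ} (hV : MemLp V 1) (f : L2R3) :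
    Integrable (fun x => (sqrtAbs V x : ℂ) * f x) :=
  MemLp.integrable_mul (p := 2) (q := 2) (memLp_sqrtAbs_two hV).ofReal (Lp.memLp f)

/-- The `L²` norm of `|V|^{1/2}`. -/
def vNorm (V : R3 → ℝ) : ℝ := (eLpNorm (sqrtAbs V) 2).toReal

lemma vNorm_nonneg (V : R3 → ℝ) : 0 ≤ vNorm V := ENNReal.toReal_nonneg

lemma integral_norm_sqrtAbs_mul_le {V : R3 → ℝ} (hV : MemLp V 1) (f : L2R3) :
    ∫ x, ‖(sqrtAbs V x : ℂ) * f x‖ ≤ vNorm V * ‖f‖ := by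
  have hv : MemLp (fun x => (sqrtAbs V x : ℂ)) 2 := (memLp_sqrtAbs_two hV).ofReal
  have h := eLpNorm_smul_le_mul_eLpNorm (p := 2) (q := 2) (r := 1) (μ := (volume : Measure R3))
    (Lp.aestronglyMeasurable f) hv.aestronglyMeasurable
  have e : eLpNorm (fun x => (sqrtAbs V x : ℂ)) 2 volume = eLpNorm (sqrtAbs V) 2 volume :=
    eLpNorm_congr_norm_ae (Eventually.of_forall fun x => by simp)
  rw [e] at h
  rw [integral_norm_eq_lintegral_enorm (integrable_sqrtAbs_mul hV f).aestronglyMeasurable,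
    ← eLpNorm_one_eq_lintegral_enorm, vNorm, Lp.norm_def, ← ENNReal.toReal_mul]
  exact ENNReal.toReal_mono (ENNReal.mul_ne_top (memLp_sqrtAbs_two hV).2.ne
    (Lp.eLpNorm_ne_top f)) h

/-- The Fourier transform of `|V|^{1/2} f`. -/
def gHat (V : R3 → ℝ) (f : L2R3) (p : R3) : ℂ :=
  fourierConst * ∫ x : R3, ((sqrtAbs V x : ℂ) * f x) * Complex.exp (-Complex.I * (inner ℝ p x : ℝ))

lemma norm_fourierConst_le : ‖fourierConst‖ ≤ 1 := by
  rw [fourierConst, Complex.norm_real, Real.norm_eq_abs, abs_of_nonneg (by positivity)]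
  refine Real.rpow_le_one_of_one_le_of_nonpos ?_ (by norm_num)
  nlinarith [Real.pi_gt_three]

lemma integrable_mul_planeWave {g : R3 → ℂ} (hg : Integrable g) (p : R3) :
    Integrable fun x => g x * Complex.exp (-Complex.I * (inner ℝ p x : ℝ)) :=
  hg.mul_bdd (c := 1) (Continuous.aestronglyMeasurable (by fun_prop))
    (Eventually.of_forall fun x => (norm_planeWave _).le)

lemma continuous_gHat {V : R3 → ℝ} (hV : MemLp V 1) (f : L2R3) : Continuous (gHat V f) := by
  unfold gHat
  refine continuous_const.mul ?_
  refine continuous_of_dominated (bound := fun x => ‖(sqrtAbs V x : ℂ) * f x‖)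
    (fun p => (integrable_mul_planeWave (integrable_sqrtAbs_mul hV f) p).aestronglyMeasurable)
    (fun p => Eventually.of_forall fun x => ?_) (integrable_sqrtAbs_mul hV f).norm
    (Eventually.of_forall fun x => by fun_prop)
  rw [norm_mul, norm_planeWave, mul_one]

lemma norm_gHat_le {V : R3 → ℝ} (hV : MemLp V 1) (f : L2R3) (p : R3) :
    ‖gHat V f p‖ ≤ vNorm V * ‖f‖ := by
  unfold gHat
  rw [norm_mul]
  refine (mul_le_of_le_one_left (norm_nonneg _) norm_fourierConst_le).trans ?_
  refine (norm_integral_le_integral_norm _).trans ((le_of_eq ?_).trans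
    (integral_norm_sqrtAbs_mul_le hV f))
  simp only [norm_mul, norm_planeWave, mul_one]

lemma gHat_add {V : R3 → ℝ} (hV : MemLp V 1) (f g : L2R3) (p : R3) :
    gHat V (f + g) p = gHat V f p + gHat V g p := by
  unfold gHat
  rw [← mul_add, ← integral_add (integrable_mul_planeWave (integrable_sqrtAbs_mul hV f) p)
    (integrable_mul_planeWave (integrable_sqrtAbs_mul hV g) p)]
  refine congrArg (fun z : ℂ => fourierConst * z) (integral_congr_ae ?_)
  filter_upwards [Lp.coeFn_add f g] with q hq
  rw [hq, Pi.add_apply]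
  ring

lemma gHat_smul (V : R3 → ℝ) (c : ℂ) (f : L2R3) (p : R3) :
    gHat V (c • f) p = c * gHat V f p := by
  unfold gHat
  rw [mul_left_comm, ← integral_const_mul c]
  refine congrArg (fun z : ℂ => fourierConst * z) (integral_congr_ae ?_)
  filter_upwards [Lp.coeFn_smul c f] with q hq
  rw [hq, Pi.smul_apply, smul_eq_mul]
  ring

lemma exists_fermiTrace {V : R3 → ℝ} (hV : MemLp V 1) (μ : ℝ) :
    ∃ F : L2R3 →L[ℂ] L2Fermi μ, ∀ f, F f =ᵐ[fermiMeasure μ] fun q => gHat V f q := by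
  set M : ℝ := (eLpNorm (fun _ : FermiSphere μ => (1 : ℝ)) 2 (fermiMeasure μ)).toReal
  have hM : eLpNorm (fun _ : FermiSphere μ => (1 : ℝ)) 2 (fermiMeasure μ) ≠ ⊤ :=
    (memLp_const (1 : ℝ)).2.ne
  obtain ⟨F, hF, -⟩ := exists_clm_of_ae (ν := fermiMeasure μ)
    (fun (f : L2R3) (q : FermiSphere μ) => gHat V f q)
    (fun f => ((continuous_gHat hV f).comp continuous_subtype_val).aestronglyMeasurable)
    (fun f g => Eventually.of_forall fun q => gHat_add hV f g q)
    (fun c f => Eventually.of_forall fun q => gHat_smul V c f q)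
    (C := vNorm V * M) (mul_nonneg (vNorm_nonneg V) ENNReal.toReal_nonneg) (fun f => by
      refine (eLpNorm_le_mul_eLpNorm_of_ae_le_mul (g := fun _ : FermiSphere μ => (1 : ℝ))
        (c := vNorm V * ‖f‖) (Eventually.of_forall fun q => ?_) 2).trans ?_
      · simpa using norm_gHat_le hV f q
      · rw [mul_right_comm, ENNReal.ofReal_mul (mul_nonneg (vNorm_nonneg V) (norm_nonneg _)),
          ENNReal.ofReal_toReal hM])
  exact ⟨F, hF⟩

/-- The operator `f ↦ (|V|^{1/2} f)^` restricted to the Fermi sphere. -/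
def fermiTrace {V : R3 → ℝ} (hV : MemLp V 1) (μ : ℝ) : L2R3 →L[ℂ] L2Fermi μ :=
  (exists_fermiTrace hV μ).choose

lemma fermiTrace_ae {V : R3 → ℝ} (hV : MemLp V 1) (μ : ℝ) (f : L2R3) :
    fermiTrace hV μ f =ᵐ[fermiMeasure μ] fun q => gHat V f q :=
  (exists_fermiTrace hV μ).choose_spec f

lemma conj_fourierConst : (starRingEnd ℂ) fourierConst = fourierConst := Complex.conj_ofReal _

lemma conj_exp_neg_I_mul (t : ℝ) : (starRingEnd ℂ) (Complex.exp (-Complex.I * (t : ℂ)))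
    = Complex.exp (-Complex.I * ((-t : ℝ) : ℂ)) := by
  rw [← Complex.exp_conj]
  simp

/-- The inverse Fourier transform of the measure `u dω`. -/
def sphereTransform (μ : ℝ) (u : L2Fermi μ) (x : R3) : ℂ :=
  fourierConst * ∫ q : FermiSphere μ,
    Complex.exp (-Complex.I * ((-inner ℝ (q : R3) x : ℝ) : ℂ)) * u q ∂(fermiMeasure μ)

lemma integrable_sphere_planeWave {μ : ℝ} (u : L2Fermi μ) (x : R3) :
    Integrable (fun q : FermiSphere μ =>
      Complex.exp (-Complex.I * ((-inner ℝ (q : R3) x : ℝ) : ℂ)) * u q) (fermiMeasure μ) :=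
  (integrable_L2Fermi u).bdd_mul (c := 1) (Continuous.aestronglyMeasurable (by fun_prop))
    (Eventually.of_forall fun q => (norm_planeWave _).le)

/-- `F* u` is `v` times the inverse Fourier transform of the measure `u dω` on the Fermi sphere. -/
lemma adjoint_fermiTrace_ae {V : R3 → ℝ} (hV : MemLp V 1) (μ : ℝ) (u : L2Fermi μ) :
    (ContinuousLinearMap.adjoint (fermiTrace hV μ)) u =ᵐ[volume]
      fun x => (sqrtAbs V x : ℂ) * sphereTransform μ u x := by
  have hcont : Continuous (sphereTransform μ u) := by
    unfold sphereTransform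
    refine continuous_const.mul (continuous_of_dominated (bound := fun q => ‖u q‖)
      (fun x => (integrable_sphere_planeWave u x).aestronglyMeasurable)
      (fun x => Eventually.of_forall fun q => ?_) (integrable_L2Fermi u).norm
      (Eventually.of_forall fun q => by fun_prop))
    rw [norm_mul, norm_planeWave, one_mul]
  have hbound : ∀ x, ‖sphereTransform μ u x‖ ≤ ∫ q, ‖u q‖ ∂(fermiMeasure μ) := by
    intro x
    unfold sphereTransform
    rw [norm_mul]
    refine (mul_le_of_le_one_left (norm_nonneg _) norm_fourierConst_le).trans ?_
    refine (norm_integral_le_integral_norm _).trans (le_of_eq ?_)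
    simp only [norm_mul, norm_planeWave, one_mul]
  have hM : MemLp (fun x => (sqrtAbs V x : ℂ) * sphereTransform μ u x) 2 :=
    MemLp.of_le_mul (c := ∫ q, ‖u q‖ ∂(fermiMeasure μ)) (memLp_sqrtAbs_two hV)
      ((memLp_sqrtAbs_two hV).ofReal.1.mul hcont.aestronglyMeasurable)
      (Eventually.of_forall fun x => by
        rw [norm_mul, Complex.norm_real, mul_comm]
        exact mul_le_mul_of_nonneg_right (hbound x) (norm_nonneg _))
  set w : L2R3 := hM.toLp _ with hw
  have hwae := hM.coeFn_toLp
  suffices h : (ContinuousLinearMap.adjoint (fermiTrace hV μ)) u = w by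
    rw [h]; exact hwae
  refine ext_inner_left ℂ fun f => ?_
  rw [ContinuousLinearMap.adjoint_inner_right, L2.inner_def, L2.inner_def]
  have e1 : ∀ᵐ q ∂(fermiMeasure μ), inner ℂ ((fermiTrace hV μ f) q) (u q) = fourierConst *
      ((∫ x : R3, (starRingEnd ℂ) ((sqrtAbs V x : ℂ) * f x) *
        Complex.exp (-Complex.I * ((-inner ℝ (q : R3) x : ℝ) : ℂ))) * u q) := by
    filter_upwards [fermiTrace_ae hV μ f] with q hq
    rw [hq, RCLike.inner_apply, gHat, map_mul, conj_fourierConst, ← integral_conj]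
    simp only [map_mul, conj_exp_neg_I_mul]
    ring
  have e2 : ∀ᵐ x, inner ℂ (f x) (w x) = fourierConst * ((starRingEnd ℂ) ((sqrtAbs V x : ℂ) * f x) *
      ∫ q : FermiSphere μ,
        Complex.exp (-Complex.I * ((-inner ℝ (q : R3) x : ℝ) : ℂ)) * u q ∂(fermiMeasure μ)) := by
    filter_upwards [hwae] with x hx
    rw [hw, hx, RCLike.inner_apply, sphereTransform, map_mul, Complex.conj_ofReal]
    ring
  rw [integral_congr_ae e1, integral_congr_ae e2, integral_const_mul, integral_const_mul]
  congr 1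
  have hconj : Integrable fun x => (starRingEnd ℂ) ((sqrtAbs V x : ℂ) * f x) :=
    LinearIsometryEquiv.integrable_comp_iff (Complex.conjLIE) |>.2 (integrable_sqrtAbs_mul hV f)
  exact (integral_phase_swap (φ := fun (x : R3) (q : FermiSphere μ) => -inner ℝ (q : R3) x)
    (Continuous.measurable (by fun_prop)) hconj (integrable_L2Fermi u)).symm

/-- `φ̂` is the Fourier transform of `|V|^{1/2}` times the function `sgn(V) F* u`. -/
lemma gHat_signOp_adjoint {V : R3 → ℝ} (hV : MemLp V 1) (μ : ℝ) (u : L2Fermi μ) (p : R3) :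
    gHat V (signOp hV.1 ((ContinuousLinearMap.adjoint (fermiTrace hV μ)) u)) p
      = phiHat V μ u p := by
  unfold gHat phiHat
  congr 1
  have hVC : Integrable (fun x => (V x : ℂ) * Complex.exp (-Complex.I * (inner ℝ p x : ℝ))) :=
    integrable_mul_planeWave (memLp_one_iff_integrable.1 hV).ofReal p
  have e : ∀ᵐ x, (sqrtAbs V x : ℂ) *
      (signOp hV.1 ((ContinuousLinearMap.adjoint (fermiTrace hV μ)) u)) x *
        Complex.exp (-Complex.I * (inner ℝ p x : ℝ))
      = fourierConst * (((V x : ℂ) * Complex.exp (-Complex.I * (inner ℝ p x : ℝ))) *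
        ∫ q : FermiSphere μ,
          Complex.exp (-Complex.I * ((-inner ℝ (q : R3) x : ℝ) : ℂ)) * u q ∂(fermiMeasure μ)) := by
    filter_upwards [signOp_ae hV.1 ((ContinuousLinearMap.adjoint (fermiTrace hV μ)) u),
      adjoint_fermiTrace_ae hV μ u] with x h1 h2
    rw [h1, h2, sphereTransform, ← sqrtAbs_mul_signV_mul V x]
    push_cast
    ring
  rw [integral_congr_ae e, integral_const_mul,
    integral_phase_swap (φ := fun (x : R3) (q : FermiSphere μ) => -inner ℝ (q : R3) x)
    (Continuous.measurable (by fun_prop)) hVC (integrable_L2Fermi u), ← integral_const_mul]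
  refine integral_congr_ae (Eventually.of_forall fun q => ?_)
  simp only [Vhat]
  rw [← mul_assoc]
  congr 3
  funext x
  rw [mul_assoc, ← Complex.exp_add, inner_sub_left]
  congr 2
  push_cast
  ring

/-- Since `v s v = V`, the leading term `F s F*` is convolution with `V^` on the Fermi sphere, that
is `√μ 𝒱_μ`. -/
lemma fermiTrace_signOp_adjoint {V : R3 → ℝ} (hV : MemLp V 1) {μ : ℝ} (hμ : 0 < μ) :
    fermiTrace hV μ ∘L signOp hV.1 ∘L ContinuousLinearMap.adjoint (fermiTrace hV μ)
      = (√μ : ℝ) • opV V μ := by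
  ext1 u
  refine Lp.ext ?_
  have hμ' : √μ ≠ 0 := (Real.sqrt_pos.2 hμ).ne'
  have e : ((√μ : ℝ) • opV V μ) u = (√μ : ℝ) • (opV V μ u) := rfl
  rw [e]
  filter_upwards [fermiTrace_ae hV μ (signOp hV.1 ((ContinuousLinearMap.adjoint (fermiTrace hV μ)) u)),
    Lp.coeFn_smul (√μ : ℝ) (opV V μ u), opV_apply_ae V μ u] with q h1 h2 h3
  rw [ContinuousLinearMap.comp_apply, ContinuousLinearMap.comp_apply, h1, h2, Pi.smul_apply, h3,
    gHat_signOp_adjoint, phiHat, Complex.real_smul]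
  have : ((√μ : ℝ) : ℂ) ≠ 0 := by exact_mod_cast hμ'
  push_cast
  field_simp

end BCS

namespace BCS

/-! ### The operators `K^{-1/2}` and `|V|^{1/2} K^{-1/2}` -/

lemma norm_sq_eq_integral {α : Type*} [MeasurableSpace α] {ν : Measure α} (f : Lp ℂ 2 ν) :
    ‖f‖ ^ 2 = ∫ x, ‖f x‖ ^ 2 ∂ν := by
  have h : Integrable (fun x => ‖f x‖ ^ 2) ν := (Lp.memLp f).integrable_norm_pow two_ne_zero
  have h1 := lintegral_enorm_sq f
  have h2 : ∫⁻ x, ‖f x‖ₑ ^ 2 ∂ν = ENNReal.ofReal (∫ x, ‖f x‖ ^ 2 ∂ν) := by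
    rw [ofReal_integral_eq_lintegral_ofReal h (Eventually.of_forall fun _ => by positivity)]
    refine lintegral_congr fun x => ?_
    rw [← ofReal_norm, ENNReal.ofReal_pow (norm_nonneg _)]
  rw [h2] at h1
  exact ((ENNReal.ofReal_eq_ofReal_iff (integral_nonneg fun _ => by positivity)
    (by positivity)).1 h1).symm

/-- The symbol of `K_{T,μ}^{-1/2}` at the frequency `ξ`, i.e. at the momentum `2πξ`. -/
def kRoot (T μ : ℝ) (ξ : R3) : ℝ := √(kInv T μ (2 * π * ‖ξ‖))

lemma continuous_kRoot (T μ : ℝ) : Continuous (kRoot T μ) :=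
  (continuous_kInv.comp (by fun_prop)).sqrt

lemma kRoot_pos {T : ℝ} (hT : 0 < T) (μ : ℝ) (ξ : R3) : 0 < kRoot T μ ξ :=
  Real.sqrt_pos.2 (kInv_pos hT _)

lemma kRoot_sq {T : ℝ} (hT : 0 < T) (μ : ℝ) (ξ : R3) :
    kRoot T μ ξ ^ 2 = kInv T μ (2 * π * ‖ξ‖) := Real.sq_sqrt (kInv_pos hT _).le

lemma kRoot_le {T : ℝ} (hT : 0 < T) (μ : ℝ) (ξ : R3) : kRoot T μ ξ ≤ √(1 / (2 * T)) :=
  Real.sqrt_le_sqrt (kInv_le hT _)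

lemma norm_mul_kRoot_le {T μ : ℝ} (hT : 0 < T) (hμ : 0 < μ) (ξ : R3) :
    ‖ξ‖ * kRoot T μ ξ ≤ √(1 + μ / (2 * T)) := by
  refine Real.le_sqrt_of_sq_le ?_
  rw [mul_pow, kRoot_sq hT]
  refine le_trans ?_ (sq_mul_kInv_le hT hμ (2 * π * ‖ξ‖))
  refine mul_le_mul_of_nonneg_right ?_ (kInv_pos hT _).le
  rw [mul_pow]
  refine le_mul_of_one_le_left (by positivity) ?_
  nlinarith [Real.pi_gt_three]

lemma one_le_mul_kRoot {T μ : ℝ} (hT : 0 < T) (hμ : 0 < μ) (ξ : R3) :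
    1 ≤ √((2 * π) ^ 2 + μ + 2 * T) * (1 + ‖ξ‖) * kRoot T μ ξ := by
  have h1 := inv_le_kInv (μ := μ) hT (2 * π * ‖ξ‖)
  have hn := norm_nonneg ξ
  have h2 : |(2 * π * ‖ξ‖) ^ 2 - μ| + 2 * T ≤ ((2 * π) ^ 2 + μ + 2 * T) * (1 + ‖ξ‖) ^ 2 := by
    have h3 : |(2 * π * ‖ξ‖) ^ 2 - μ| ≤ (2 * π * ‖ξ‖) ^ 2 + μ := by
      rw [abs_le]; constructor <;> nlinarith [sq_nonneg (2 * π * ‖ξ‖)]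
    have h4 : ‖ξ‖ ^ 2 ≤ (1 + ‖ξ‖) ^ 2 := by nlinarith
    have h5 : 1 ≤ (1 + ‖ξ‖) ^ 2 := by nlinarith
    have h6 := mul_le_mul_of_nonneg_left h4 (sq_nonneg (2 * π))
    have h7 := mul_le_mul_of_nonneg_left h5 (show 0 ≤ μ + 2 * T by positivity)
    rw [mul_pow] at h3
    rw [mul_pow]
    nlinarith
  have hpos : 0 < |(2 * π * ‖ξ‖) ^ 2 - μ| + 2 * T := by positivity
  have h3 : 1 ≤ ((2 * π) ^ 2 + μ + 2 * T) * (1 + ‖ξ‖) ^ 2 * kInv T μ (2 * π * ‖ξ‖) := by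
    rw [div_le_iff₀ hpos] at h1
    nlinarith [mul_le_mul_of_nonneg_left h2 (kInv_pos (μ := μ) hT (2 * π * ‖ξ‖)).le]
  have h4 : (√((2 * π) ^ 2 + μ + 2 * T) * (1 + ‖ξ‖) * kRoot T μ ξ) ^ 2
      = ((2 * π) ^ 2 + μ + 2 * T) * (1 + ‖ξ‖) ^ 2 * kInv T μ (2 * π * ‖ξ‖) := by
    rw [mul_pow, mul_pow, kRoot_sq hT, Real.sq_sqrt (by positivity)]
  have h5 : 0 ≤ √((2 * π) ^ 2 + μ + 2 * T) * (1 + ‖ξ‖) * kRoot T μ ξ :=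
    mul_nonneg (by positivity) (kRoot_pos hT μ ξ).le
  nlinarith

lemma exists_rootOp {T : ℝ} (hT : 0 < T) (μ : ℝ) :
    ∃ A : L2R3 →L[ℂ] L2R3, (∀ u, A u =ᵐ[volume] fun ξ => (kRoot T μ ξ : ℂ) * u ξ) ∧
      ‖A‖ ≤ √(1 / (2 * T)) :=
  exists_mul_clm (fun ξ => (kRoot T μ ξ : ℂ))
    (Complex.continuous_ofReal.comp (continuous_kRoot T μ)).aestronglyMeasurable
    (Real.sqrt_nonneg _) fun ξ => by
      rw [Complex.norm_real, Real.norm_eq_abs, abs_of_pos (kRoot_pos hT μ ξ)]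
      exact kRoot_le hT μ ξ

/-- Multiplication by the symbol of `K_{T,μ}^{-1/2}` in frequency space. -/
def rootOp {T : ℝ} (hT : 0 < T) (μ : ℝ) : L2R3 →L[ℂ] L2R3 := (exists_rootOp hT μ).choose

lemma rootOp_ae {T : ℝ} (hT : 0 < T) (μ : ℝ) (f : L2R3) :
    rootOp hT μ f =ᵐ[volume] fun ξ => (kRoot T μ ξ : ℂ) * f ξ := (exists_rootOp hT μ).choose_spec.1 f

/-- The map `f ↦ 𝓕⁻¹ (K_{T,μ}^{-1/2} f)` from frequency space to position space. -/
def dressOp {T : ℝ} (hT : 0 < T) (μ : ℝ) : L2R3 →L[ℂ] L2R3 :=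
  ((Lp.fourierTransformₗᵢ R3 ℂ).symm.toContinuousLinearEquiv : L2R3 →L[ℂ] L2R3) ∘L rootOp hT μ

lemma dressOp_eq {T : ℝ} (hT : 0 < T) (μ : ℝ) (f : L2R3) :
    dressOp hT μ f = 𝓕⁻ (rootOp hT μ f) := rfl

lemma fourier_dressOp {T : ℝ} (hT : 0 < T) (μ : ℝ) (f : L2R3) :
    𝓕 (dressOp hT μ f) = rootOp hT μ f := by
  rw [dressOp_eq, FourierTransform.fourier_fourierInv_eq]

lemma norm_dressOp_sq_le {T : ℝ} (hT : 0 < T) (μ : ℝ) (f : L2R3) :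
    ‖dressOp hT μ f‖ ^ 2 ≤ 1 / (2 * T) * ‖f‖ ^ 2 := by
  have h1 : ‖dressOp hT μ f‖ = ‖rootOp hT μ f‖ := (Lp.fourierTransformₗᵢ R3 ℂ).symm.norm_map _
  have h2 := (rootOp hT μ).le_of_opNorm_le (exists_rootOp hT μ).choose_spec.2 f
  rw [h1]
  calc ‖rootOp hT μ f‖ ^ 2 ≤ (√(1 / (2 * T)) * ‖f‖) ^ 2 := by gcongr
    _ = 1 / (2 * T) * ‖f‖ ^ 2 := by rw [mul_pow, Real.sq_sqrt (by positivity)]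

lemma memLp_norm_mul_dressOp {T μ : ℝ} (hT : 0 < T) (hμ : 0 < μ) (f : L2R3) :
    MemLp (fun ξ : R3 => (‖ξ‖ : ℂ) * (𝓕 (dressOp hT μ f) : L2R3) ξ) 2 ∧
      ∫ ξ, ‖(‖ξ‖ : ℂ) * (𝓕 (dressOp hT μ f) : L2R3) ξ‖ ^ 2
        ≤ (√(1 + μ / (2 * T)) * ‖f‖) ^ 2 := by
  rw [fourier_dressOp]
  have hb : ∀ᵐ ξ : R3, ‖(‖ξ‖ : ℂ) * (rootOp hT μ f) ξ‖ ≤ √(1 + μ / (2 * T)) * ‖f ξ‖ := by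
    filter_upwards [rootOp_ae hT μ f] with ξ h
    rw [h, norm_mul, norm_mul, Complex.norm_real, Complex.norm_real, norm_norm, Real.norm_eq_abs,
      abs_of_pos (kRoot_pos hT μ ξ), ← mul_assoc]
    exact mul_le_mul_of_nonneg_right (norm_mul_kRoot_le hT hμ ξ) (norm_nonneg _)
  have hM : MemLp (fun ξ : R3 => (‖ξ‖ : ℂ) * (rootOp hT μ f) ξ) 2 :=
    MemLp.of_le_mul (Lp.memLp f) (Continuous.aestronglyMeasurable (by fun_prop) |>.mul
      (Lp.aestronglyMeasurable _)) hb
  refine ⟨hM, ?_⟩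
  rw [mul_pow, norm_sq_eq_integral, ← integral_const_mul]
  refine integral_mono_ae (hM.integrable_norm_pow two_ne_zero)
    (((Lp.memLp f).integrable_norm_pow two_ne_zero).const_mul _) ?_
  filter_upwards [hb] with ξ h
  rw [← mul_pow]
  gcongr

/-- `K_{T,μ}^{-1/2}` maps `L²` onto the form domain. -/
lemma range_dressOp {T μ : ℝ} (hT : 0 < T) (hμ : 0 < μ) : H1 = range (dressOp hT μ) := by
  apply Subset.antisymm
  · intro ψ (hψ : MemLp (fun ξ : R3 => (‖ξ‖ : ℂ) * (𝓕 ψ : L2R3) ξ) 2)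
    set g : L2R3 := 𝓕 ψ with hg
    set M := √((2 * π) ^ 2 + μ + 2 * T) with hM
    have hmem : MemLp (fun ξ => ((kRoot T μ ξ)⁻¹ : ℂ) * g ξ) 2 := by
      refine MemLp.of_le_mul (c := M) ((Lp.memLp g).norm.add hψ.norm) ?_
        (Eventually.of_forall fun ξ => ?_)
      · refine AEStronglyMeasurable.mul (Continuous.aestronglyMeasurable ?_)
          (Lp.aestronglyMeasurable g)
        exact (Complex.continuous_ofReal.comp (continuous_kRoot T μ)).inv₀ fun ξ =>
          Complex.ofReal_ne_zero.2 (kRoot_pos hT μ ξ).ne'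
      · have h1 := one_le_mul_kRoot hT hμ ξ
        have h0 := kRoot_pos hT μ ξ
        have h2 : (kRoot T μ ξ)⁻¹ ≤ M * (1 + ‖ξ‖) := by
          rw [inv_le_iff_one_le_mul₀ h0]; exact h1
        rw [norm_mul, norm_inv, Complex.norm_real, Real.norm_eq_abs, abs_of_pos h0, Pi.add_apply,
          Real.norm_eq_abs, norm_mul, Complex.norm_real, norm_norm, abs_of_nonneg (by positivity)]
        calc (kRoot T μ ξ)⁻¹ * ‖g ξ‖ ≤ (M * (1 + ‖ξ‖)) * ‖g ξ‖ := by gcongr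
          _ = M * (‖g ξ‖ + ‖ξ‖ * ‖g ξ‖) := by ring
    refine ⟨hmem.toLp _, ?_⟩
    rw [dressOp_eq]
    have : rootOp hT μ (hmem.toLp _) = g := by
      refine Lp.ext ?_
      filter_upwards [rootOp_ae hT μ (hmem.toLp _), hmem.coeFn_toLp] with ξ h1 h2
      rw [h1, h2, mul_inv_cancel_left₀ (Complex.ofReal_ne_zero.2 (kRoot_pos hT μ ξ).ne')]
    rw [this, hg, FourierTransform.fourierInv_fourier_eq]
  · rintro _ ⟨f, rfl⟩
    exact (memLp_norm_mul_dressOp hT hμ f).1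

/-- A constant in Sobolev's inequality. -/
def sobolevConst : ℝ := exists_sobolev.choose

lemma sobolevConst_pos : 0 < sobolevConst := exists_sobolev.choose_spec.1

instance holderTriple_three_six_two : ENNReal.HolderTriple 3 6 2 where
  inv_add_inv_eq_inv := by
    rw [← ENNReal.toReal_eq_toReal_iff' (by simp) (by simp), ENNReal.toReal_add (by simp) (by simp)]
    norm_num

lemma eLpNorm_mul_dressOp_le {T μ : ℝ} (hT : 0 < T) (hμ : 0 < μ) {w : R3 → ℝ}
    (hw : AEStronglyMeasurable w) (f : L2R3) :
    eLpNorm (fun x => (w x : ℂ) * (dressOp hT μ f) x) 2 volume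
      ≤ eLpNorm w 3 volume * ENNReal.ofReal (sobolevConst * (√(1 + μ / (2 * T)) * ‖f‖)) := by
  obtain ⟨h1, h2⟩ := memLp_norm_mul_dressOp hT hμ f
  have h3 := exists_sobolev.choose_spec.2 (dressOp hT μ f) _ (by positivity) h1 h2
  have hwC : AEStronglyMeasurable (fun x => (w x : ℂ)) volume :=
    Complex.continuous_ofReal.comp_aestronglyMeasurable hw
  have h := eLpNorm_smul_le_mul_eLpNorm (p := 3) (q := 6) (r := 2)
    (Lp.aestronglyMeasurable (dressOp hT μ f)) hwC
  have e : eLpNorm (fun x => (w x : ℂ)) 3 volume = eLpNorm w 3 volume :=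
    eLpNorm_congr_norm_ae (Eventually.of_forall fun x => by simp)
  rw [e] at h
  exact h.trans (mul_le_mul_right h3 _)

lemma exists_bsOp {V : R3 → ℝ} (hV : MemLp V (3 / 2)) {T μ : ℝ} (hT : 0 < T) (hμ : 0 < μ) :
    ∃ X : L2R3 →L[ℂ] L2R3,
      ∀ f, X f =ᵐ[volume] fun x => (sqrtAbs V x : ℂ) * (dressOp hT μ f) x := by
  have hv := memLp_sqrtAbs_three hV
  obtain ⟨X, hX, -⟩ := exists_clm_of_ae (ν := (volume : Measure R3))
    (fun (f : L2R3) x => (sqrtAbs V x : ℂ) * (dressOp hT μ f) x)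
    (fun f => (Complex.continuous_ofReal.comp_aestronglyMeasurable hv.1).mul
      (Lp.aestronglyMeasurable _))
    (fun f g => by
      rw [map_add]
      filter_upwards [Lp.coeFn_add (dressOp hT μ f) (dressOp hT μ g)] with x hx
      rw [hx, Pi.add_apply, mul_add])
    (fun c f => by
      rw [map_smul]
      filter_upwards [Lp.coeFn_smul c (dressOp hT μ f)] with x hx
      rw [hx, Pi.smul_apply, smul_eq_mul, mul_left_comm])
    (C := (eLpNorm (sqrtAbs V) 3 volume).toReal * (sobolevConst * √(1 + μ / (2 * T))))
    (mul_nonneg ENNReal.toReal_nonneg (mul_nonneg sobolevConst_pos.le (Real.sqrt_nonneg _)))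
    (fun f => by
      refine (eLpNorm_mul_dressOp_le hT hμ hv.1 f).trans (le_of_eq ?_)
      rw [mul_assoc, ENNReal.ofReal_mul ENNReal.toReal_nonneg, ENNReal.ofReal_toReal hv.2.ne,
        mul_assoc])
  exact ⟨X, hX⟩

/-- The operator `|V|^{1/2} K_{T,μ}^{-1/2}` (from frequency space to position space), whose form
version of the Birman–Schwinger operator is `X* sgn(V) X`. -/
def bsOp {V : R3 → ℝ} (hV : MemLp V (3 / 2)) {T μ : ℝ} (hT : 0 < T) (hμ : 0 < μ) :
    L2R3 →L[ℂ] L2R3 := (exists_bsOp hV hT hμ).choose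

lemma bsOp_ae {V : R3 → ℝ} (hV : MemLp V (3 / 2)) {T μ : ℝ} (hT : 0 < T) (hμ : 0 < μ) (f : L2R3) :
    bsOp hV hT hμ f =ᵐ[volume] fun x => (sqrtAbs V x : ℂ) * (dressOp hT μ f) x :=
  (exists_bsOp hV hT hμ).choose_spec f

/-- `V` is form bounded with respect to `K_{T,μ}` with arbitrarily small bound; the constants are
explicit in `T`. -/
lemma exists_norm_bsOp_sq_le {V : R3 → ℝ} (hV : MemLp V (3 / 2)) {μ : ℝ} (hμ : 0 < μ) {η : ℝ}
    (hη : 0 < η) : ∃ M : ℝ, 0 ≤ M ∧ ∀ {T : ℝ} (hT : 0 < T) (f : L2R3),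
      ‖bsOp hV hT hμ f‖ ^ 2 ≤ η * (1 + μ / (2 * T)) * ‖f‖ ^ 2 + M * ‖dressOp hT μ f‖ ^ 2 := by
  have hC := sobolevConst_pos
  set ε : ℝ := √(η / 2) / sobolevConst with hε
  have hε0 : 0 < ε := div_pos (Real.sqrt_pos.2 (by positivity)) hC
  have hv := memLp_sqrtAbs_three hV
  -- a bounded function close to `|V|^{1/2}` in `L³`
  obtain ⟨g, hg, hgM⟩ := hv.exists_boundedContinuous_eLpNorm_sub_le (by norm_num)
    (ε := ENNReal.ofReal ε) (by simpa using hε0)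
  refine ⟨2 * ‖g‖ ^ 2, by positivity, fun {T} hT f => ?_⟩
  have hsub : eLpNorm (fun x => ((sqrtAbs V x - g x : ℝ) : ℂ) * (dressOp hT μ f) x) 2 volume
      ≤ ENNReal.ofReal (ε * (sobolevConst * (√(1 + μ / (2 * T)) * ‖f‖))) := by
    refine (eLpNorm_mul_dressOp_le hT hμ (hv.sub hgM).1 f).trans ?_
    rw [ENNReal.ofReal_mul hε0.le]
    exact mul_le_mul_left hg _
  have hbd : eLpNorm (fun x => (g x : ℂ) * (dressOp hT μ f) x) 2 volume
      ≤ ENNReal.ofReal (‖g‖ * ‖dressOp hT μ f‖) := by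
    refine (eLpNorm_le_mul_eLpNorm_of_ae_le_mul (g := dressOp hT μ f) (c := ‖g‖)
      (Eventually.of_forall fun x => ?_) 2).trans ?_
    · rw [norm_mul, Complex.norm_real]
      exact mul_le_mul_of_nonneg_right (g.norm_coe_le_norm x) (norm_nonneg _)
    · rw [ENNReal.ofReal_mul (norm_nonneg _), Lp.norm_def (dressOp hT μ f),
        ENNReal.ofReal_toReal (Lp.eLpNorm_ne_top _)]
  have htot : ‖bsOp hV hT hμ f‖
      ≤ ε * (sobolevConst * (√(1 + μ / (2 * T)) * ‖f‖)) + ‖g‖ * ‖dressOp hT μ f‖ := by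
    rw [Lp.norm_def]
    refine ENNReal.toReal_le_of_le_ofReal (by positivity) ?_
    rw [ENNReal.ofReal_add (by positivity) (by positivity)]
    refine le_trans (le_of_eq ?_) ((eLpNorm_add_le ?_ ?_ (by norm_num)).trans
      (add_le_add hsub hbd))
    · refine eLpNorm_congr_ae ?_
      filter_upwards [bsOp_ae hV hT hμ f] with x hx
      rw [hx, Pi.add_apply]
      push_cast
      ring
    · exact (Complex.continuous_ofReal.comp_aestronglyMeasurable (hv.sub hgM).1).mul
        (Lp.aestronglyMeasurable _)
    · exact (Complex.continuous_ofReal.comp_aestronglyMeasurable hgM.1).mul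
        (Lp.aestronglyMeasurable _)
  have e1 : (ε * (sobolevConst * (√(1 + μ / (2 * T)) * ‖f‖))) ^ 2
      = η / 2 * (1 + μ / (2 * T)) * ‖f‖ ^ 2 := by
    have : ε * sobolevConst = √(η / 2) := by rw [hε]; field_simp
    rw [← mul_assoc, this, mul_pow, mul_pow, Real.sq_sqrt (by positivity),
      Real.sq_sqrt (by positivity)]
    ring
  have hb : 0 ≤ ‖g‖ * ‖dressOp hT μ f‖ := by positivity
  calc ‖bsOp hV hT hμ f‖ ^ 2
      ≤ (ε * (sobolevConst * (√(1 + μ / (2 * T)) * ‖f‖)) + ‖g‖ * ‖dressOp hT μ f‖) ^ 2 := by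
        gcongr
    _ ≤ 2 * (ε * (sobolevConst * (√(1 + μ / (2 * T)) * ‖f‖))) ^ 2
        + 2 * (‖g‖ * ‖dressOp hT μ f‖) ^ 2 := by
        nlinarith [sq_nonneg (ε * (sobolevConst * (√(1 + μ / (2 * T)) * ‖f‖))
          - ‖g‖ * ‖dressOp hT μ f‖)]
    _ = _ := by rw [e1, mul_pow]; ring

lemma ae_norm_ne (a : ℝ) : ∀ᵐ ξ : R3, ‖ξ‖ ≠ a := by
  have h := Measure.addHaar_sphere (volume : Measure R3) 0 a
  filter_upwards [compl_mem_ae_iff.2 h] with ξ hξ h1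
  exact hξ (by simpa using h1)

open ContinuousLinearMap in
/-- The form of `K_{T,μ} + λV`, expressed through `f = K^{1/2} ψ`. -/
lemma formKV_dressOp {V : R3 → ℝ} (hV : MemLp V (3 / 2)) {T μ : ℝ} (hT : 0 < T) (hμ : 0 < μ)
    (lam : ℝ) (f g : L2R3) :
    formKV V μ lam T (dressOp hT μ f) (dressOp hT μ g) = inner ℂ f
      ((1 + lam • (adjoint (bsOp hV hT hμ) ∘L signOp hV.1 ∘L bsOp hV hT hμ)) g) := by
  have h1 : (1 + lam • (adjoint (bsOp hV hT hμ) ∘L signOp hV.1 ∘L bsOp hV hT hμ)) g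
      = g + lam • (adjoint (bsOp hV hT hμ) (signOp hV.1 (bsOp hV hT hμ g))) := rfl
  rw [h1, inner_add_right, inner_smul_right_eq_smul, adjoint_inner_right, Complex.real_smul, formKV,
    L2.inner_def, L2.inner_def]
  congr 1
  · refine integral_congr_ae ?_
    rw [fourier_dressOp, fourier_dressOp]
    filter_upwards [rootOp_ae hT μ f, rootOp_ae hT μ g, ae_norm_ne (√μ / (2 * π))]
      with ξ hf hg hξ
    have hn : ‖(2 * π) • ξ‖ = 2 * π * ‖ξ‖ := by
      rw [norm_smul, Real.norm_eq_abs, abs_of_pos (by positivity)]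
    have hne : ‖(2 * π) • ξ‖ ^ 2 ≠ μ := by
      intro h
      apply hξ
      rw [← h, Real.sqrt_sq (norm_nonneg _), hn]
      field_simp
    have h2 := kSymbol_mul_kInv hT hne
    rw [hn, ← kRoot_sq hT] at h2
    have h3 : (kSymbol T μ ((2 * π) • ξ) : ℂ) * (kRoot T μ ξ : ℂ) ^ 2 = 1 := by exact_mod_cast h2
    rw [hf, hg, RCLike.inner_apply, map_mul, Complex.conj_ofReal]
    linear_combination ((starRingEnd ℂ) (f ξ) * g ξ) * h3
  · congr 1
    refine integral_congr_ae ?_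
    filter_upwards [bsOp_ae hV hT hμ f, bsOp_ae hV hT hμ g, signOp_ae hV.1 (bsOp hV hT hμ g)]
      with x hf hg hs
    rw [hs, hf, hg, RCLike.inner_apply, map_mul, Complex.conj_ofReal]
    conv_lhs => rw [← sqrtAbs_mul_signV_mul V x]
    push_cast
    ring

open ContinuousLinearMap in
lemma abs_re_inner_bsOp_le {V : R3 → ℝ} (hV : MemLp V (3 / 2)) {T μ : ℝ} (hT : 0 < T)
    (hμ : 0 < μ) (f : L2R3) :
    |(inner ℂ f ((adjoint (bsOp hV hT hμ) ∘L signOp hV.1 ∘L bsOp hV hT hμ) f)).re|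
      ≤ ‖bsOp hV hT hμ f‖ ^ 2 := by
  rw [comp_apply, adjoint_inner_right, comp_apply]
  refine (abs_re_inner_le _ _).trans ?_
  exact mul_le_of_le_one_left (by positivity) (norm_signOp_le hV.1)

lemma isSelfAdjoint_one_add_smul {H : Type*} [NormedAddCommGroup H] [InnerProductSpace ℂ H]
    [CompleteSpace H] {B : H →L[ℂ] H} (hB : IsSelfAdjoint B) (a : ℝ) :
    IsSelfAdjoint (1 + a • B) :=
  (IsSelfAdjoint.one _).add ((IsSelfAdjoint.all a).smul hB)

open ContinuousLinearMap in
/-- The Birman–Schwinger form of the condition `inf spec (K_{T,μ} + λV) ≥ 0`. -/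
lemma zero_le_infSpecKV_iff {V : R3 → ℝ} (hV : MemLp V (3 / 2)) {T μ lam : ℝ} (hT : 0 < T)
    (hμ : 0 < μ) (hlam : 0 < lam) :
    0 ≤ infSpecKV V μ lam T ↔ ∀ f, 0 ≤ ‖f‖ ^ 2 + lam *
      (inner ℂ f ((adjoint (bsOp hV hT hμ) ∘L signOp hV.1 ∘L bsOp hV hT hμ) f)).re := by
  set B := adjoint (bsOp hV hT hμ) ∘L signOp hV.1 ∘L bsOp hV hT hμ with hB
  have hBs : IsSelfAdjoint B := by
    have := (isSelfAdjoint_signOp hV.1).conj_adjoint (adjoint (bsOp hV hT hμ))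
    rwa [adjoint_adjoint] at this
  have hre : ∀ f, (inner ℂ f ((1 + lam • B) f)).re = ‖f‖ ^ 2 + lam * (inner ℂ f (B f)).re :=
    fun f => re_inner_one_add_smul B lam f
  have hK : 0 < 1 + μ / (2 * T) := by positivity
  obtain ⟨M, hM, hbd⟩ := exists_norm_bsOp_sq_le hV hμ
    (η := 1 / (2 * lam * (1 + μ / (2 * T)))) (by positivity)
  rw [infSpecKV, zero_le_formInfSpec_iff (range_dressOp hT hμ)
    (formKV_dressOp hV hT hμ lam) ?_ (C := lam * M + 1) (δ := 1 / 2) (by positivity) (by norm_num)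
    ?_]
  · simp only [hre, ← hB]
  · exact isSelfAdjoint_one_add_smul hBs lam
  · intro f
    rw [← hB, hre]
    have h1 := (abs_le.1 (abs_re_inner_bsOp_le hV hT hμ f)).1
    rw [← hB] at h1
    have h2 := mul_le_mul_of_nonneg_left (h1.trans' (neg_le_neg (hbd hT f))) hlam.le
    have e : lam * (1 / (2 * lam * (1 + μ / (2 * T))) * (1 + μ / (2 * T)) * ‖f‖ ^ 2)
        = 1 / 2 * ‖f‖ ^ 2 := by field_simp
    nlinarith [sq_nonneg ‖dressOp hT μ f‖]

/-- At high temperature the form is nonnegative. -/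
lemma exists_zero_le_infSpecKV {V : R3 → ℝ} (hV : MemLp V (3 / 2)) {μ lam : ℝ} (hμ : 0 < μ)
    (hlam : 0 < lam) : ∃ T, 0 < T ∧ 0 ≤ infSpecKV V μ lam T := by
  obtain ⟨M, hM, hbd⟩ := exists_norm_bsOp_sq_le hV hμ (η := 1 / (4 * lam)) (by positivity)
  set T : ℝ := μ + lam * M with hTdef
  have hT : 0 < T := by positivity
  refine ⟨T, hT, (zero_le_infSpecKV_iff hV hT hμ hlam).2 fun f => ?_⟩
  have h1 := (abs_le.1 (abs_re_inner_bsOp_le hV hT hμ f)).1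
  have h2 := hbd hT f
  have h3 := mul_le_mul_of_nonneg_left (norm_dressOp_sq_le hT μ f) hM
  have h4 := mul_le_mul_of_nonneg_left (h1.trans' (neg_le_neg (h2.trans
    (add_le_add_right h3 _)))) hlam.le
  have h5 : μ / (2 * T) ≤ 1 / 2 := by
    rw [div_le_div_iff₀ (by positivity) (by norm_num)]
    nlinarith [mul_nonneg hlam.le hM]
  have h6 : lam * M * (1 / (2 * T)) ≤ 1 / 2 := by
    rw [mul_one_div, div_le_div_iff₀ (by positivity) (by norm_num)]
    nlinarith
  have e : lam * -(1 / (4 * lam) * (1 + μ / (2 * T)) * ‖f‖ ^ 2 + M * (1 / (2 * T) * ‖f‖ ^ 2))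
      = -(1 / 4 * (1 + μ / (2 * T)) + lam * M * (1 / (2 * T))) * ‖f‖ ^ 2 := by
    field_simp
  rw [e] at h4
  have : 0 ≤ (1 - (1 / 4 * (1 + μ / (2 * T)) + lam * M * (1 / (2 * T)))) * ‖f‖ ^ 2 :=
    mul_nonneg (by linarith) (by positivity)
  linarith

end BCS

namespace BCS

/-! ### Spherical averages of `|(|V|^{1/2} f)^|²` -/

/-- `ρ_f(r) = ∫_{S²} |(|V|^{1/2} f)^(rθ)|² dΩ(θ)`. -/
def sphereDensity (V : R3 → ℝ) (f : L2R3) (r : ℝ) : ℝ :=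
  ∫ θ : S2, ‖gHat V f (r • (θ : R3))‖ ^ 2 ∂dOmega

lemma gHat_mul_conj {V : R3 → ℝ} (f : L2R3) (p : R3) :
    ((‖gHat V f p‖ ^ 2 : ℝ) : ℂ) = fourierConst ^ 2 * ∫ z : R3 × R3,
      (((sqrtAbs V z.1 : ℂ) * f z.1) * (starRingEnd ℂ) ((sqrtAbs V z.2 : ℂ) * f z.2)) *
        Complex.exp (-Complex.I * (inner ℝ p (z.1 - z.2) : ℝ)) := by
  have h := integral_prod_mul (μ := (volume : Measure R3)) (ν := (volume : Measure R3))
    (fun x => ((sqrtAbs V x : ℂ) * f x) * Complex.exp (-Complex.I * (inner ℝ p x : ℝ)))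
    (fun x => (starRingEnd ℂ)
      (((sqrtAbs V x : ℂ) * f x) * Complex.exp (-Complex.I * (inner ℝ p x : ℝ))))
  rw [integral_conj] at h
  push_cast
  rw [← Complex.mul_conj', gHat, map_mul, conj_fourierConst]
  rw [show ∀ a b c : ℂ, a * b * (a * c) = a ^ 2 * (b * c) from fun a b c => by ring, ← h]
  congr 1
  refine integral_congr_ae (Eventually.of_forall fun z => ?_)
  simp only [map_mul, conj_exp_neg_I_mul]
  rw [mul_mul_mul_comm, ← Complex.exp_add, inner_sub_right]
  congr 2
  push_cast
  ring

lemma integrable_sqrtAbs_prod {V : R3 → ℝ} (hV : MemLp V 1) (f : L2R3) :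
    Integrable (fun z : R3 × R3 =>
      ((sqrtAbs V z.1 : ℂ) * f z.1) * (starRingEnd ℂ) ((sqrtAbs V z.2 : ℂ) * f z.2)) :=
  (integrable_sqrtAbs_mul hV f).mul_prod
    (LinearIsometryEquiv.integrable_comp_iff (Complex.conjLIE) |>.2 (integrable_sqrtAbs_mul hV f))

lemma integral_norm_sqrtAbs_prod_le {V : R3 → ℝ} (hV : MemLp V 1) (f : L2R3) :
    ∫ z : R3 × R3, ‖((sqrtAbs V z.1 : ℂ) * f z.1) *
      (starRingEnd ℂ) ((sqrtAbs V z.2 : ℂ) * f z.2)‖ ≤ vNorm V ^ 2 * ‖f‖ ^ 2 := by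
  have h := integral_prod_mul (μ := (volume : Measure R3)) (ν := (volume : Measure R3))
    (fun x => ‖(sqrtAbs V x : ℂ) * f x‖) (fun x => ‖(sqrtAbs V x : ℂ) * f x‖)
  have e : ∀ z : R3 × R3, ‖((sqrtAbs V z.1 : ℂ) * f z.1) *
      (starRingEnd ℂ) ((sqrtAbs V z.2 : ℂ) * f z.2)‖
      = ‖(sqrtAbs V z.1 : ℂ) * f z.1‖ * ‖(sqrtAbs V z.2 : ℂ) * f z.2‖ := fun z => by
    rw [norm_mul, RCLike.norm_conj]
  simp only [e]
  refine (le_of_eq h).trans ?_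
  rw [← mul_pow, sq]
  have h0 : 0 ≤ ∫ x, ‖(sqrtAbs V x : ℂ) * f x‖ := integral_nonneg fun _ => norm_nonneg _
  exact mul_self_le_mul_self h0 (integral_norm_sqrtAbs_mul_le hV f)

/-- Expanding the square and integrating over the sphere first expresses the spherical averages
through the explicit kernel `sphereWave`. -/
lemma sphereDensity_eq {V : R3 → ℝ} (hV : MemLp V 1) (f : L2R3) (r : ℝ) :
    (sphereDensity V f r : ℂ) = fourierConst ^ 2 * ∫ z : R3 × R3,
      (((sqrtAbs V z.1 : ℂ) * f z.1) * (starRingEnd ℂ) ((sqrtAbs V z.2 : ℂ) * f z.2)) *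
        sphereWave (r • (z.1 - z.2)) := by
  rw [sphereDensity, ← integral_complex_ofReal]
  simp only [gHat_mul_conj]
  rw [integral_const_mul]
  congr 1
  have h := integral_phase_swap (φ := fun (z : R3 × R3) (θ : S2) =>
      (inner ℝ (r • (z.1 - z.2)) (θ : R3) : ℝ)) (ν := (volume : Measure (R3 × R3)))
    (ω := dOmega) (Continuous.measurable (by fun_prop)) (integrable_sqrtAbs_prod hV f)
    (h := fun _ => (1 : ℂ)) (integrable_const _)
  simp only [mul_one] at h
  simp only [sphereWave]
  rw [h]
  refine integral_congr_ae (Eventually.of_forall fun θ => ?_)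
  have e : ∀ w : R3, inner ℝ (r • (θ : R3)) w = inner ℝ (r • w) (θ : R3) := fun w => by
    rw [real_inner_smul_left, real_inner_smul_left, real_inner_comm]
  simp only [e]

/-- Spherical averages are Lipschitz, since `sin(r|x-y|)/(r|x-y|)` is Lipschitz in `r` away
from `0`, uniformly in `x - y`. -/
lemma abs_sphereDensity_sub_le {V : R3 → ℝ} (hV : MemLp V 1) (f : L2R3) {r r' : ℝ} (hr : 0 < r)
    (hr' : 0 < r') : |sphereDensity V f r - sphereDensity V f r'|
      ≤ 8 * π / r' * vNorm V ^ 2 * ‖f‖ ^ 2 * |r - r'| := by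
  have hG := integrable_sqrtAbs_prod hV f
  have hI : ∀ r : ℝ, Integrable fun z : R3 × R3 =>
      (((sqrtAbs V z.1 : ℂ) * f z.1) * (starRingEnd ℂ) ((sqrtAbs V z.2 : ℂ) * f z.2)) *
        sphereWave (r • (z.1 - z.2)) := fun r =>
    hG.mul_bdd (c := 4 * π) (Continuous.aestronglyMeasurable
      (continuous_sphereWave.comp (by fun_prop))) (Eventually.of_forall fun z => norm_sphereWave_le _)
  have e : ((sphereDensity V f r - sphereDensity V f r' : ℝ) : ℂ) = fourierConst ^ 2 *
      ∫ z : R3 × R3, (((sqrtAbs V z.1 : ℂ) * f z.1) *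
        (starRingEnd ℂ) ((sqrtAbs V z.2 : ℂ) * f z.2)) *
        (sphereWave (r • (z.1 - z.2)) - sphereWave (r' • (z.1 - z.2))) := by
    simp only [mul_sub]
    rw [integral_sub (hI r) (hI r'), Complex.ofReal_sub, sphereDensity_eq hV, sphereDensity_eq hV,
      mul_sub]
  rw [← Real.norm_eq_abs, ← Complex.norm_real, e, norm_mul, norm_pow]
  refine (mul_le_of_le_one_left (norm_nonneg _)
    (pow_le_one₀ (norm_nonneg _) norm_fourierConst_le)).trans ?_
  have hle : ∀ z : R3 × R3, ‖(((sqrtAbs V z.1 : ℂ) * f z.1) *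
        (starRingEnd ℂ) ((sqrtAbs V z.2 : ℂ) * f z.2)) *
        (sphereWave (r • (z.1 - z.2)) - sphereWave (r' • (z.1 - z.2)))‖
      ≤ ‖((sqrtAbs V z.1 : ℂ) * f z.1) * (starRingEnd ℂ) ((sqrtAbs V z.2 : ℂ) * f z.2)‖ *
        (8 * π / r' * |r - r'|) := fun z => by
    rw [norm_mul]
    exact mul_le_mul_of_nonneg_left (norm_sphereWave_sub_le _ hr hr') (norm_nonneg _)
  refine (norm_integral_le_of_norm_le (hG.norm.mul_const _) (Eventually.of_forall hle)).trans ?_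
  rw [integral_mul_const]
  refine (mul_le_mul_of_nonneg_right (integral_norm_sqrtAbs_prod_le hV f) (by positivity)).trans
    (le_of_eq ?_)
  ring

lemma norm_fermiTrace_sq {V : R3 → ℝ} (hV : MemLp V 1) {μ : ℝ} (hμ : 0 < μ) (f : L2R3) :
    ‖fermiTrace hV μ f‖ ^ 2 = μ * sphereDensity V f (√μ) := by
  have e : (fun q => ‖(fermiTrace hV μ f) q‖ ^ 2) =ᵐ[fermiMeasure μ]
      fun q : FermiSphere μ => ‖gHat V f q‖ ^ 2 := by
    filter_upwards [fermiTrace_ae hV μ f] with q hq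
    rw [hq]
  rw [norm_sq_eq_integral, integral_congr_ae e, fermiMeasure, integral_smul_measure,
    ENNReal.toReal_ofReal hμ.le, integral_map (measurable_toFermiSphere μ).aemeasurable, smul_eq_mul]
  · rfl
  · exact (((continuous_gHat hV f).norm.pow 2).comp continuous_subtype_val).aestronglyMeasurable

/-! ### The adjoint of `|V|^{1/2} K^{-1/2}` in momentum space -/

lemma fourierConst_ne_zero : fourierConst ≠ 0 := by
  rw [fourierConst]
  exact Complex.ofReal_ne_zero.2 (by positivity)

lemma norm_fourierConst_inv_sq : ‖fourierConst⁻¹‖ ^ 2 = (2 * π) ^ 3 := by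
  rw [fourierConst, norm_inv, Complex.norm_real, Real.norm_eq_abs, abs_of_nonneg (by positivity),
    ← Real.rpow_neg (by positivity), ← Real.rpow_natCast, ← Real.rpow_mul (by positivity)]
  norm_num

open ContinuousLinearMap in
/-- In momentum space `X* f` is `K_{T,μ}^{-1/2}` times the Fourier transform of `v f`. Both sides are
tested against indicators of sets of finite measure: `v f` is integrable but need not be in `L²`, so
Plancherel does not apply to it. -/
lemma adjoint_bsOp_ae {V : R3 → ℝ} (hV1 : MemLp V 1) (hV : MemLp V (3 / 2)) {T μ : ℝ} (hT : 0 < T)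
    (hμ : 0 < μ) (f : L2R3) : adjoint (bsOp hV hT hμ) f =ᵐ[volume]
      fun ξ => (kRoot T μ ξ : ℂ) * (fourierConst⁻¹ * gHat V f ((2 * π) • ξ)) := by
  have hcont : Continuous fun ξ : R3 =>
      (kRoot T μ ξ : ℂ) * (fourierConst⁻¹ * gHat V f ((2 * π) • ξ)) :=
    (Complex.continuous_ofReal.comp (continuous_kRoot T μ)).mul
      (continuous_const.mul ((continuous_gHat hV1 f).comp (by fun_prop)))
  refine ae_eq_of_forall_setIntegral_eq_of_sigmaFinite
    (fun s hs hsf => integrableOn_Lp_of_measure_ne_top _ (by norm_num) hsf.ne)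
    (fun s hs hsf => Measure.integrableOn_of_bounded (M := √(1 / (2 * T)) *
      (‖fourierConst⁻¹‖ * (vNorm V * ‖f‖))) hsf.ne hcont.aestronglyMeasurable
      (Eventually.of_forall fun ξ => ?_)) (fun s hs hsf => ?_)
  · rw [norm_mul, norm_mul, Complex.norm_real, Real.norm_eq_abs, abs_of_pos (kRoot_pos hT μ ξ)]
    gcongr
    · exact kRoot_le hT μ ξ
    · exact norm_gHat_le hV1 f _
  · set χ : L2R3 := indicatorConstLp 2 hs hsf.ne (1 : ℂ) with hχ
    have hχae : χ =ᵐ[volume] s.indicator fun _ => (1 : ℂ) := indicatorConstLp_coeFn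
    have hkI : IntegrableOn (fun ξ => (kRoot T μ ξ : ℂ)) s :=
      Measure.integrableOn_of_bounded (M := √(1 / (2 * T))) hsf.ne
        (Complex.continuous_ofReal.comp (continuous_kRoot T μ)).aestronglyMeasurable
        (Eventually.of_forall fun ξ => by
          rw [Complex.norm_real, Real.norm_eq_abs, abs_of_pos (kRoot_pos hT μ ξ)]
          exact kRoot_le hT μ ξ)
    have hD : rootOp hT μ χ =ᵐ[volume] s.indicator fun ξ => (kRoot T μ ξ : ℂ) := by
      filter_upwards [rootOp_ae hT μ χ, hχae] with ξ h1 h2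
      rw [h1, h2]
      by_cases h : ξ ∈ s <;> simp [h]
    have hDI : Integrable (rootOp hT μ χ) := ((integrable_indicator_iff hs).2 hkI).congr hD.symm
    have hS : ∀ᵐ x, (starRingEnd ℂ) ((dressOp hT μ χ) x) = ∫ ξ in s,
        Complex.exp (-Complex.I * ((2 * π * inner ℝ ξ x : ℝ) : ℂ)) * (kRoot T μ ξ : ℂ) := by
      filter_upwards [fourierInv_ae_eq hDI] with x hx
      rw [dressOp_eq, hx, Real.fourierInv_eq', ← integral_conj, ← integral_indicator hs]
      refine integral_congr_ae ?_
      filter_upwards [hD] with ξ hξ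
      rw [hξ]
      by_cases h : ξ ∈ s
      · rw [indicator_of_mem h, indicator_of_mem h, smul_eq_mul, map_mul, Complex.conj_ofReal,
          ← Complex.exp_conj]
        congr 2
        rw [map_mul, Complex.conj_ofReal, Complex.conj_I]
        push_cast
        ring
      · rw [indicator_of_notMem h, indicator_of_notMem h, smul_zero, map_zero]
    rw [← L2.inner_indicatorConstLp_one hs hsf.ne, ← hχ, adjoint_inner_right, L2.inner_def]
    have e : ∀ᵐ x, inner ℂ ((bsOp hV hT hμ χ) x) (f x) = ((sqrtAbs V x : ℂ) * f x) * ∫ ξ in s,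
        Complex.exp (-Complex.I * ((2 * π * inner ℝ ξ x : ℝ) : ℂ)) * (kRoot T μ ξ : ℂ) := by
      filter_upwards [bsOp_ae hV hT hμ χ, hS] with x h1 h2
      rw [h1, RCLike.inner_apply, map_mul, h2, Complex.conj_ofReal]
      ring
    rw [integral_congr_ae e, integral_phase_swap
      (φ := fun (x : R3) (ξ : R3) => (2 * π * inner ℝ ξ x : ℝ))
      (Continuous.measurable (by fun_prop)) (integrable_sqrtAbs_mul hV1 f) hkI]
    refine integral_congr_ae (Eventually.of_forall fun ξ => ?_)
    simp only [gHat, inner_smul_left]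
    rw [inv_mul_cancel_left₀ fourierConst_ne_zero, mul_comm]
    rfl

open ContinuousLinearMap in
/-- `‖X* f‖²` in polar coordinates. -/
lemma norm_adjoint_bsOp_sq {V : R3 → ℝ} (hV1 : MemLp V 1) (hV : MemLp V (3 / 2)) {T μ : ℝ}
    (hT : 0 < T) (hμ : 0 < μ) (f : L2R3) :
    IntegrableOn (fun r => r ^ 2 * kInv T μ r * sphereDensity V f r) (Ioi 0) ∧
    ‖adjoint (bsOp hV hT hμ) f‖ ^ 2
      = ∫ r in Ioi (0 : ℝ), r ^ 2 * kInv T μ r * sphereDensity V f r := by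
  set h : R3 → ℝ := fun p => kInv T μ ‖p‖ * ‖gHat V f p‖ ^ 2 with hh
  have h2π : (2 * π) ≠ 0 := by positivity
  have e : ∀ᵐ ξ, ‖(adjoint (bsOp hV hT hμ) f) ξ‖ ^ 2 = (2 * π) ^ 3 * h ((2 * π) • ξ) := by
    filter_upwards [adjoint_bsOp_ae hV1 hV hT hμ f] with ξ hξ
    rw [hξ, norm_mul, norm_mul, mul_pow, mul_pow, norm_fourierConst_inv_sq, Complex.norm_real,
      Real.norm_eq_abs, sq_abs, kRoot_sq hT, hh]
    simp only [norm_smul, Real.norm_eq_abs, abs_of_pos (show 0 < 2 * π by positivity)]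
    ring
  have hI : Integrable h := by
    have h1 : Integrable fun ξ => (2 * π) ^ 3 * h ((2 * π) • ξ) :=
      ((Lp.memLp (adjoint (bsOp hV hT hμ) f)).integrable_norm_pow two_ne_zero).congr e
    have h2 := h1.const_mul ((2 * π) ^ 3)⁻¹
    have h3 : Integrable fun ξ => h ((2 * π) • ξ) := by
      refine h2.congr (Eventually.of_forall fun ξ => ?_)
      exact inv_mul_cancel_left₀ (by positivity) _
    exact (integrable_comp_smul_iff volume h h2π).1 h3
  obtain ⟨p1, p2⟩ := integral_polar hI
  have e2 : ∀ r ∈ Ioi (0 : ℝ), r ^ 2 • ∫ θ : S2, h (r • (θ : R3)) ∂dOmega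
      = r ^ 2 * kInv T μ r * sphereDensity V f r := by
    intro r hr
    have hr0 : 0 < r := hr
    have e3 : ∀ θ : S2, h (r • (θ : R3)) = kInv T μ r * ‖gHat V f (r • (θ : R3))‖ ^ 2 := by
      intro θ
      have : ‖(θ : R3)‖ = 1 := norm_eq_of_mem_sphere θ
      simp only [hh, norm_smul, this, mul_one, Real.norm_eq_abs, abs_of_pos hr0]
    simp only [e3]
    rw [integral_const_mul, smul_eq_mul, sphereDensity, mul_assoc]
  refine ⟨p1.congr_fun e2 measurableSet_Ioi, ?_⟩
  rw [← setIntegral_congr_fun measurableSet_Ioi e2, ← p2, norm_sq_eq_integral, integral_congr_ae e,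
    integral_const_mul, Measure.integral_comp_smul]
  simp only [finrank_euclideanSpace, Fintype.card_fin, smul_eq_mul]
  rw [abs_of_pos (by positivity), mul_inv_cancel_left₀ (by positivity)]

end BCS

namespace BCS

/-! ### The regular part of the Birman–Schwinger operator and its zero temperature limit -/

open ContinuousLinearMap

variable {V : R3 → ℝ} {μ : ℝ}

/-- The zero temperature density `r²/|r²-μ| (ρ_f(r) - ρ_f(√μ)) + ρ_f(√μ)`. -/
def remDensity (V : R3 → ℝ) (μ : ℝ) (f : L2R3) (r : ℝ) : ℝ :=
  r ^ 2 / |r ^ 2 - μ| * (sphereDensity V f r - sphereDensity V f (√μ)) + sphereDensity V f (√μ)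

/-- The density at temperature `T`, where `1/|r²-μ|` is replaced by the symbol of `K_{T,μ}^{-1}`. -/
def remDensityAt (V : R3 → ℝ) (μ T : ℝ) (f : L2R3) (r : ℝ) : ℝ :=
  r ^ 2 * kInv T μ r * (sphereDensity V f r - sphereDensity V f (√μ)) + sphereDensity V f (√μ)

/-- `X X* - (m/μ) F* F`: what is left of the Birman–Schwinger operator when the part which is
singular for `T → 0`, and which lives on the Fermi sphere, is removed. -/
def remOp (hV1 : MemLp V 1) (hV : MemLp V (3 / 2)) {T : ℝ} (hT : 0 < T) (hμ : 0 < μ) :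
    L2R3 →L[ℂ] L2R3 :=
  bsOp hV hT hμ ∘L adjoint (bsOp hV hT hμ)
    - (radialM μ T / μ) • (adjoint (fermiTrace hV1 μ) ∘L fermiTrace hV1 μ)

lemma bsOp_comp_adjoint (hV1 : MemLp V 1) (hV : MemLp V (3 / 2)) {T : ℝ} (hT : 0 < T)
    (hμ : 0 < μ) : bsOp hV hT hμ ∘L adjoint (bsOp hV hT hμ)
      = (radialM μ T / μ) • (adjoint (fermiTrace hV1 μ) ∘L fermiTrace hV1 μ)
        + remOp hV1 hV hT hμ := by
  rw [remOp, add_sub_cancel]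

lemma isSelfAdjoint_comp_adjoint_sub {H K : Type*} [NormedAddCommGroup H] [InnerProductSpace ℂ H]
    [CompleteSpace H] [NormedAddCommGroup K] [InnerProductSpace ℂ K] [CompleteSpace K]
    (X : H →L[ℂ] H) (F : H →L[ℂ] K) (c : ℝ) :
    IsSelfAdjoint (X ∘L adjoint X - c • (adjoint F ∘L F)) :=
  (isPositive_self_comp_adjoint X).isSelfAdjoint.sub
    ((IsSelfAdjoint.all c).smul (isPositive_adjoint_comp_self F).isSelfAdjoint)

lemma isSelfAdjoint_remOp (hV1 : MemLp V 1) (hV : MemLp V (3 / 2)) {T : ℝ} (hT : 0 < T)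
    (hμ : 0 < μ) : IsSelfAdjoint (remOp hV1 hV hT hμ) :=
  isSelfAdjoint_comp_adjoint_sub (bsOp hV hT hμ) (fermiTrace hV1 μ) (radialM μ T / μ)

lemma re_inner_comp_adjoint_sub {H K : Type*} [NormedAddCommGroup H] [InnerProductSpace ℂ H]
    [CompleteSpace H] [NormedAddCommGroup K] [InnerProductSpace ℂ K] [CompleteSpace K]
    (X : H →L[ℂ] H) (F : H →L[ℂ] K) (c : ℝ) (f : H) :
    (inner ℂ f ((X ∘L adjoint X - c • (adjoint F ∘L F)) f)).re
      = ‖adjoint X f‖ ^ 2 - c * ‖F f‖ ^ 2 := by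
  have h : (X ∘L adjoint X - c • (adjoint F ∘L F)) f
      = X (adjoint X f) - c • (adjoint F (F f)) := rfl
  rw [h, inner_sub_right, Complex.sub_re, re_inner_real_smul, adjoint_inner_right,
    ← adjoint_inner_left, re_inner_self, re_inner_self]

lemma re_inner_remOp (hV1 : MemLp V 1) (hV : MemLp V (3 / 2)) {T : ℝ} (hT : 0 < T)
    (hμ : 0 < μ) (f : L2R3) : IntegrableOn (remDensityAt V μ T f) (Ioi 0) ∧
      (inner ℂ f (remOp hV1 hV hT hμ f)).re = ∫ r in Ioi (0 : ℝ), remDensityAt V μ T f r := by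
  obtain ⟨h1, h2⟩ := norm_adjoint_bsOp_sq hV1 hV hT hμ f
  have h3 := (integrableOn_radialM (μ := μ) hμ hT).mul_const (sphereDensity V f (√μ))
  have e : remDensityAt V μ T f = fun r => r ^ 2 * kInv T μ r * sphereDensity V f r
      - (r ^ 2 * kInv T μ r - 1) * sphereDensity V f (√μ) := by
    funext r
    rw [remDensityAt]
    ring
  constructor
  · rw [e]
    exact h1.sub h3
  · rw [e, integral_sub h1 h3, ← h2, integral_mul_const, ← radialM]
    refine (re_inner_comp_adjoint_sub (bsOp hV hT hμ) (fermiTrace hV1 μ) (radialM μ T / μ) f).trans ?_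
    rw [norm_fermiTrace_sq hV1 hμ]
    field_simp

/-- A bound for the thermal smearing of the Fermi surface. -/
def thermalErr (μ T : ℝ) : ℝ := ∫ r in Ioi (0 : ℝ), 2 * r * Real.exp (-(|r ^ 2 - μ| / T))

lemma thermal_le {T r : ℝ} (hT : 0 < T) (hT1 : T ≤ 1) (hr : 0 < r) :
    2 * r * Real.exp (-(|r ^ 2 - μ| / T)) ≤ 2 * Real.exp μ * (r * Real.exp (-1 * r ^ 2)) := by
  have h1 : r ^ 2 - μ ≤ |r ^ 2 - μ| / T :=
    (le_abs_self _).trans (le_div_self (abs_nonneg _) hT hT1)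
  have h2 : Real.exp (-(|r ^ 2 - μ| / T)) ≤ Real.exp μ * Real.exp (-1 * r ^ 2) := by
    rw [← Real.exp_add]
    exact Real.exp_le_exp.2 (by linarith)
  calc 2 * r * Real.exp (-(|r ^ 2 - μ| / T)) ≤ 2 * r * (Real.exp μ * Real.exp (-1 * r ^ 2)) := by
        gcongr
    _ = _ := by ring

lemma aestronglyMeasurable_thermal (T : ℝ) (ν : Measure ℝ) :
    AEStronglyMeasurable (fun r => 2 * r * Real.exp (-(|r ^ 2 - μ| / T))) ν :=
  Continuous.aestronglyMeasurable (by fun_prop)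

lemma integrableOn_thermal_bound :
    IntegrableOn (fun r : ℝ => 2 * Real.exp μ * (r * Real.exp (-1 * r ^ 2))) (Ioi 0) :=
  ((integrable_mul_exp_neg_mul_sq one_pos).const_mul _).integrableOn

lemma integrableOn_thermal {T : ℝ} (hT : 0 < T) (hT1 : T ≤ 1) :
    IntegrableOn (fun r => 2 * r * Real.exp (-(|r ^ 2 - μ| / T))) (Ioi 0) := by
  refine (integrableOn_thermal_bound (μ := μ)).mono' (aestronglyMeasurable_thermal T _) ?_
  filter_upwards [ae_restrict_mem measurableSet_Ioi] with r hr
  have hr0 : 0 < r := hr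
  rw [Real.norm_eq_abs, abs_of_nonneg (by positivity)]
  exact thermal_le hT hT1 hr0

lemma tendsto_thermalErr (hμ : 0 < μ) : Tendsto (thermalErr μ) (𝓝[>] 0) (𝓝 0) := by
  have h : Tendsto (thermalErr μ) (𝓝[>] 0) (𝓝 (∫ r in Ioi (0 : ℝ), (0 : ℝ))) := by
    refine tendsto_integral_filter_of_dominated_convergence _
      (Eventually.of_forall fun T => aestronglyMeasurable_thermal T _) ?_
      (integrableOn_thermal_bound (μ := μ)) ?_
    · filter_upwards [Ioc_mem_nhdsGT (zero_lt_one (α := ℝ))] with T hT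
      filter_upwards [ae_restrict_mem measurableSet_Ioi] with r hr
      have hr0 : 0 < r := hr
      rw [Real.norm_eq_abs, abs_of_nonneg (by positivity)]
      exact thermal_le hT.1 hT.2 hr0
    · filter_upwards [ae_restrict_mem measurableSet_Ioi, ae_ne (√μ) (Ioi 0)] with r hr hne
      have h0 : 0 < |r ^ 2 - μ| := abs_pos.2 (sq_sub_ne_zero hμ hr hne)
      have h1 : Tendsto (fun T : ℝ => |r ^ 2 - μ| / T) (𝓝[>] 0) atTop := by
        simp only [div_eq_mul_inv]
        exact tendsto_inv_nhdsGT_zero.const_mul_atTop h0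
      have h2 := (Real.tendsto_exp_neg_atTop_nhds_zero.comp h1).const_mul (2 * r)
      rw [mul_zero] at h2
      exact h2
  simpa using h

/-- The Lipschitz constant of the spherical averages at the Fermi sphere. -/
def lipConst (V : R3 → ℝ) (μ : ℝ) : ℝ := 8 * π / √μ * vNorm V ^ 2

lemma lipConst_nonneg (V : R3 → ℝ) (μ : ℝ) : 0 ≤ lipConst V μ := by
  unfold lipConst; positivity

/-- The Lipschitz bound absorbs the pole of `1 / |r² - μ|`, which leaves the factor
`1 - tanh (|r² - μ| / 2T) ≤ 2 exp (-|r² - μ| / T)`. -/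
lemma abs_remDensity_sub_le (hV1 : MemLp V 1) (hμ : 0 < μ) {T r : ℝ} (hT : 0 < T)
    (hr : 0 < r) (hne : r ≠ √μ) (f : L2R3) :
    |remDensityAt V μ T f r - remDensity V μ f r|
      ≤ lipConst V μ * ‖f‖ ^ 2 * (2 * r * Real.exp (-(|r ^ 2 - μ| / T))) := by
  have hs : 0 < √μ := Real.sqrt_pos.2 hμ
  have h0 := sq_sub_ne_zero hμ hr hne
  have h0' : 0 < |r ^ 2 - μ| := abs_pos.2 h0
  have hfac : |r ^ 2 - μ| = |r - √μ| * (r + √μ) := by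
    rw [← abs_of_pos (show 0 < r + √μ by positivity), ← abs_mul]
    congr 1
    nlinarith [Real.sq_sqrt hμ.le]
  have hρ := abs_sphereDensity_sub_le hV1 f hr hs
  set D := sphereDensity V f r - sphereDensity V f (√μ) with hD
  have e : remDensityAt V μ T f r - remDensity V μ f r
      = -(r ^ 2 / |r ^ 2 - μ| * (1 - Real.tanh (|r ^ 2 - μ| / (2 * T))) * D) := by
    rw [remDensityAt, remDensity, ← hD, kInv_eq hT h0]
    ring
  have h1 := one_sub_tanh_le_exp (|r ^ 2 - μ| / (2 * T))
  have h2 : 0 ≤ 1 - Real.tanh (|r ^ 2 - μ| / (2 * T)) := one_sub_tanh_nonneg _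
  have e2 : 2 * (|r ^ 2 - μ| / (2 * T)) = |r ^ 2 - μ| / T := by field_simp
  rw [e2] at h1
  have hd : 0 < |r - √μ| := abs_pos.2 (sub_ne_zero.2 hne)
  have h3 : r ^ 2 / |r ^ 2 - μ| * |r - √μ| ≤ r := by
    rw [hfac, div_mul_eq_mul_div, div_le_iff₀ (by positivity)]
    nlinarith [mul_pos (mul_pos hr hd) hs]
  rw [e, abs_neg, abs_mul, abs_mul, abs_of_nonneg h2, abs_of_nonneg (by positivity)]
  calc r ^ 2 / |r ^ 2 - μ| * (1 - Real.tanh (|r ^ 2 - μ| / (2 * T))) * |D|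
      ≤ r ^ 2 / |r ^ 2 - μ| * (2 * Real.exp (-(|r ^ 2 - μ| / T))) *
        (8 * π / √μ * vNorm V ^ 2 * ‖f‖ ^ 2 * |r - √μ|) := by gcongr
    _ = lipConst V μ * ‖f‖ ^ 2 * (2 * (r ^ 2 / |r ^ 2 - μ| * |r - √μ|) *
        Real.exp (-(|r ^ 2 - μ| / T))) := by rw [lipConst]; ring
    _ ≤ lipConst V μ * ‖f‖ ^ 2 * (2 * r * Real.exp (-(|r ^ 2 - μ| / T))) := by
        have := lipConst_nonneg V μ
        gcongr

lemma aestronglyMeasurable_sphereDensity (hV1 : MemLp V 1) (f : L2R3) :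
    AEStronglyMeasurable (sphereDensity V f) (volume.restrict (Ioi 0)) := by
  have : Continuous (Function.uncurry fun (r : ℝ) (θ : S2) => ‖gHat V f (r • (θ : R3))‖ ^ 2) :=
    ((continuous_gHat hV1 f).comp (by fun_prop)).norm.pow 2
  exact (this.stronglyMeasurable.integral_prod_right (ν := dOmega)).aestronglyMeasurable

/-- The form of `R_T` converges as `T → 0`, at a rate uniform on bounded sets. -/
lemma integral_remDensity (hV1 : MemLp V 1) (hV : MemLp V (3 / 2)) {T : ℝ} (hT : 0 < T)
    (hT1 : T ≤ 1) (hμ : 0 < μ) (f : L2R3) : IntegrableOn (remDensity V μ f) (Ioi 0) ∧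
      |(inner ℂ f (remOp hV1 hV hT hμ f)).re - ∫ r in Ioi (0 : ℝ), remDensity V μ f r|
        ≤ lipConst V μ * thermalErr μ T * ‖f‖ ^ 2 := by
  obtain ⟨h1, h2⟩ := re_inner_remOp hV1 hV hT hμ f
  have hm : AEStronglyMeasurable (remDensity V μ f) (volume.restrict (Ioi 0)) := by
    refine AEStronglyMeasurable.add (AEStronglyMeasurable.mul
      (Measurable.aestronglyMeasurable (by fun_prop)) ?_) aestronglyMeasurable_const
    exact (aestronglyMeasurable_sphereDensity hV1 f).sub aestronglyMeasurable_const
  have hb : ∀ᵐ r ∂(volume.restrict (Ioi (0 : ℝ))),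
      ‖remDensityAt V μ T f r - remDensity V μ f r‖
      ≤ lipConst V μ * ‖f‖ ^ 2 * (2 * r * Real.exp (-(|r ^ 2 - μ| / T))) := by
    filter_upwards [ae_restrict_mem measurableSet_Ioi, ae_ne (√μ) (Ioi 0)] with r hr hne
    exact abs_remDensity_sub_le hV1 hμ hT hr hne f
  have hI := (integrableOn_thermal (μ := μ) hT hT1).const_mul (lipConst V μ * ‖f‖ ^ 2)
  have hd : IntegrableOn (fun r => remDensityAt V μ T f r - remDensity V μ f r) (Ioi 0) :=
    hI.mono' (h1.aestronglyMeasurable.sub hm) hb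
  have h0 : IntegrableOn (remDensity V μ f) (Ioi 0) := by
    refine (h1.sub hd).congr (Eventually.of_forall fun r => ?_)
    simp
  refine ⟨h0, ?_⟩
  rw [h2, ← integral_sub h1 h0, ← Real.norm_eq_abs]
  refine (norm_integral_le_of_norm_le hI hb).trans (le_of_eq ?_)
  rw [integral_const_mul, thermalErr]
  ring

/-- An operator limit in which the forms converge uniformly. -/
lemma exists_operator_limit {H : Type*} [NormedAddCommGroup H] [InnerProductSpace ℂ H]
    [CompleteSpace H] (A : ℕ → H →L[ℂ] H) (hA : ∀ n, IsSelfAdjoint (A n)) (q : H → ℝ)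
    (ε : ℕ → ℝ) (hε0 : ∀ n, 0 < ε n) (hε : Tendsto ε atTop (𝓝 0))
    (h : ∀ n f, |(inner ℂ f (A n f)).re - q f| ≤ ε n * ‖f‖ ^ 2) :
    ∃ B : H →L[ℂ] H, IsSelfAdjoint B ∧ ∀ f, (inner ℂ f (B f)).re = q f := by
  have hd : ∀ m n, ‖A m - A n‖ ≤ ε m + ε n := by
    intro m n
    refine norm_le_of_abs_re_inner_le ((hA m).sub (hA n)) (add_pos (hε0 m) (hε0 n)) fun f => ?_
    have e : (inner ℂ f ((A m - A n) f)).re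
        = ((inner ℂ f (A m f)).re - q f) - ((inner ℂ f (A n f)).re - q f) := by
      rw [_root_.sub_apply, inner_sub_right, Complex.sub_re]
      ring
    rw [e, add_mul]
    exact (abs_sub _ _).trans (add_le_add (h m f) (h n f))
  have hc : CauchySeq A := by
    rw [Metric.cauchySeq_iff]
    intro δ hδ
    obtain ⟨N, hN⟩ := (hε.eventually (gt_mem_nhds (half_pos hδ))).exists_forall_of_atTop
    refine ⟨N, fun m hm n hn => ?_⟩
    rw [dist_eq_norm]
    have := hd m n
    have := hN m hm
    have := hN n hn
    linarith
  obtain ⟨B, hB⟩ := cauchySeq_tendsto_of_complete hc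
  refine ⟨B, ?_, fun f => ?_⟩
  · refine tendsto_nhds_unique (f := fun n => star (A n)) (hB.star) ?_
    exact hB.congr fun n => (hA n).symm
  · have h1 : Tendsto (fun n => (inner ℂ f (A n f)).re) atTop (𝓝 (inner ℂ f (B f)).re) := by
      have : Continuous fun C : H →L[ℂ] H => (inner ℂ f (C f)).re :=
        Complex.continuous_re.comp (continuous_const.inner (by fun_prop))
      exact (this.tendsto B).comp hB
    have h2 : Tendsto (fun n => (inner ℂ f (A n f)).re) atTop (𝓝 (q f)) := by
      rw [tendsto_iff_dist_tendsto_zero]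
      refine squeeze_zero (fun _ => dist_nonneg) (fun n => h n f) ?_
      simpa using hε.mul_const (‖f‖ ^ 2)
    exact tendsto_nhds_unique h1 h2

lemma thermalErr_nonneg (μ T : ℝ) : 0 ≤ thermalErr μ T := by
  refine setIntegral_nonneg measurableSet_Ioi fun r hr => ?_
  have : 0 < r := hr
  positivity

/-- The zero temperature limit of the regular part. -/
lemma exists_remOp_limit (hV1 : MemLp V 1) (hV : MemLp V (3 / 2)) (hμ : 0 < μ) :
    ∃ R : L2R3 →L[ℂ] L2R3, IsSelfAdjoint R ∧
      (∀ f, IntegrableOn (remDensity V μ f) (Ioi 0) ∧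
        (inner ℂ f (R f)).re = ∫ r in Ioi (0 : ℝ), remDensity V μ f r) ∧
      ∀ T (hT : 0 < T), T ≤ 1 →
        ‖remOp hV1 hV hT hμ - R‖ ≤ lipConst V μ * thermalErr μ T + T := by
  -- The limit is taken along `T = 1 / (n + 1)`. Adding `T` to the error keeps it positive.
  set t : ℕ → ℝ := fun n => 1 / ((n : ℝ) + 1) with ht
  have ht0 : ∀ n, 0 < t n := fun n => by positivity
  have ht1 : ∀ n, t n ≤ 1 := fun n => by
    rw [ht]
    exact div_le_one_of_le₀ (by linarith [Nat.cast_nonneg (α := ℝ) n]) (by positivity)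
  have htlim : Tendsto t atTop (𝓝[>] 0) :=
    tendsto_nhdsWithin_iff.2 ⟨tendsto_one_div_add_atTop_nhds_zero_nat,
      Eventually.of_forall fun n => ht0 n⟩
  have hε : Tendsto (fun n => lipConst V μ * thermalErr μ (t n) + t n) atTop (𝓝 0) := by
    have h1 := ((tendsto_thermalErr hμ).comp htlim).const_mul (lipConst V μ)
    have h2 := h1.add (tendsto_nhdsWithin_iff.1 htlim).1
    simpa using h2
  have hpos : ∀ T, 0 < T → 0 < lipConst V μ * thermalErr μ T + T := fun T hT =>
    add_pos_of_nonneg_of_pos (mul_nonneg (lipConst_nonneg V μ) (thermalErr_nonneg μ T)) hT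
  have hform : ∀ T (hT : 0 < T), T ≤ 1 → ∀ f,
      |(inner ℂ f (remOp hV1 hV hT hμ f)).re - ∫ r in Ioi (0 : ℝ), remDensity V μ f r|
        ≤ (lipConst V μ * thermalErr μ T + T) * ‖f‖ ^ 2 := fun T hT hT1 f =>
    (integral_remDensity hV1 hV hT hT1 hμ f).2.trans
      (mul_le_mul_of_nonneg_right (by linarith) (by positivity))
  obtain ⟨R, hR, hRq⟩ := exists_operator_limit (fun n => remOp hV1 hV (ht0 n) hμ)
    (fun n => isSelfAdjoint_remOp hV1 hV (ht0 n) hμ)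
    (fun f => ∫ r in Ioi (0 : ℝ), remDensity V μ f r) _ (fun n => hpos _ (ht0 n)) hε
    (fun n f => hform _ (ht0 n) (ht1 n) f)
  refine ⟨R, hR, fun f => ⟨(integral_remDensity hV1 hV one_pos le_rfl hμ f).1, hRq f⟩,
    fun T hT hT1 => ?_⟩
  refine norm_le_of_abs_re_inner_le ((isSelfAdjoint_remOp hV1 hV hT hμ).sub hR) (hpos T hT)
    fun f => ?_
  rw [_root_.sub_apply, inner_sub_right, Complex.sub_re, hRq]
  exact hform T hT hT1 f

end BCS

namespace BCS

/-! ### Solving the implicit equation for the critical temperature -/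

/-- The asymptotics of the threshold `T_c(λ) = inf {T > 0 : P λ T}` when, for small `T` and `λ`, the
condition `P λ T` is equivalent to `λ c(T) g(T, λ) ≥ -1`, where `c(T) κ = ln(μ/T) - L + o(1)` and
`g(T, λ) = G(λ) + O(λ²) + λ o(1)` is negative. -/
lemma threshold_asymptotics {P : ℝ → ℝ → Prop} {Tc c ε G : ℝ → ℝ} {g : ℝ → ℝ → ℝ}
    {μ κ L e C : ℝ} (hμ : 0 < μ) (hκ : 0 < κ) (he : e < 0)
    (hTc : ∀ l, Tc l = sInf {T : ℝ | 0 < T ∧ P l T})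
    (hne : ∀ l, 0 < l → ∃ T, 0 < T ∧ P l T)
    (hsmall : ∀ T, 0 < T → ∀ᶠ l in 𝓝[>] (0 : ℝ), P l T)
    (hmono : ∀ l l' T, 0 < l' → l' ≤ l → 0 < T → P l T → P l' T)
    {τ Λ : ℝ} (hτ : 0 < τ) (hΛ : 0 < Λ)
    (h1 : ∀ T l, 0 < T → T < τ → 0 < l → l < Λ → P l T → -1 ≤ l * c T * g T l)
    (h2 : ∀ T l, 0 < T → T < τ → 0 < l → l < Λ → ¬ P l T → l * c T * g T l ≤ -1)
    (h3 : ∀ T l, 0 < T → T < τ → 0 < l → l < Λ → |g T l - G l| ≤ C * (l ^ 2 + l * ε T))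
    (h4 : ∀ T l, 0 < T → T < τ → 0 < l → l < Λ → g T l ≤ e)
    (hG : ∀ l, 0 < l → l < Λ → G l ≤ e)
    (hε : Tendsto ε (𝓝[>] 0) (𝓝 0))
    (hc : Tendsto (fun T => c T * κ - Real.log (μ / T)) (𝓝[>] 0) (𝓝 (-L))) :
    (∀ l, 0 < l → 0 < Tc l) ∧
      Tendsto (fun l => Real.log (μ / Tc l) + κ / (l * G l)) (𝓝[>] 0) (𝓝 L) := by
  have hbdd : ∀ l, BddBelow {T : ℝ | 0 < T ∧ P l T} := fun l => ⟨0, fun T hT => hT.1.le⟩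
  have hctop : Tendsto c (𝓝[>] 0) atTop := by
    have hlog : Tendsto (fun T : ℝ => Real.log (μ / T)) (𝓝[>] 0) atTop := by
      refine Real.tendsto_log_atTop.comp ?_
      refine (tendsto_inv_nhdsGT_zero.const_mul_atTop hμ).congr fun T => ?_
      rw [div_eq_mul_inv]
    have := (hc.add_atTop hlog).atTop_div_const hκ
    refine this.congr fun T => ?_
    rw [sub_add_cancel, mul_div_cancel_right₀ _ hκ.ne']
  have hTcpos_small : ∀ l, 0 < l → l < Λ → 0 < Tc l := by
    intro l hl hlΛ
    have hev : ∀ᶠ T in 𝓝[>] (0 : ℝ), 1 / (l * -e) < c T := hctop.eventually_gt_atTop _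
    obtain ⟨δ, hδ, hδ'⟩ := mem_nhdsGT_iff_exists_Ioo_subset.1 hev
    have hδ0 : 0 < δ := hδ
    refine lt_of_lt_of_le (lt_min hδ0 hτ) ?_
    rw [hTc]
    refine le_csInf (hne l hl) fun T ⟨hT, hPT⟩ => ?_
    by_contra! hlt
    have hTδ : T < δ := hlt.trans_le (min_le_left _ _)
    have hTτ : T < τ := hlt.trans_le (min_le_right _ _)
    have hcT : 1 / (l * -e) < c T := hδ' ⟨hT, hTδ⟩
    have hle : 0 < l * -e := mul_pos hl (neg_pos.2 he)
    rw [div_lt_iff₀ hle] at hcT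
    have hc0 : 0 < c T := by
      by_contra! hcn
      nlinarith
    have := h1 T l hT hTτ hl hlΛ hPT
    have := mul_le_mul_of_nonneg_left (h4 T l hT hTτ hl hlΛ) (mul_pos hl hc0).le
    nlinarith
  have hTcpos : ∀ l, 0 < l → 0 < Tc l := by
    intro l hl
    set l' := min l (Λ / 2) with hl'
    have hl'0 : 0 < l' := lt_min hl (half_pos hΛ)
    refine (hTcpos_small l' hl'0 ((min_le_right _ _).trans_lt (half_lt_self hΛ))).trans_le ?_
    rw [hTc, hTc]
    exact csInf_le_csInf (hbdd l') (hne l hl) fun T ⟨hT, hPT⟩ =>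
      ⟨hT, hmono l l' T hl'0 (min_le_left _ _) hT hPT⟩
  refine ⟨hTcpos, ?_⟩
  have hTc0 : Tendsto Tc (𝓝[>] 0) (𝓝 0) := by
    rw [Metric.tendsto_nhds]
    intro δ hδ
    filter_upwards [hsmall (δ / 2) (half_pos hδ), self_mem_nhdsWithin] with l hl hl0
    have h : Tc l ≤ δ / 2 := by
      rw [hTc]
      exact csInf_le (hbdd l) ⟨half_pos hδ, hl⟩
    rw [Real.dist_eq, sub_zero, abs_of_pos (hTcpos l hl0)]
    linarith
  have hl1 : Tendsto (fun l : ℝ => 1 + l) (𝓝[>] 0) (𝓝 1) := by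
    have : Tendsto (fun l : ℝ => 1 + l) (𝓝 0) (𝓝 (1 + 0)) := (by fun_prop : Continuous
      fun l : ℝ => 1 + l).tendsto 0
    rw [add_zero] at this
    exact this.mono_left nhdsWithin_le_nhds
  have hlog1 : Tendsto (fun l : ℝ => Real.log (1 + l)) (𝓝[>] 0) (𝓝 0) := by
    have := (Real.continuousAt_log one_ne_zero).tendsto.comp hl1
    rwa [Real.log_one] at this
  have hid : Tendsto (fun l : ℝ => l) (𝓝[>] 0) (𝓝 0) := tendsto_id.mono_left nhdsWithin_le_nhds
  -- along any temperature that vanishes with `l`, `g` may be replaced by `G`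
  have hcomp : ∀ S : ℝ → ℝ, Tendsto S (𝓝[>] 0) (𝓝[>] 0) →
      Tendsto (fun l => κ / (l * G l) - κ / (l * g (S l) l)) (𝓝[>] 0) (𝓝 0) := by
    intro S hS
    have hlim : Tendsto (fun l => κ * C * (l + ε (S l)) / e ^ 2) (𝓝[>] 0) (𝓝 0) := by
      have := (((hid.add (hε.comp hS)).const_mul (κ * C)).div_const (e ^ 2))
      simpa using this
    refine squeeze_zero_norm' ?_ hlim
    filter_upwards [hS (Ioo_mem_nhdsGT hτ), Ioo_mem_nhdsGT hΛ] with l hSl hl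
    have hSl' : S l ∈ Ioo 0 τ := hSl
    have a3 := h3 _ _ hSl'.1 hSl'.2 hl.1 hl.2
    have a4 := h4 _ _ hSl'.1 hSl'.2 hl.1 hl.2
    have aG := hG _ hl.1 hl.2
    have hl0 : 0 < l := hl.1
    have hg0 : g (S l) l ≠ 0 := (a4.trans_lt he).ne
    have hG0 : G l ≠ 0 := (aG.trans_lt he).ne
    have e1 : κ / (l * G l) - κ / (l * g (S l) l)
        = κ * (g (S l) l - G l) / l / (g (S l) l * G l) := by field_simp
    have e2 : e ^ 2 ≤ g (S l) l * G l := by nlinarith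
    have e3 : 0 < e ^ 2 := by nlinarith
    rw [e1, Real.norm_eq_abs, abs_div, abs_div, abs_mul, abs_of_pos hκ, abs_of_pos hl0,
      abs_of_pos (e3.trans_le e2)]
    have hnum : κ * |g (S l) l - G l| / l ≤ κ * C * (l + ε (S l)) := by
      rw [div_le_iff₀ hl0]
      calc κ * |g (S l) l - G l| ≤ κ * (C * (l ^ 2 + l * ε (S l))) := by gcongr
        _ = _ := by ring
    have hnum0 : 0 ≤ κ * |g (S l) l - G l| / l := by positivity
    exact div_le_div₀ (hnum0.trans hnum) hnum e3 e2
  -- temperatures just above and just below the threshold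
  have hex : ∀ l : ℝ, ∃ T, 0 < l → 0 < T ∧ P l T ∧ Tc l ≤ T ∧ T < (1 + l) * Tc l := by
    intro l
    by_cases hl : 0 < l
    · have hlt : Tc l < (1 + l) * Tc l := by nlinarith [hTcpos l hl]
      conv at hlt => lhs; rw [hTc]
      obtain ⟨T, ⟨hT, hPT⟩, hlt'⟩ := exists_lt_of_csInf_lt (hne l hl) hlt
      refine ⟨T, fun _ => ⟨hT, hPT, ?_, hlt'⟩⟩
      rw [hTc]
      exact csInf_le (hbdd l) ⟨hT, hPT⟩
    · exact ⟨0, fun h => absurd h hl⟩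
  choose U hU using hex
  have hUlim : Tendsto U (𝓝[>] 0) (𝓝[>] 0) := by
    refine tendsto_nhdsWithin_iff.2 ⟨?_, ?_⟩
    · have := hl1.mul hTc0
      rw [one_mul] at this
      refine squeeze_zero' ?_ ?_ this
      · filter_upwards [self_mem_nhdsWithin] with l hl using (hU l hl).1.le
      · filter_upwards [self_mem_nhdsWithin] with l hl using (hU l hl).2.2.2.le
    · filter_upwards [self_mem_nhdsWithin] with l hl using (hU l hl).1
  have hDlim : Tendsto (fun l => Tc l / (1 + l)) (𝓝[>] 0) (𝓝[>] 0) := by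
    refine tendsto_nhdsWithin_iff.2 ⟨?_, ?_⟩
    · have := hTc0.div hl1 one_ne_zero
      rwa [zero_div] at this
    · filter_upwards [self_mem_nhdsWithin] with l hl
      have hl0 : 0 < l := hl
      exact div_pos (hTcpos l hl) (by positivity)
  have hneg : Tendsto (fun T => Real.log (μ / T) - c T * κ) (𝓝[>] 0) (𝓝 L) := by
    have := hc.neg
    rw [neg_neg] at this
    exact this.congr fun T => by ring
  have hup : Tendsto (fun l => (Real.log (μ / U l) - c (U l) * κ) + Real.log (1 + l)
      + (κ / (l * G l) - κ / (l * g (U l) l))) (𝓝[>] 0) (𝓝 L) := by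
    simpa using ((hneg.comp hUlim).add hlog1).add (hcomp U hUlim)
  have hlow : Tendsto (fun l => (Real.log (μ / (Tc l / (1 + l))) - c (Tc l / (1 + l)) * κ)
      - Real.log (1 + l) + (κ / (l * G l) - κ / (l * g (Tc l / (1 + l)) l))) (𝓝[>] 0) (𝓝 L) := by
    simpa using ((hneg.comp hDlim).sub hlog1).add (hcomp _ hDlim)
  refine tendsto_of_tendsto_of_tendsto_of_le_of_le' hlow hup ?_ ?_
  · filter_upwards [hDlim (Ioo_mem_nhdsGT hτ), Ioo_mem_nhdsGT hΛ] with l hD hl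
    have hD' : Tc l / (1 + l) ∈ Ioo 0 τ := hD
    have hl0 : 0 < l := hl.1
    have hT0 := hTcpos l hl0
    set T := Tc l / (1 + l) with hTdef
    have hnP : ¬ P l T := by
      intro hP
      have : Tc l ≤ T := by
        conv_lhs => rw [hTc]
        exact csInf_le (hbdd l) ⟨hD'.1, hP⟩
      have h5 : T < Tc l := div_lt_self hT0 (by linarith)
      linarith
    have a2 := h2 T l hD'.1 hD'.2 hl.1 hl.2 hnP
    have a4 := (h4 T l hD'.1 hD'.2 hl.1 hl.2).trans_lt he
    have hcg : -(κ / (l * g T l)) ≤ c T * κ := by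
      have h6 : l * g T l < 0 := mul_neg_of_pos_of_neg hl0 a4
      rw [← div_neg, div_le_iff₀ (neg_pos.2 h6)]
      nlinarith
    have hlog : Real.log (μ / T) = Real.log (μ / Tc l) + Real.log (1 + l) := by
      rw [← Real.log_mul (by positivity) (by positivity), hTdef]
      congr 1
      field_simp
    rw [hlog]
    linarith
  · filter_upwards [hUlim (Ioo_mem_nhdsGT hτ), Ioo_mem_nhdsGT hΛ] with l hD hl
    have hD' : U l ∈ Ioo 0 τ := hD
    have hl0 : 0 < l := hl.1
    have hT0 := hTcpos l hl0
    obtain ⟨hU0, hUP, hU1, hU2⟩ := hU l hl0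
    have a2 := h1 (U l) l hD'.1 hD'.2 hl.1 hl.2 hUP
    have a4 := (h4 (U l) l hD'.1 hD'.2 hl.1 hl.2).trans_lt he
    have hcg : c (U l) * κ ≤ -(κ / (l * g (U l) l)) := by
      have h6 : l * g (U l) l < 0 := mul_neg_of_pos_of_neg hl0 a4
      rw [← div_neg, le_div_iff₀ (neg_pos.2 h6)]
      nlinarith
    have hlog : Real.log (μ / Tc l) ≤ Real.log (μ / U l) + Real.log (1 + l) := by
      rw [← Real.log_mul (by positivity) (by positivity)]
      refine Real.log_le_log (by positivity) ?_
      rw [div_mul_eq_mul_div, div_le_div_iff₀ hT0 hU0]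
      nlinarith
    linarith

/-! ### The reduced operator to second order -/

section Reduced

open ContinuousLinearMap (adjoint)

variable {K Ω : Type*} [NormedAddCommGroup K] [InnerProductSpace ℂ K] [CompleteSpace K]
  [NormedAddCommGroup Ω] [InnerProductSpace ℂ Ω] [CompleteSpace Ω]

/-- The bottom of `F s F*`. -/
def firstOrderInf (F : K →L[ℂ] Ω) (s : K →L[ℂ] K) : ℝ := sInf (spectrum ℝ (F ∘L s ∘L adjoint F))

/-- The bottom of `F s F* - a F s R s F*`, the expansion of the reduced operator to second order. -/
def secondOrderInf (F : K →L[ℂ] Ω) (s R : K →L[ℂ] K) (a : ℝ) : ℝ :=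
  sInf (spectrum ℝ (F ∘L s ∘L adjoint F - a • (F ∘L (s * R * s) ∘L adjoint F)))

lemma isSelfAdjoint_secondOrder (F : K →L[ℂ] Ω) {s R : K →L[ℂ] K} (hs : IsSelfAdjoint s)
    (hR : IsSelfAdjoint R) (a : ℝ) :
    IsSelfAdjoint (F ∘L s ∘L adjoint F - a • (F ∘L (s * R * s) ∘L adjoint F)) := by
  have h : IsSelfAdjoint (s * R * s) := by
    have := hR.conjugate s
    rwa [hs.star_eq] at this
  exact (hs.conj_adjoint F).sub ((IsSelfAdjoint.all a).smul (h.conj_adjoint F))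

/-- Neumann series: `(s + a R)⁻¹ = s - a s R s + O(a²)`, together with the replacement of `R` by
`R₀`. -/
lemma abs_reducedInf_sub_secondOrderInf_le [Nontrivial Ω] (F : K →L[ℂ] Ω) {s R R₀ : K →L[ℂ] K}
    (hs : IsSelfAdjoint s) (hR : IsSelfAdjoint R) (hR₀ : IsSelfAdjoint R₀) (hs2 : s * s = 1)
    (hs1 : ‖s‖ ≤ 1) {a : ℝ} (ha : |a| * ‖R‖ ≤ 1 / 2) :
    |reducedInf F s R a - secondOrderInf F s R₀ a|
      ≤ ‖F‖ ^ 2 * (2 * a ^ 2 * ‖R‖ ^ 2 + |a| * ‖R - R₀‖) := by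
  refine (abs_sInf_spectrum_sub_le (isSelfAdjoint_reducedOp F hs hR a)
    (isSelfAdjoint_secondOrder F hs hR₀ a)).trans ?_
  have e : reducedOp F s R a - (F ∘L s ∘L adjoint F - a • (F ∘L (s * R₀ * s) ∘L adjoint F))
      = F ∘L ((dressedInv s R a - (s - a • (s * R * s))) - a • (s * (R - R₀) * s)) ∘L adjoint F := by
    ext1 u
    have e1 : (s * (R - R₀) * s) (adjoint F u)
        = (s * R * s) (adjoint F u) - (s * R₀ * s) (adjoint F u) := by
      rw [mul_sub, sub_mul, _root_.sub_apply]
    change F (dressedInv s R a (adjoint F u)) - (F (s (adjoint F u))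
      - a • F ((s * R₀ * s) (adjoint F u))) = F ((dressedInv s R a (adjoint F u)
      - (s (adjoint F u) - a • (s * R * s) (adjoint F u))) - a • (s * (R - R₀) * s) (adjoint F u))
    have hsm : ∀ w, F (a • w) = a • F w := fun w => F.map_smul_of_tower a w
    rw [e1]
    simp only [map_sub, hsm, smul_sub]
    abel
  rw [e]
  refine (norm_comp_adjoint_le F _).trans (mul_le_mul_of_nonneg_left ?_ (sq_nonneg _))
  refine (norm_sub_le _ _).trans (add_le_add (norm_dressedInv_sub_le hs2 hs1 ha) ?_)
  rw [norm_smul, Real.norm_eq_abs]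
  refine mul_le_mul_of_nonneg_left ?_ (abs_nonneg a)
  calc ‖s * (R - R₀) * s‖ ≤ ‖s‖ * ‖R - R₀‖ * ‖s‖ :=
        (norm_mul_le _ _).trans (mul_le_mul_of_nonneg_right (norm_mul_le _ _) (norm_nonneg _))
    _ ≤ 1 * ‖R - R₀‖ * 1 := by gcongr
    _ = ‖R - R₀‖ := by ring

lemma abs_secondOrderInf_sub_le [Nontrivial Ω] (F : K →L[ℂ] Ω) {s R : K →L[ℂ] K}
    (hs : IsSelfAdjoint s) (hR : IsSelfAdjoint R) (hs1 : ‖s‖ ≤ 1) (a : ℝ) :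
    |secondOrderInf F s R a - firstOrderInf F s|
      ≤ ‖F‖ ^ 2 * (|a| * ‖R‖) := by
  refine (abs_sInf_spectrum_sub_le (isSelfAdjoint_secondOrder F hs hR a)
    (hs.conj_adjoint F)).trans ?_
  rw [sub_sub_cancel_left, norm_neg, norm_smul, Real.norm_eq_abs, mul_left_comm]
  refine mul_le_mul_of_nonneg_left ((norm_comp_adjoint_le F _).trans
    (mul_le_mul_of_nonneg_left ?_ (sq_nonneg _))) (abs_nonneg a)
  calc ‖s * R * s‖ ≤ ‖s‖ * ‖R‖ * ‖s‖ :=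
        (norm_mul_le _ _).trans (mul_le_mul_of_nonneg_right (norm_mul_le _ _) (norm_nonneg _))
    _ ≤ 1 * ‖R‖ * 1 := by gcongr
    _ = ‖R‖ := by ring

lemma reducedInf_zero [Nontrivial Ω] (F : K →L[ℂ] Ω) {s R : K →L[ℂ] K} (hs : IsSelfAdjoint s)
    (hR : IsSelfAdjoint R) (hs2 : s * s = 1) (hs1 : ‖s‖ ≤ 1) :
    reducedInf F s R 0 = firstOrderInf F s := by
  have h := abs_reducedInf_sub_secondOrderInf_le F hs hR hR hs2 hs1 (a := 0) (by simp)
  simp only [abs_zero, zero_mul, ne_eq, OfNat.ofNat_ne_zero, not_false_eq_true, zero_pow, mul_zero,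
    add_zero] at h
  have h2 := sub_eq_zero.1 (abs_nonpos_iff.1 h)
  rw [h2, secondOrderInf, zero_smul, sub_zero, firstOrderInf]

end Reduced

end BCS

namespace BCS

/-! ### The operators on the Fermi sphere and the critical temperature -/

open ContinuousLinearMap (adjoint)

lemma inner_eq_re_of_isSelfAdjoint {H : Type*} [NormedAddCommGroup H] [InnerProductSpace ℂ H]
    [CompleteSpace H] {A : H →L[ℂ] H} (hA : IsSelfAdjoint A) (f : H) :
    inner ℂ f (A f) = ((inner ℂ f (A f)).re : ℂ) := by
  refine (Complex.conj_eq_iff_re.1 ?_).symm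
  rw [inner_conj_symm]
  exact ContinuousLinearMap.isSelfAdjoint_iff_isSymmetric.1 hA f f

lemma inner_conj_adjoint {K Ω : Type*} [NormedAddCommGroup K] [InnerProductSpace ℂ K]
    [CompleteSpace K] [NormedAddCommGroup Ω] [InnerProductSpace ℂ Ω] [CompleteSpace Ω]
    (F : K →L[ℂ] Ω) {s : K →L[ℂ] K} (hs : IsSelfAdjoint s) (R : K →L[ℂ] K) (u : Ω) :
    inner ℂ u ((F ∘L (s * R * s) ∘L adjoint F) u)
      = inner ℂ (s (adjoint F u)) (R (s (adjoint F u))) := by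
  change inner ℂ u (F (s (R (s (adjoint F u))))) = _
  rw [← ContinuousLinearMap.adjoint_inner_left]
  exact (ContinuousLinearMap.isSelfAdjoint_iff_isSymmetric.1 hs _ _).symm

lemma formWIntegrand_eq {V : R3 → ℝ} (hV : MemLp V 1) (μ : ℝ) (u : L2Fermi μ) :
    formWIntegrand V μ u = remDensity V μ (signOp hV.1 (adjoint (fermiTrace hV μ) u)) := by
  have hI : ∀ r : ℝ, Integrable (fun θ : S2 => ‖phiHat V μ u (r • (θ : R3))‖ ^ 2) dOmega := by
    intro r
    have hc : Continuous fun θ : S2 => ‖phiHat V μ u (r • (θ : R3))‖ ^ 2 :=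
      ((continuous_phiHat V μ u).comp (by fun_prop)).norm.pow 2
    exact hc.integrable_of_hasCompactSupport (HasCompactSupport.of_compactSpace _)
  funext r
  rw [formWIntegrand, remDensity, sphereDensity, sphereDensity, integral_sub (hI r) (hI _)]
  simp only [gHat_signOp_adjoint]

/-- For `f = s F* u` the Fourier transform of `v f` is the function `φ^` of the form `𝒲_μ`, because
`v s v = V`; so the form of the limiting regular part at `f` is that of `𝒲_μ` at `u`. -/
lemma hasFormW_of_limit {V : R3 → ℝ} (hV : MemLp V 1) {μ : ℝ} {R : L2R3 →L[ℂ] L2R3}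
    (hR : IsSelfAdjoint R) (hq : ∀ f, IntegrableOn (remDensity V μ f) (Ioi 0) ∧
      (inner ℂ f (R f)).re = ∫ r in Ioi (0 : ℝ), remDensity V μ f r) :
    HasFormW V μ (fermiTrace hV μ ∘L (signOp hV.1 * R * signOp hV.1) ∘L
      adjoint (fermiTrace hV μ)) := by
  intro u
  rw [formWIntegrand_eq hV]
  refine ⟨(hq _).1, ?_⟩
  rw [← (hq _).2, ← inner_eq_re_of_isSelfAdjoint hR]
  exact inner_conj_adjoint (fermiTrace hV μ) (isSelfAdjoint_signOp hV.1) R u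

lemma opW_eq {V : R3 → ℝ} {μ : ℝ} {W : L2Fermi μ →L[ℂ] L2Fermi μ} (hW : HasFormW V μ W) :
    opW V μ = W := by
  have h : ∃ W, HasFormW V μ W := ⟨W, hW⟩
  rw [opW, dif_pos h]
  exact h.choose_spec.unique hW

lemma nontrivial_of_sInf_spectrum_neg {H : Type*} [NormedAddCommGroup H] [InnerProductSpace ℂ H]
    [CompleteSpace H] {A : H →L[ℂ] H} (h : sInf (spectrum ℝ A) < 0) : Nontrivial H := by
  by_contra hn
  rw [not_nontrivial_iff_subsingleton] at hn
  rw [spectrum.of_subsingleton, Real.sInf_empty] at h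
  exact lt_irrefl _ h

lemma sInf_spectrum_fermi {V : R3 → ℝ} (hV : MemLp V 1) {μ : ℝ} (hμ : 0 < μ)
    [Nontrivial (L2Fermi μ)] :
    firstOrderInf (fermiTrace hV μ) (signOp hV.1) = √μ * eMu V μ := by
  have hs : 0 < √μ := Real.sqrt_pos.2 hμ
  have h := (isSelfAdjoint_signOp hV.1).conj_adjoint (fermiTrace hV μ)
  have e : opV V μ = (√μ)⁻¹ •
      (fermiTrace hV μ ∘L signOp hV.1 ∘L adjoint (fermiTrace hV μ)) := by
    rw [fermiTrace_signOp_adjoint hV hμ, smul_smul, inv_mul_cancel₀ hs.ne', one_smul]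
  have h2 := sInf_spectrum_smul h (inv_pos.2 hs)
  have h3 : eMu V μ = (√μ)⁻¹ * firstOrderInf (fermiTrace hV μ) (signOp hV.1) := by
    refine Eq.trans ?_ h2
    rw [eMu, infSpec, e]
    rfl
  rw [h3, mul_inv_cancel_left₀ hs.ne']

/-- `b_μ(λ)` in terms of the second order expansion of the reduced operator. -/
lemma bMu_eq {V : R3 → ℝ} (hV : MemLp V 1) {μ lam : ℝ} (hμ : 0 < μ) (hlam : 0 < lam)
    [Nontrivial (L2Fermi μ)] {R : L2R3 →L[ℂ] L2R3} (hR : IsSelfAdjoint R)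
    (hW : opW V μ = fermiTrace hV μ ∘L (signOp hV.1 * R * signOp hV.1) ∘L
      adjoint (fermiTrace hV μ)) :
    bMu V μ lam = lam * (π / (2 * μ)) *
      secondOrderInf (fermiTrace hV μ) (signOp hV.1) R lam := by
  have hs : 0 < √μ := Real.sqrt_pos.2 hμ
  have h := isSelfAdjoint_secondOrder (fermiTrace hV μ) (isSelfAdjoint_signOp hV.1) hR lam
  have hc : 0 < lam * (π / (2 * μ)) := by positivity
  have e : opB V μ lam = (lam * (π / (2 * μ))) •
      (fermiTrace hV μ ∘L signOp hV.1 ∘L adjoint (fermiTrace hV μ)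
        - lam • (fermiTrace hV μ ∘L (signOp hV.1 * R * signOp hV.1) ∘L
          adjoint (fermiTrace hV μ))) := by
    rw [opB, ← hW, fermiTrace_signOp_adjoint hV hμ, smul_sub, smul_smul, smul_smul]
    congr 2
    · have : μ = √μ * √μ := (Real.mul_self_sqrt hμ.le).symm
      rw [show lam * (π / (2 * μ)) * √μ = lam * (π / (2 * (√μ * √μ))) * √μ by rw [← this]]
      field_simp
    · ring
  have h2 := sInf_spectrum_smul h hc
  rw [secondOrderInf, ← h2, bMu, infSpec, e]
  rfl

/-- Nonnegativity of the form passes to weaker coupling. -/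
lemma zero_le_infSpecKV_of_le {V : R3 → ℝ} (hV : MemLp V (3 / 2)) {T μ l l' : ℝ} (hT : 0 < T)
    (hμ : 0 < μ) (hl' : 0 < l') (hle : l' ≤ l) (h : 0 ≤ infSpecKV V μ l T) :
    0 ≤ infSpecKV V μ l' T := by
  rw [zero_le_infSpecKV_iff hV hT hμ (hl'.trans_le hle)] at h
  rw [zero_le_infSpecKV_iff hV hT hμ hl']
  intro f
  have h1 := h f
  rcases le_total 0 (inner ℂ f
    ((adjoint (bsOp hV hT hμ) ∘L signOp hV.1 ∘L bsOp hV hT hμ) f)).re with h0 | h0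
  · positivity
  · have := mul_le_mul_of_nonpos_right hle h0
    linarith

lemma eventually_zero_le_infSpecKV {V : R3 → ℝ} (hV : MemLp V (3 / 2)) {T μ : ℝ} (hT : 0 < T)
    (hμ : 0 < μ) : ∀ᶠ l in 𝓝[>] (0 : ℝ), 0 ≤ infSpecKV V μ l T := by
  set B : ℝ := ‖bsOp hV hT hμ‖ ^ 2 + 1 with hB
  have hB0 : 0 < B := by positivity
  filter_upwards [Ioo_mem_nhdsGT (one_div_pos.2 hB0)] with l hl
  rw [zero_le_infSpecKV_iff hV hT hμ hl.1]
  intro f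
  have h1 := (abs_le.1 (abs_re_inner_bsOp_le hV hT hμ f)).1
  have h2 : ‖bsOp hV hT hμ f‖ ^ 2 ≤ B * ‖f‖ ^ 2 := by
    have h3 := (bsOp hV hT hμ).le_opNorm f
    calc ‖bsOp hV hT hμ f‖ ^ 2 ≤ (‖bsOp hV hT hμ‖ * ‖f‖) ^ 2 := by gcongr
      _ = ‖bsOp hV hT hμ‖ ^ 2 * ‖f‖ ^ 2 := mul_pow _ _ _
      _ ≤ B * ‖f‖ ^ 2 := by gcongr; linarith
  have h4 := mul_le_mul_of_nonneg_left (h1.trans' (neg_le_neg h2)) hl.1.le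
  have h5 : l * B ≤ 1 := ((lt_div_iff₀ hB0).1 hl.2).le
  nlinarith [mul_le_mul_of_nonneg_right h5 (sq_nonneg ‖f‖)]

open Classical in
/-- The bottom of the reduced Birman–Schwinger operator at temperature `T` and coupling `l`. -/
def reducedBottom {V : R3 → ℝ} (hV1 : MemLp V 1) (hV : MemLp V (3 / 2)) {μ : ℝ} (hμ : 0 < μ)
    (T l : ℝ) : ℝ :=
  if hT : 0 < T then reducedInf (fermiTrace hV1 μ) (signOp hV1.1) (remOp hV1 hV hT hμ) l else 0

/-- The statement on the critical temperature, in terms of the zero temperature limit `R` of the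
regular part of the Birman–Schwinger operator. -/
lemma criticalTemperature_asymptotics {V : R3 → ℝ} (hV1 : MemLp V 1) (hV : MemLp V (3 / 2)) {μ : ℝ}
    (hμ : 0 < μ) (he : eMu V μ < 0) [Nontrivial (L2Fermi μ)] {R : L2R3 →L[ℂ] L2R3}
    (hR : IsSelfAdjoint R) (hlim : ∀ T (hT : 0 < T), T ≤ 1 →
        ‖remOp hV1 hV hT hμ - R‖ ≤ lipConst V μ * thermalErr μ T + T) :
    (∀ l, 0 < l → 0 < criticalTemperature V μ l) ∧
      Tendsto (fun l => Real.log (μ / criticalTemperature V μ l)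
        + √μ / (l * secondOrderInf (fermiTrace hV1 μ) (signOp hV1.1) R l)) (𝓝[>] 0)
        (𝓝 (2 - Real.eulerMascheroniConstant - Real.log (8 / π))) := by
  have hκ : 0 < √μ := Real.sqrt_pos.2 hμ
  have hs := isSelfAdjoint_signOp hV1.1
  have hs2 := signOp_mul_self hV1.1
  have hs1 := norm_signOp_le hV1.1
  set F := fermiTrace hV1 μ with hF
  set s := signOp hV1.1 with hsdef
  set e₀ : ℝ := √μ * eMu V μ with he₀
  have he₀' : e₀ < 0 := mul_neg_of_pos_of_neg hκ he
  have hbot : firstOrderInf F s = e₀ := sInf_spectrum_fermi hV1 hμ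
  set ε : ℝ → ℝ := fun T => lipConst V μ * thermalErr μ T + T with hεdef
  have hε : Tendsto ε (𝓝[>] 0) (𝓝 0) := by
    have h1 := ((tendsto_thermalErr hμ).const_mul (lipConst V μ)).add
      (tendsto_id.mono_left (nhdsWithin_le_nhds (a := (0 : ℝ)) (s := Ioi 0)))
    simpa using h1
  set c : ℝ → ℝ := fun T => radialM μ T / μ with hcdef
  have hc : Tendsto (fun T => c T * √μ - Real.log (μ / T)) (𝓝[>] 0)
      (𝓝 (-(2 - Real.eulerMascheroniConstant - Real.log (8 / π)))) := by
    have h := tendsto_radialM hμ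
    rw [show Real.eulerMascheroniConstant - 2 + Real.log (8 / π)
      = -(2 - Real.eulerMascheroniConstant - Real.log (8 / π)) by ring] at h
    refine h.congr fun T => ?_
    congr 1
    rw [hcdef, div_mul_eq_mul_div, div_eq_div_iff hκ.ne' hμ.ne', mul_assoc,
      Real.mul_self_sqrt hμ.le]
  have hcpos : ∀ᶠ T in 𝓝[>] (0 : ℝ), 0 < c T := by
    have hlog : Tendsto (fun T : ℝ => Real.log (μ / T)) (𝓝[>] 0) atTop := by
      refine Real.tendsto_log_atTop.comp ?_
      refine (tendsto_inv_nhdsGT_zero.const_mul_atTop hμ).congr fun T => ?_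
      rw [div_eq_mul_inv]
    filter_upwards [(hc.add_atTop hlog).eventually_gt_atTop 0] with T hT
    rw [sub_add_cancel] at hT
    exact pos_of_mul_pos_left hT hκ.le
  obtain ⟨τ', hτ', hτ''⟩ := mem_nhdsGT_iff_exists_Ioo_subset.1
    ((hε.eventually (gt_mem_nhds one_pos)).and hcpos)
  have hτ'0 : 0 < τ' := hτ'
  set τ := min τ' 1 with hτdef
  have hτ : 0 < τ := lt_min hτ'0 one_pos
  set B : ℝ := ‖R‖ + 1 with hB
  have hB0 : 0 < B := by positivity
  have hnear : ∀ T (hT : 0 < T), T < τ → ‖remOp hV1 hV hT hμ - R‖ ≤ ε T ∧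
      ‖remOp hV1 hV hT hμ‖ ≤ B ∧ 0 < c T := by
    intro T hT hTτ
    obtain ⟨h1, h2⟩ := hτ'' ⟨hT, hTτ.trans_le (min_le_left _ _)⟩
    have h3 := hlim T hT (hTτ.le.trans (min_le_right _ _))
    refine ⟨h3, ?_, h2⟩
    have h4 := norm_add_le (remOp hV1 hV hT hμ - R) R
    rw [sub_add_cancel] at h4
    have h5 : ε T < 1 := h1
    linarith
  -- for these couplings the reduced operators are defined and stay below `e₀ / 2`
  set Λ : ℝ := min (1 / (2 * B)) (-e₀ / (8 * ‖F‖ ^ 2 * B + 1)) with hΛdef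
  have hΛ : 0 < Λ := lt_min (by positivity) (div_pos (neg_pos.2 he₀') (by positivity))
  have hΛ1 : ∀ l, 0 < l → l < Λ → l * B ≤ 1 / 2 := by
    intro l hl hlΛ
    have := (lt_div_iff₀ (by positivity)).1 (hlΛ.trans_le (min_le_left _ _))
    linarith
  have hΛ2 : ∀ l, 0 < l → l < Λ → 8 * ‖F‖ ^ 2 * B * l ≤ -e₀ := by
    intro l hl hlΛ
    have := (lt_div_iff₀ (by positivity)).1 (hlΛ.trans_le (min_le_right _ _))
    nlinarith
  have hsmallR : ∀ T (hT : 0 < T), T < τ → ∀ l, 0 < l → l < Λ →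
      l * ‖remOp hV1 hV hT hμ‖ ≤ 1 / 2 := fun T hT hTτ l hl hlΛ =>
    (mul_le_mul_of_nonneg_left (hnear T hT hTτ).2.1 hl.le).trans (hΛ1 l hl hlΛ)
  have hFB : ∀ x, x ≤ B → ‖F‖ ^ 2 * x ≤ ‖F‖ ^ 2 * B := fun x hx =>
    mul_le_mul_of_nonneg_left hx (sq_nonneg _)
  refine threshold_asymptotics (P := fun l T => 0 ≤ infSpecKV V μ l T) (ε := ε) (c := c)
    (g := reducedBottom hV1 hV hμ) (C := ‖F‖ ^ 2 * (2 * B ^ 2 + 1)) (e := e₀ / 2) hμ hκ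
    (by linarith) (fun l => rfl) (fun l hl => exists_zero_le_infSpecKV hV hμ hl)
    (fun T hT => eventually_zero_le_infSpecKV hV hT hμ)
    (fun l l' T hl' hle hT h => zero_le_infSpecKV_of_le hV hT hμ hl' hle h) hτ hΛ
    ?_ ?_ ?_ ?_ ?_ hε hc
  · intro T l hT hTτ hl hlΛ hP
    rw [reducedBottom, dif_pos hT]
    exact neg_one_le_mul_reducedInf (bsOp_comp_adjoint hV1 hV hT hμ) hs
      (isSelfAdjoint_remOp hV1 hV hT hμ) hs2 hs1 hl (hsmallR T hT hTτ l hl hlΛ)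
      ((zero_le_infSpecKV_iff hV hT hμ hl).1 hP)
  · intro T l hT hTτ hl hlΛ hP
    rw [reducedBottom, dif_pos hT]
    refine mul_reducedInf_le_neg_one (bsOp_comp_adjoint hV1 hV hT hμ) hs
      (isSelfAdjoint_remOp hV1 hV hT hμ) hs2 hs1 (hnear T hT hTτ).2.2 hl
      (hsmallR T hT hTτ l hl hlΛ) (fun h => hP ((zero_le_infSpecKV_iff hV hT hμ hl).2 h)) ?_
    rw [reducedInf_zero F hs (isSelfAdjoint_remOp hV1 hV hT hμ) hs2 hs1, hbot]
    have h1 := hFB _ (hnear T hT hTτ).2.1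
    have h2 := hΛ2 l hl hlΛ
    nlinarith
  · intro T l hT hTτ hl hlΛ
    rw [reducedBottom, dif_pos hT]
    obtain ⟨h1, h2, -⟩ := hnear T hT hTτ
    refine (abs_reducedInf_sub_secondOrderInf_le F hs (isSelfAdjoint_remOp hV1 hV hT hμ) hR hs2 hs1
      (by rw [abs_of_pos hl]; exact hsmallR T hT hTτ l hl hlΛ)).trans ?_
    rw [abs_of_pos hl, mul_assoc (‖F‖ ^ 2)]
    refine mul_le_mul_of_nonneg_left ?_ (sq_nonneg _)
    have h0 : 0 ≤ ε T := (norm_nonneg _).trans h1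
    calc 2 * l ^ 2 * ‖remOp hV1 hV hT hμ‖ ^ 2 + l * ‖remOp hV1 hV hT hμ - R‖
        ≤ 2 * l ^ 2 * B ^ 2 + l * ε T := by gcongr
      _ ≤ (2 * B ^ 2 + 1) * (l ^ 2 + l * ε T) := by
        nlinarith [mul_nonneg (sq_nonneg B) (mul_nonneg hl.le h0), sq_nonneg l]
  · intro T l hT hTτ hl hlΛ
    rw [reducedBottom, dif_pos hT]
    have hRT := isSelfAdjoint_remOp hV1 hV hT hμ
    have h1 := abs_reducedInf_sub_le F hs hRT hs2 hs1 (a := l) (b := 0)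
      (by rw [abs_of_pos hl]; exact hsmallR T hT hTτ l hl hlΛ) (by simp)
    rw [reducedInf_zero F hs hRT hs2 hs1, hbot, sub_zero, abs_of_pos hl] at h1
    have h2 := hFB _ (hnear T hT hTτ).2.1
    have h3 := hΛ2 l hl hlΛ
    have h4 := (abs_le.1 h1).2
    nlinarith
  · intro l hl hlΛ
    have h1 := abs_secondOrderInf_sub_le F hs hR hs1 l
    rw [hbot, abs_of_pos hl] at h1
    have h2 := hFB ‖R‖ (by linarith)
    have h3 := hΛ2 l hl hlΛ
    have h4 := (abs_le.1 h1).2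
    have h5 : 0 ≤ ‖F‖ ^ 2 * B * l := by positivity
    nlinarith

end BCS

end

theorem theorem1 (V : BCS.R3 → ℝ) (hV1 : MemLp V 1) (hV2 : MemLp V (3 / 2)) (μ : ℝ) (hμ : 0 < μ)
    (he : BCS.eMu V μ < 0) :
    BCS.HasFormW V μ (BCS.opW V μ) ∧
    (∀ lam : ℝ, 0 < lam → 0 < BCS.criticalTemperature V μ lam) ∧
    Tendsto
      (fun lam : ℝ => Real.log (μ / BCS.criticalTemperature V μ lam)
        + π / (2 * √μ * BCS.bMu V μ lam))
      (𝓝[>] 0) (𝓝 (2 - Real.eulerMascheroniConstant - Real.log (8 / π))) := by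
  have hΩ : Nontrivial (BCS.L2Fermi μ) := BCS.nontrivial_of_sInf_spectrum_neg he
  obtain ⟨R, hR, hq, hlim⟩ := BCS.exists_remOp_limit hV1 hV2 hμ
  have hform := BCS.hasFormW_of_limit hV1 hR hq
  have hW := BCS.opW_eq hform
  obtain ⟨hpos, htend⟩ := BCS.criticalTemperature_asymptotics hV1 hV2 hμ he hR hlim
  refine ⟨by rw [hW]; exact hform, hpos, htend.congr' ?_⟩
  filter_upwards [self_mem_nhdsWithin] with l hl
  have hl0 : 0 < l := hl
  have hs : 0 < √μ := Real.sqrt_pos.2 hμ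
  rw [BCS.bMu_eq hV1 hμ hl0 hR hW]
  congr 1
  rcases eq_or_ne (BCS.secondOrderInf (BCS.fermiTrace hV1 μ) (BCS.signOp hV1.1) R l) 0 with h0 | h0
  · simp [h0]
  · have hμs : √μ * √μ = μ := Real.mul_self_sqrt hμ.le
    rw [div_eq_div_iff (by positivity) (by positivity)]
    field_simp
    rw [sq, hμs]
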